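/- Let $d\ge 1$, $\sigma\in(0,2)$, and let $\chi_\sigma(y)=0$ if $\sigma<1$, $\chi_1(y)=1_{\{|y|\le 1\}}$, and $\chi_\sigma(y)=1$ if $\sigma>1$. Let $\mathfrak A^\sigma$ be the class of measures $\pi\ge 0$ on $\mathbf R^d\setminus\{0\}$ with $\int(|y|^2\wedge 1)\,d\pi<\infty$ and $\sigma=\inf\{\alpha<2:\int_{|y|\le 1}|y|^\alpha d\pi<\infty\}$, such that in addition $\int_{|y|>1}|y|\,d\pi<\infty$ if $\sigma>1$, and $\int_{R<|y|\le R'}y\,d\pi=0$ for all $0<R<R'<\infty$ if $\sigma=1$. For $\pi\in\mathfrak A^\sigma$ put $$L^\pi f(x)=\int[f(x+y)-f(x)-\chi_\sigma(y)\,y\cdot\nabla f(x)]\,\pi(dy),\qquad \psi^\pi(\xi)=\int[e^{i2\pi\xi\cdot y}-1-i2\pi\chi_\sigma(y)\,\xi\cdot y]\,\pi(dy),$$ let $Z^\pi_t$ be the Lévy process with $\mathbf E e^{i2\pi\xi\cdot Z^\pi_t}=e^{t\psi^\pi(\xi)}$, and for $R>0$ let $\pi_R(\Gamma)=\int 1_\Gamma(y/R)\,\pi(dy)$.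 Let $\kappa:(0,\infty)\to(0,\infty)$ be a scaling function with scaling factor $l$: $\kappa$ is continuous, $\kappa(R)\to 0$ as $R\to 0$, $\kappa(R)\to\infty$ as $R\to\infty$, $l$ is continuous and nondecreasing on $(0,\infty)$, $l(\varepsilon)\to 0$ as $\varepsilon\to 0$, and $\kappa(\varepsilon r)\le l(\varepsilon)\kappa(r)$ for all $\varepsilon,r>0$. Let $\gamma(t)=\inf\{r>0:l(r)\ge t\}$ and $\tilde\pi_R=\kappa(R)\pi_R$. Let $\pi\in\mathfrak A^\sigma$ satisfy the following two assumptions. $\mathbf D(\kappa,l)$: there is a measure $\mu^0\in\bigcup_{\sigma'\in(0,2)}\mathfrak A^{\sigma'}$ carried by $\{|y|\le 1\}$ such that $\tilde\pi_R\ge\mu^0$ for every $R>0$; for some constants $n_0$ and $c_1>0$, $$\int|y|^2\mu^0(dy)+\int|\xi|^4[1+\lambda(\xi)]^{d+3}e^{-\psi_0(\xi)}\,d\xi\le n_0,\qquad \int|\xi\cdot y|^2\mu^0(dy)\ge c_1\ \text{ for all } |\xi|=1,$$ where $\psi_0(\xi)=\int[1-\cos(2\pi\xi\cdot y)]\,\mu^0(dy)$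 and $\lambda(\xi)=\int\chi_\sigma(y)|y|[(|\xi||y|)\wedge 1]\,\mu^0(dy)$; and, if $\sigma=1$, $\int_{R<|y|\le R'}y\,\mu^0(dy)=0$ for all $0<R<R'\le 1$. $\mathbf B(\kappa,l)$: there are $\alpha_1,\alpha_2$ and $N_0>0$ such that $\int_{|z|\le 1}|z|^{\alpha_1}\tilde\pi_R(dz)+\int_{|z|>1}|z|^{\alpha_2}\tilde\pi_R(dz)\le N_0$ for all $R>0$, where $\alpha_1,\alpha_2\in(0,1]$ if $\sigma<1$; $\alpha_1,\alpha_2\in(1,2]$ if $\sigma>1$; $\alpha_1\in(1,2]$ and $\alpha_2\in[0,1)$ if $\sigma=1$. Assume $\int_1^\infty\gamma(t)^{-1}dt<\infty$. Then, for all $R,t>0$, $Z_t^{\tilde\pi_R}$ has a continuous probability density $p^R(t,\cdot)$, and for $z\ne 0$ and $\hat z=z/|z|$ the kernel $$k^{\pi;1}(y,z)=\kappa(|z|)\,|z|^{-d}\int_0^\infty\Big[p^{|z|}\Big(t,\frac{y}{|z|}+\hat z\Big)-p^{|z|}\Big(t,\frac{y}{|z|}\Big)\Big]dt$$ is well defined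 (the integral converges absolutely) for a.e. $y$ and is integrable in $y\in\mathbf R^d$. There is a constant $c>0$ such that for all real-valued Schwartz functions $f$ on $\mathbf R^d$ $$f(x+z)-f(x)=-c\int L^\pi f(x-y)\,k^{\pi;1}(-y,-z)\,dy,\qquad x\in\mathbf R^d,\ z\ne 0,$$ where the integral converges absolutely. Moreover, $L^\pi f$ is bounded, and there is a constant $C>0$ such that for all such $f$ $$|f(x+z)-f(x)|\le C\,|L^\pi f|_\infty\,\kappa(|z|),\qquad x\in\mathbf R^d,\ z\ne 0,$$ where $|L^\pi f|_\infty=\sup_x|L^\pi f(x)|$. -/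

import Mathlib

open MeasureTheory Set Filter Topology
open scoped ENNReal SchwartzMap

noncomputable section

namespace LevyIncrement

/-- The Euclidean space `ℝ^d`. -/
abbrev E (d : ℕ) := EuclideanSpace ℝ (Fin d)

/-- The truncation function `χ_σ`: `0` for `σ < 1`, the indicator of `{|y| ≤ 1}` for `σ = 1`, and
`1` for `σ > 1`. -/
def chi {d : ℕ} (σ : ℝ) (y : E d) : ℝ :=
  if σ < 1 then 0 else if σ = 1 then (if ‖y‖ ≤ 1 then 1 else 0) else 1

/-- The class `𝔄^σ` of Lévy measures on `ℝ^d \ {0}` of order `σ`; a measure on `ℝ^d \ {0}` is a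
Borel measure on `ℝ^d` that does not charge the origin. -/
structure IsLevyMeasure {d : ℕ} (σ : ℝ) (π : Measure (E d)) : Prop where
  zero : π {0} = 0
  finite : ∫⁻ y, ENNReal.ofReal (min (‖y‖ ^ 2) 1) ∂π < ∞
  order : IsGLB {α : ℝ | α < 2 ∧ ∫⁻ y in {y | ‖y‖ ≤ 1}, ENNReal.ofReal (‖y‖ ^ α) ∂π < ∞} σ
  tail : 1 < σ → ∫⁻ y in {y | 1 < ‖y‖}, ENNReal.ofReal ‖y‖ ∂π < ∞
  centered : σ = 1 → ∀ R R' : ℝ, 0 < R → R < R' → ∫ y in {y | R < ‖y‖ ∧ ‖y‖ ≤ R'}, y ∂π = 0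

/-- The integro-differential operator `L^π`. -/
def levyOp {d : ℕ} (σ : ℝ) (π : Measure (E d)) (f : E d → ℝ) (x : E d) : ℝ :=
  ∫ y, (f (x + y) - f x - chi σ y * fderiv ℝ f x y) ∂π

/-- The symbol `ψ^π` of `L^π`. -/
def symbol {d : ℕ} (σ : ℝ) (π : Measure (E d)) (ξ : E d) : ℂ :=
  ∫ y, (Complex.exp (2 * Real.pi * (inner ℝ ξ y : ℝ) * Complex.I) - 1
    - 2 * Real.pi * (chi σ y : ℝ) * (inner ℝ ξ y : ℝ) * Complex.I) ∂π

/-- `q` is the continuous probability density of `Z_t^π`, the value at time `t` of the Lévy process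
associated to `L^π`: its law has characteristic function `E exp(i 2π ξ·Z_t) = exp(t ψ^π(ξ))`. -/
structure IsLevyDensity {d : ℕ} (σ : ℝ) (π : Measure (E d)) (t : ℝ) (q : E d → ℝ) : Prop where
  continuous : Continuous q
  nonneg : ∀ x, 0 ≤ q x
  prob : IsProbabilityMeasure (volume.withDensity fun x => ENNReal.ofReal (q x))
  charFun_eq : ∀ ξ : E d,
    charFun (volume.withDensity fun x => ENNReal.ofReal (q x)) ((2 * Real.pi) • ξ)
      = Complex.exp (t * symbol σ π ξ)

/-- The probability density function `p^π(t, ·)` of `Z_t^π` (a meaningful value when a continuous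
density exists; it is then unique). -/
def levyDensity {d : ℕ} (σ : ℝ) (π : Measure (E d)) (t : ℝ) : E d → ℝ :=
  Classical.epsilon (IsLevyDensity σ π t)

/-- `κ` is a scaling function with scaling factor `l` (both are functions on `(0, ∞)`; their values
elsewhere play no role). -/
structure IsScalingFunction (κ l : ℝ → ℝ) : Prop where
  pos : ∀ r, 0 < r → 0 < κ r
  continuousOn : ContinuousOn κ (Ioi 0)
  tendsto_zero : Tendsto κ (𝓝[>] 0) (𝓝 0)
  tendsto_atTop : Tendsto κ atTop atTop
  factor_mono : MonotoneOn l (Ioi 0)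
  factor_continuousOn : ContinuousOn l (Ioi 0)
  factor_tendsto_zero : Tendsto l (𝓝[>] 0) (𝓝 0)
  scaling : ∀ ε r, 0 < ε → 0 < r → κ (ε * r) ≤ l ε * κ r

/-- The generalized inverse `γ(t) = inf {r > 0 : l(r) ≥ t}` of the scaling factor. -/
def scalingInv (l : ℝ → ℝ) (t : ℝ) : ℝ := sInf {r : ℝ | 0 < r ∧ t ≤ l r}

/-- The rescaled measure `κ(R) π_R`, where `π_R(Γ) = ∫ 1_Γ(y / R) π(dy)`. -/
def rescaled {d : ℕ} (κ : ℝ → ℝ) (π : Measure (E d)) (R : ℝ) : Measure (E d) :=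
  ENNReal.ofReal (κ R) • π.map (fun y => R⁻¹ • y)

/-- `ψ_0(ξ) = ∫_{|y| ≤ 1} (1 - cos (2π ξ·y)) μ⁰(dy)`. -/
def psiZero {d : ℕ} (μ₀ : Measure (E d)) (ξ : E d) : ℝ :=
  ∫ y in {y | ‖y‖ ≤ 1}, (1 - Real.cos (2 * Real.pi * inner ℝ ξ y)) ∂μ₀

/-- `λ(ξ) = ∫_{|y| ≤ 1} χ_σ(y) |y| ((|ξ| |y|) ∧ 1) μ⁰(dy)`. -/
def lambdaZero {d : ℕ} (σ : ℝ) (μ₀ : Measure (E d)) (ξ : E d) : ℝ :=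
  ∫ y in {y | ‖y‖ ≤ 1}, chi σ y * ‖y‖ * min (‖ξ‖ * ‖y‖) 1 ∂μ₀

/-- Assumption `A₀(σ)` on the auxiliary Lévy measure, with constants `n₀` and `c₁`. -/
structure AssumptionA₀ {d : ℕ} (σ : ℝ) (μ₀ : Measure (E d)) (n₀ c₁ : ℝ) : Prop where
  levy : ∃ σ' ∈ Ioo (0 : ℝ) 2, IsLevyMeasure σ' μ₀
  support : μ₀.restrict {y | ‖y‖ ≤ 1} = μ₀
  bound : ∫⁻ y, ENNReal.ofReal (‖y‖ ^ 2) ∂μ₀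
    + ∫⁻ ξ, ENNReal.ofReal (‖ξ‖ ^ 4 * (1 + lambdaZero σ μ₀ ξ) ^ (d + 3)
        * Real.exp (-psiZero μ₀ ξ)) ≤ ENNReal.ofReal n₀
  pos : 0 < c₁
  nondegenerate : ∀ ξ : E d, ‖ξ‖ = 1 → c₁ ≤ ∫ y in {y | ‖y‖ ≤ 1}, |inner ℝ ξ y| ^ 2 ∂μ₀

/-- Assumption `D(κ, l)`. -/
def AssumptionD {d : ℕ} (σ : ℝ) (κ : ℝ → ℝ) (π : Measure (E d)) : Prop :=
  ∃ (μ₀ : Measure (E d)) (n₀ c₁ : ℝ), AssumptionA₀ σ μ₀ n₀ c₁ ∧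
    (∀ R, 0 < R → μ₀.restrict {y | ‖y‖ ≤ 1} ≤ rescaled κ π R) ∧
    (σ = 1 → ∀ R R' : ℝ, 0 < R → R < R' → R' ≤ 1 →
      ∫ y in {y | R < ‖y‖ ∧ ‖y‖ ≤ R'}, y ∂μ₀ = 0)

/-- Assumption `B(κ, l)`. -/
def AssumptionB {d : ℕ} (σ : ℝ) (κ : ℝ → ℝ) (π : Measure (E d)) : Prop :=
  ∃ α₁ α₂ N₀ : ℝ, 0 < N₀ ∧
    (σ < 1 → α₁ ∈ Ioc 0 1 ∧ α₂ ∈ Ioc 0 1) ∧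
    (1 < σ → α₁ ∈ Ioc 1 2 ∧ α₂ ∈ Ioc 1 2) ∧
    (σ = 1 → α₁ ∈ Ioc 1 2 ∧ α₂ ∈ Ico 0 1) ∧
    ∀ R, 0 < R →
      ∫⁻ z in {z | ‖z‖ ≤ 1}, ENNReal.ofReal (‖z‖ ^ α₁) ∂(rescaled κ π R)
        + ∫⁻ z in {z | 1 < ‖z‖}, ENNReal.ofReal (‖z‖ ^ α₂) ∂(rescaled κ π R)
      ≤ ENNReal.ofReal N₀

/-- The integrand, in `t`, of the kernel:
`t^δ (p^{|z|}(t, y/|z| + z/|z|) - p^{|z|}(t, y/|z|)) / t`, where `p^R(t, ·)` is the density of the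
Lévy process with Lévy measure `κ(R) π_R`. -/
def kernelIntegrand {d : ℕ} (σ : ℝ) (κ : ℝ → ℝ) (π : Measure (E d)) (δ : ℝ) (y z : E d)
    (t : ℝ) : ℝ :=
  t ^ δ * (levyDensity σ (rescaled κ π ‖z‖) t (‖z‖⁻¹ • y + ‖z‖⁻¹ • z)
    - levyDensity σ (rescaled κ π ‖z‖) t (‖z‖⁻¹ • y)) / t

/-- The kernel `k^{π;δ}(y, z) = κ(|z|)^δ |z|^{-d} ∫_0^∞ (...) dt`, for `z ≠ 0`. -/
def kernel {d : ℕ} (σ : ℝ) (κ : ℝ → ℝ) (π : Measure (E d)) (δ : ℝ) (y z : E d) : ℝ :=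
  κ ‖z‖ ^ δ * (‖z‖ ^ d)⁻¹ * ∫ t in Ioi (0 : ℝ), kernelIntegrand σ κ π δ y z t

end LevyIncrement

end

open MeasureTheory Set Filter Topology
open scoped ENNReal SchwartzMap

noncomputable section

namespace LevyIncrement

/-! Fix z, put R = |z|, and let P_t be the semigroup of the dilated process R·Z_t with Lévy measure
κ(R)π_R for Z. Its symbol is ψ^{κ(R)π_R}(Rξ) = κ(R)ψ^π(ξ); for σ = 1 this uses that π is centered on
shells. So P_t has generator κ(R)L^π, and the derivative in t of P_t[f(·+z) - f](x) is κ(R)P_t[L^π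
f(·+z) - L^π f](x). Integrating over (0,∞) gives f(x+z) - f(x) up to sign, provided the boundary
value at infinity vanishes. Moving the shift by z from L^π f onto the density and exchanging the
time and space integrals produces the kernel, with c = 1 (`increment_eq`).

Everything rests on one estimate (`exists_lintegral_increment_le`): for |h| = 1 the L¹ norm in x of
p^R(t,x+h) - p^R(t,x) has an integral over t in (0,∞) bounded uniformly in R. For t ≤ 1 the norm is
at most 2. For larger t, take r with l(r) ≤ t. Domination at radius rR and κ(rR) ≤ l(r)κ(R) show
that tκ(R)π_R dominates the image of μ⁰ under dilation by r (`map_smul_le_rescaled`). Hence p^R(t,·)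
is the r-dilate of the density p⁰ with transform exp ψ^{μ⁰}, convolved with a probability measure
(`exists_factorization`), and its L¹ increment is at most r⁻¹‖∇p⁰‖₁. The choice r = γ(t)/2 makes
this integrable on (1,∞) by hypothesis. The kernel then has L¹ norm at most Kκ(|z|), which gives the
final bound.

That ∇p⁰ is integrable comes from the moment condition on μ⁰ (`smooth_aux_density`): the derivatives
of exp ψ^{μ⁰} up to order d+3 are bounded by a multiple of (1+λ)^{d+3}exp(-ψ_0), so
|x|^{d+1}|∇p⁰(x)| is bounded. The laws themselves are built from compound Poisson laws by the
continuity theorem, and their densities by Fourier inversion. -/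

open scoped FourierTransform ContDiff

/-! ### Integrability, growth and continuity of the symbol. -/

section Symbols

variable {d : ℕ} {σ : ℝ} {ν ν' : Measure (E d)}

/-- The integrand of the symbol `ψ^π(ξ)`. -/
def levyIntegrand (σ : ℝ) (ξ y : E d) : ℂ :=
  Complex.exp (2 * Real.pi * (inner ℝ ξ y : ℝ) * Complex.I) - 1
    - 2 * Real.pi * (chi σ y : ℝ) * (inner ℝ ξ y : ℝ) * Complex.I

/-- A weight in `y` dominating the integrand of the symbol, locally uniformly in `ξ`. -/
def levyWeight (σ : ℝ) (y : E d) : ℝ :=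
  if σ < 1 then min ‖y‖ 1 else if σ = 1 then min (‖y‖ ^ 2) 1 else min (‖y‖ ^ 2) ‖y‖

/-- Measures not charging the origin whose symbol is given by an absolutely convergent integral. -/
structure Admissible (σ : ℝ) (ν : Measure (E d)) : Prop where
  zero : ν {0} = 0
  finite : ∫⁻ y, ENNReal.ofReal (levyWeight σ y) ∂ν < ⊤

lemma symbol_eq_integral (ξ : E d) : symbol σ ν ξ = ∫ y, levyIntegrand σ ξ y ∂ν := rfl

lemma levyWeight_nonneg (y : E d) : 0 ≤ levyWeight σ y := by
  unfold levyWeight; split_ifs <;> positivity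

lemma levyWeight_pos {y : E d} (hy : y ≠ 0) : 0 < levyWeight σ y := by
  have : 0 < ‖y‖ := norm_pos_iff.2 hy
  unfold levyWeight; split_ifs <;> positivity

@[fun_prop]
lemma continuous_levyWeight : Continuous (levyWeight (d := d) σ) := by
  unfold levyWeight; split_ifs <;> fun_prop

@[fun_prop]
lemma measurable_chi : Measurable (chi (d := d) σ) := by
  unfold chi
  split_ifs
  · fun_prop
  · exact Measurable.ite (measurableSet_le measurable_norm measurable_const) measurable_const
      measurable_const
  · fun_prop

lemma measurable_levyIntegrand (ξ : E d) : Measurable (levyIntegrand σ ξ) := by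
  unfold levyIntegrand
  have h2 : Measurable (fun y : E d => (inner ℝ ξ y : ℝ)) := by fun_prop
  fun_prop

lemma continuous_levyIntegrand (y : E d) : Continuous (fun ξ => levyIntegrand σ ξ y) := by
  unfold levyIntegrand; fun_prop

lemma norm_cexp_mul_I_sub_one_le (u : ℝ) : ‖Complex.exp (u * Complex.I) - 1‖ ≤ |u| := by
  have := Real.norm_exp_I_mul_ofReal_sub_one_le (x := u)
  rwa [mul_comm] at this

lemma norm_cexp_mul_I_sub_one_le_two (u : ℝ) : ‖Complex.exp (u * Complex.I) - 1‖ ≤ 2 := by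
  refine (norm_sub_le _ _).trans ?_
  rw [Complex.norm_exp_ofReal_mul_I]; norm_num

lemma norm_cexp_mul_I_sub_sub_le (u : ℝ) :
    ‖Complex.exp (u * Complex.I) - 1 - u * Complex.I‖ ≤ 2 * |u| := by
  refine (norm_sub_le _ _).trans ?_
  have := norm_cexp_mul_I_sub_one_le u
  simp only [norm_mul, Complex.norm_I, Complex.norm_real, Real.norm_eq_abs, mul_one]
  linarith

lemma norm_cexp_mul_I_sub_sub_le_sq (u : ℝ) :
    ‖Complex.exp (u * Complex.I) - 1 - u * Complex.I‖ ≤ 2 * u ^ 2 := by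
  rcases le_or_gt |u| 1 with h | h
  · have := Complex.norm_exp_sub_one_sub_id_le (x := u * Complex.I) (by simpa using h)
    simp only [norm_mul, Complex.norm_I, Complex.norm_real, Real.norm_eq_abs, mul_one,
      sq_abs] at this
    nlinarith [sq_nonneg u]
  · refine (norm_cexp_mul_I_sub_sub_le u).trans ?_
    nlinarith [sq_abs u]

lemma abs_two_pi_inner_le (ξ y : E d) :
    |2 * Real.pi * inner ℝ ξ y| ≤ 2 * Real.pi * ‖ξ‖ * ‖y‖ := by
  rw [abs_mul, abs_of_pos Real.two_pi_pos, mul_assoc (2 * Real.pi)]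
  exact mul_le_mul_of_nonneg_left (abs_real_inner_le_norm ξ y) Real.two_pi_pos.le

/-- The growth in `ξ` of the symbol. -/
def growth (ξ : E d) : ℝ := 2 * (1 + 2 * Real.pi * ‖ξ‖) ^ 2

/-- With u = 2πξ·y, the three cases use |e^{iu}-1| ≤ min(|u|, 2) when nothing is compensated,
|e^{iu}-1-iu| ≤ 2 min(u², |u|) under full compensation, and for σ = 1 one or the other according to
|y| ≤ 1. The factor `growth` dominates 2, 2a and 2a² with a = 2π|ξ|, so it serves all cases. -/
lemma norm_levyIntegrand_le (ξ y : E d) :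
    ‖levyIntegrand σ ξ y‖ ≤ growth ξ * levyWeight σ y := by
  set u : ℝ := 2 * Real.pi * inner ℝ ξ y with hu
  set a : ℝ := 2 * Real.pi * ‖ξ‖ with ha
  have ha0 : 0 ≤ a := by positivity
  have hua : |u| ≤ a * ‖y‖ := abs_two_pi_inner_le ξ y
  have hy := norm_nonneg y
  have hu2 : u ^ 2 ≤ a ^ 2 * ‖y‖ ^ 2 := by
    rw [← sq_abs, ← mul_pow]; exact pow_le_pow_left₀ (abs_nonneg _) hua 2
  have hform : levyIntegrand σ ξ y =
      Complex.exp (u * Complex.I) - 1 - (chi σ y : ℝ) * (u * Complex.I) := by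
    simp only [levyIntegrand, hu]; push_cast; ring_nf
  have e1 := norm_cexp_mul_I_sub_one_le u
  have e2 := norm_cexp_mul_I_sub_one_le_two u
  have e3 := norm_cexp_mul_I_sub_sub_le u
  have e4 := norm_cexp_mul_I_sub_sub_le_sq u
  have hg : growth ξ = 2 * (1 + a) ^ 2 := rfl
  have hg2 : 2 ≤ growth ξ := by rw [hg]; nlinarith
  have hga : 2 * a ≤ growth ξ := by rw [hg]; nlinarith
  have hga2 : 2 * a ^ 2 ≤ growth ξ := by rw [hg]; nlinarith
  have q1 : 2 * (a * ‖y‖) ≤ growth ξ * ‖y‖ := by nlinarith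
  have q2 : 2 * (a ^ 2 * ‖y‖ ^ 2) ≤ growth ξ * ‖y‖ ^ 2 := by nlinarith [sq_nonneg ‖y‖]
  have q3 : 0 ≤ a * ‖y‖ := by positivity
  rw [hform]
  unfold levyWeight chi
  split_ifs with h1 h2 h3
  · simp only [Complex.ofReal_zero, zero_mul, sub_zero]
    rw [mul_min_of_nonneg _ _ (by linarith)]
    exact le_min (by linarith) (by linarith)
  · simp only [Complex.ofReal_one, one_mul]
    have : ‖y‖ ^ 2 ≤ 1 := by nlinarith
    rw [min_eq_left this]; linarith
  · simp only [Complex.ofReal_zero, zero_mul, sub_zero]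
    have : 1 ≤ ‖y‖ ^ 2 := by nlinarith
    rw [min_eq_right this]; linarith
  · simp only [Complex.ofReal_one, one_mul]
    rw [mul_min_of_nonneg _ _ (by linarith)]
    exact le_min (by linarith) (by linarith)

lemma Admissible.integrable_weight (h : Admissible σ ν) : Integrable (levyWeight σ) ν := by
  refine ⟨continuous_levyWeight.aestronglyMeasurable, ?_⟩
  rw [hasFiniteIntegral_iff_ofReal (ae_of_all _ levyWeight_nonneg)]
  exact h.finite

/-- An integrable weight that vanishes only at the origin, a null point, forces σ-finiteness. Fubini
and Radon–Nikodym arguments below depend on it. -/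
lemma Admissible.sigmaFinite (h : Admissible σ ν) : SigmaFinite ν := by
  obtain ⟨t, ht, h0, hs⟩ := h.integrable_weight.aefinStronglyMeasurable.exists_set_sigmaFinite
  have hν : ν tᶜ = 0 := by
    have h1 : ∀ᵐ y ∂(ν.restrict tᶜ), y ≠ 0 := ae_restrict_of_ae (by
      rw [ae_iff]; simpa using h.zero)
    have h2 : ∀ᵐ y ∂(ν.restrict tᶜ), False := by
      filter_upwards [h0, h1] with y hy hy'
      exact (levyWeight_pos hy').ne' hy
    simpa [ae_iff] using h2
  rwa [Measure.restrict_eq_self_of_ae_mem (by rw [ae_iff]; exact hν)] at hs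

lemma Admissible.mono (h : Admissible σ ν) (hle : ν' ≤ ν) : Admissible σ ν' where
  zero := le_antisymm ((hle _).trans h.zero.le) bot_le
  finite := (lintegral_mono' hle le_rfl).trans_lt h.finite

lemma Admissible.smul (h : Admissible σ ν) {c : ℝ≥0∞} (hc : c ≠ ⊤) : Admissible σ (c • ν) where
  zero := by simp [h.zero]
  finite := by
    rw [lintegral_smul_measure]
    exact ENNReal.mul_lt_top hc.lt_top h.finite

lemma Admissible.integrable (h : Admissible σ ν) (ξ : E d) : Integrable (levyIntegrand σ ξ) ν :=
  (h.integrable_weight.const_mul (growth ξ)).mono'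
    (measurable_levyIntegrand ξ).aestronglyMeasurable (ae_of_all _ (norm_levyIntegrand_le ξ))

lemma norm_symbol_le (h : Admissible σ ν) (ξ : E d) :
    ‖symbol σ ν ξ‖ ≤ growth ξ * ∫ y, levyWeight σ y ∂ν := by
  rw [symbol_eq_integral, ← integral_const_mul]
  exact norm_integral_le_of_norm_le (h.integrable_weight.const_mul _)
    (ae_of_all _ (norm_levyIntegrand_le ξ))

lemma symbol_add (h : Admissible σ ν) (h' : Admissible σ ν') (ξ : E d) :
    symbol σ (ν + ν') ξ = symbol σ ν ξ + symbol σ ν' ξ :=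
  integral_add_measure (h.integrable ξ) (h'.integrable ξ)

lemma symbol_smul {t : ℝ} (ht : 0 ≤ t) (ξ : E d) :
    symbol σ (ENNReal.ofReal t • ν) ξ = t * symbol σ ν ξ := by
  simp only [symbol_eq_integral]
  rw [integral_smul_measure, ENNReal.toReal_ofReal ht, Complex.real_smul]

lemma growth_le {ξ : E d} {C : ℝ} (h : ‖ξ‖ ≤ C) : growth ξ ≤ 2 * (1 + 2 * Real.pi * C) ^ 2 := by
  unfold growth
  gcongr

lemma continuous_symbol (h : Admissible σ ν) : Continuous (symbol σ ν) := by
  rw [continuous_iff_continuousAt]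
  intro ξ₀
  have hev : ∀ᶠ ξ in 𝓝 ξ₀, growth ξ ≤ 2 * (1 + 2 * Real.pi * (‖ξ₀‖ + 1)) ^ 2 := by
    filter_upwards [Metric.ball_mem_nhds ξ₀ one_pos] with ξ hξ
    refine growth_le ?_
    have h1 : ‖ξ - ξ₀‖ < 1 := by simpa [dist_eq_norm] using hξ
    have h2 := norm_add_le ξ₀ (ξ - ξ₀)
    rw [add_sub_cancel] at h2
    linarith
  refine tendsto_integral_filter_of_dominated_convergence
    (fun y => 2 * (1 + 2 * Real.pi * (‖ξ₀‖ + 1)) ^ 2 * levyWeight σ y) ?_ ?_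
    (h.integrable_weight.const_mul _) ?_
  · exact Eventually.of_forall fun ξ => (measurable_levyIntegrand ξ).aestronglyMeasurable
  · filter_upwards [hev] with ξ hξ
    exact ae_of_all _ fun y => (norm_levyIntegrand_le ξ y).trans
      (mul_le_mul_of_nonneg_right hξ (levyWeight_nonneg y))
  · exact ae_of_all _ fun y => (continuous_levyIntegrand y).continuousAt

lemma levyIntegrand_re (ξ y : E d) :
    (levyIntegrand σ ξ y).re = -(1 - Real.cos (2 * Real.pi * inner ℝ ξ y)) := by
  have : levyIntegrand σ ξ y = Complex.exp ((2 * Real.pi * inner ℝ ξ y : ℝ) * Complex.I) - 1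
    - (2 * Real.pi * chi σ y * inner ℝ ξ y : ℝ) * Complex.I := by
    simp [levyIntegrand]
  rw [this, Complex.sub_re, Complex.sub_re, Complex.exp_ofReal_mul_I_re, Complex.re_ofReal_mul]
  simp

lemma symbol_re (h : Admissible σ ν) (ξ : E d) :
    (symbol σ ν ξ).re = -∫ y, (1 - Real.cos (2 * Real.pi * inner ℝ ξ y)) ∂ν := by
  have := integral_re (h.integrable ξ)
  rw [symbol_eq_integral, ← integral_neg]
  refine Eq.trans ?_ (integral_congr_ae (ae_of_all _ fun y => levyIntegrand_re (σ := σ) ξ y))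
  exact this.symm

lemma symbol_re_nonpos (h : Admissible σ ν) (ξ : E d) : (symbol σ ν ξ).re ≤ 0 := by
  rw [symbol_re h, neg_nonpos]
  exact integral_nonneg fun y => by simpa using Real.cos_le_one _

end Symbols

/-! ### Existence of the infinitely divisible laws. -/

section Characteristic

variable {d : ℕ} {σ : ℝ} {ν ν' : Measure (E d)}

/-- `φ` is the characteristic function, in the normalization `E exp(i 2π ξ·X)`, of a probability
measure. -/
def IsCharacteristic (φ : E d → ℂ) : Prop :=
  ∃ Q : Measure (E d), IsProbabilityMeasure Q ∧ ∀ ξ, charFun Q ((2 * Real.pi) • ξ) = φ ξ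

lemma charFun_two_pi_smul (Q : Measure (E d)) (ξ : E d) :
    charFun Q ((2 * Real.pi) • ξ)
      = ∫ y, Complex.exp (2 * Real.pi * (inner ℝ ξ y : ℝ) * Complex.I) ∂Q := by
  rw [charFun_apply]
  congr 1 with y
  rw [real_inner_smul_right, real_inner_comm]
  push_cast
  ring_nf

lemma IsCharacteristic.mul {φ φ' : E d → ℂ} (h : IsCharacteristic φ) (h' : IsCharacteristic φ') :
    IsCharacteristic (fun ξ => φ ξ * φ' ξ) := by
  obtain ⟨Q, hQ, hφ⟩ := h
  obtain ⟨Q', hQ', hφ'⟩ := h'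
  exact ⟨Q ∗ Q', inferInstance, fun ξ => by rw [charFun_conv, hφ, hφ']⟩

lemma isCharacteristic_dirac (b : E d) :
    IsCharacteristic (fun ξ => Complex.exp (2 * Real.pi * (inner ℝ ξ b : ℝ) * Complex.I)) :=
  ⟨Measure.dirac b, inferInstance, fun ξ => by rw [charFun_two_pi_smul, integral_dirac]⟩

lemma isCharacteristic_one : IsCharacteristic (fun _ : E d => 1) := by
  simpa using isCharacteristic_dirac (0 : E d)

lemma IsCharacteristic.pow {φ : E d → ℂ} (h : IsCharacteristic φ) (n : ℕ) :
    IsCharacteristic (fun ξ => φ ξ ^ n) := by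
  induction n with
  | zero => simpa using isCharacteristic_one
  | succ n ih => simpa only [pow_succ] using ih.mul h

/-- The **Lévy continuity theorem**. -/
lemma IsCharacteristic.of_tendsto {φ : E d → ℂ} {u : ℕ → E d → ℂ}
    (hu : ∀ᶠ n in atTop, IsCharacteristic (u n)) (hφ : ContinuousAt φ 0)
    (h : ∀ ξ, Tendsto (fun n => u n ξ) atTop (𝓝 (φ ξ))) : IsCharacteristic φ := by
  obtain ⟨N, hN⟩ := eventually_atTop.1 hu
  choose Q hQ hQu using fun n => hN (n + N) (Nat.le_add_left _ _)
  have hpi : (2 * Real.pi) ≠ 0 := Real.two_pi_pos.ne'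
  have hlim : ∀ t, Tendsto (fun n => charFun (Q n) t) atTop (𝓝 (φ ((2 * Real.pi)⁻¹ • t))) := by
    intro t
    have := (tendsto_add_atTop_iff_nat N).2 (h ((2 * Real.pi)⁻¹ • t))
    refine this.congr fun n => ?_
    rw [← hQu, smul_inv_smul₀ hpi]
  have hcont : ContinuousAt (fun t : E d => φ ((2 * Real.pi)⁻¹ • t)) 0 := by
    refine ContinuousAt.comp (f := fun t : E d => (2 * Real.pi)⁻¹ • t) ?_ (by fun_prop)
    simpa using hφ
  -- Continuity of the limit at 0 is exactly what prevents mass from escaping to infinity.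
  have htight := isTightMeasureSet_of_tendsto_charFun hcont hlim
  let μ : ℕ → ProbabilityMeasure (E d) := fun n => ⟨Q n, hQ n⟩
  have hcomp : IsCompact (closure (range μ)) := by
    refine isCompact_closure_of_isTightMeasureSet ?_
    have hrange : {x | ∃ ρ ∈ range μ, (ρ : Measure (E d)) = x} = range Q := by
      ext ρ
      constructor
      · rintro ⟨_, ⟨n, rfl⟩, rfl⟩; exact ⟨n, rfl⟩
      · rintro ⟨n, rfl⟩; exact ⟨μ n, ⟨n, rfl⟩, rfl⟩
    rw [hrange]
    exact htight
  -- An ultrafilter limit replaces a weakly convergent subsequence. It has the right characteristic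
  -- function because a limit along n is also the limit along any finer ultrafilter.
  obtain ⟨μ', -, hμ'⟩ := hcomp.ultrafilter_le_nhds ((hyperfilter ℕ : Ultrafilter ℕ).map μ)
    (.trans (by simp) (monotone_principal subset_closure))
  refine ⟨μ', inferInstance, fun ξ => ?_⟩
  have hU : ((hyperfilter ℕ : Ultrafilter ℕ) : Filter ℕ) ≤ atTop := by
    rw [← Nat.cofinite_eq_atTop]; exact hyperfilter_le_cofinite
  have h1 : Tendsto (fun n => charFun (Q n) ((2 * Real.pi) • ξ)) (hyperfilter ℕ : Ultrafilter ℕ)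
      (𝓝 (charFun (μ' : Measure (E d)) ((2 * Real.pi) • ξ))) := by
    have hμ'' : Tendsto μ (hyperfilter ℕ : Ultrafilter ℕ) (𝓝 μ') := hμ'
    rw [ProbabilityMeasure.tendsto_iff_forall_integral_rclike_tendsto ℂ] at hμ''
    simp_rw [charFun_eq_integral_innerProbChar]
    exact hμ'' (BoundedContinuousFunction.innerProbChar ((2 * Real.pi) • ξ))
  have h2 := tendsto_nhds_unique h1 ((hlim _).mono_left hU)
  rwa [inv_smul_smul₀ hpi] at h2

lemma integrable_cexp_inner [IsFiniteMeasure ν] (ξ : E d) :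
    Integrable (fun y => Complex.exp (2 * Real.pi * (inner ℝ ξ y : ℝ) * Complex.I)) ν := by
  refine (integrable_const (1 : ℝ)).mono' (by fun_prop) (ae_of_all _ fun y => ?_)
  have := Complex.norm_exp_ofReal_mul_I (2 * Real.pi * inner ℝ ξ y)
  push_cast at this
  exact this.le

/-- Compound Poisson laws. -/
lemma isCharacteristic_compoundPoisson [IsFiniteMeasure ν] :
    IsCharacteristic (fun ξ => Complex.exp
      (∫ y, (Complex.exp (2 * Real.pi * (inner ℝ ξ y : ℝ) * Complex.I) - 1) ∂ν)) := by
  set a : E d → ℂ := fun ξ =>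
    ∫ y, (Complex.exp (2 * Real.pi * (inner ℝ ξ y : ℝ) * Complex.I) - 1) ∂ν with ha
  have ha' : ∀ ξ, a ξ =
      ∫ y, Complex.exp (2 * Real.pi * (inner ℝ ξ y : ℝ) * Complex.I) ∂ν - ν.real univ := by
    intro ξ
    rw [ha]
    simp only
    rw [integral_sub (integrable_cexp_inner ξ) (integrable_const _)]
    simp
  -- With m the mass of ν, the function 1 + a/n is the transform of (1 - m/n)δ₀ + ν/n, a probability
  -- measure as soon as n ≥ max(1, m); its n-th power is an n-fold convolution.
  refine IsCharacteristic.of_tendsto (u := fun n ξ => (1 + a ξ / n) ^ n) ?_ ?_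
    (fun ξ => Complex.tendsto_one_add_div_pow_exp (a ξ))
  · filter_upwards [eventually_ge_atTop (max 1 ⌈ν.real univ⌉₊)] with n hn
    have hn1 : (1 : ℝ) ≤ n := by exact_mod_cast (le_max_left _ _).trans hn
    have hn2 : ν.real univ ≤ n := (Nat.le_ceil _).trans (by exact_mod_cast (le_max_right _ _).trans hn)
    have hn0 : (0 : ℝ) < n := by linarith
    have hq : 0 ≤ 1 - ν.real univ / n := by
      rw [sub_nonneg, div_le_one hn0]; exact hn2
    refine IsCharacteristic.pow ?_ n
    refine ⟨ENNReal.ofReal (1 - ν.real univ / n) • Measure.dirac 0 +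
      ENNReal.ofReal ((n : ℝ)⁻¹) • ν, ⟨?_⟩, fun ξ => ?_⟩
    · simp only [Measure.coe_add, Measure.coe_smul, Pi.add_apply, Pi.smul_apply, measure_univ,
        smul_eq_mul, mul_one]
      rw [← ofReal_measureReal (μ := ν) (s := univ), ← ENNReal.ofReal_mul (by positivity),
        ← ENNReal.ofReal_add hq (by positivity)]
      simp only [ENNReal.ofReal_eq_one]
      field_simp
      ring
    · have f1 : IsFiniteMeasure (ENNReal.ofReal (1 - ν.real univ / n) • Measure.dirac (0 : E d)) :=
        Measure.smul_finite _ ENNReal.ofReal_ne_top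
      have f2 : IsFiniteMeasure (ENNReal.ofReal ((n : ℝ)⁻¹) • ν) :=
        Measure.smul_finite _ ENNReal.ofReal_ne_top
      rw [charFun_two_pi_smul, integral_add_measure (integrable_cexp_inner ξ)
        (integrable_cexp_inner ξ), integral_smul_measure, integral_smul_measure, integral_dirac,
        ENNReal.toReal_ofReal hq, ENNReal.toReal_ofReal (by positivity)]
      simp only [ha', inner_zero_right, Complex.ofReal_zero, mul_zero, zero_mul, Complex.exp_zero,
        Complex.real_smul]
      generalize (∫ y, Complex.exp (2 * Real.pi * (inner ℝ ξ y : ℝ) * Complex.I) ∂ν) = J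
      push_cast
      ring
  · refine ContinuousAt.cexp ?_
    have : a = fun ξ => charFun ν ((2 * Real.pi) • ξ) - ν.real univ := by
      ext ξ; rw [ha', charFun_two_pi_smul]
    change ContinuousAt a 0
    rw [this]
    have := continuous_charFun (μ := ν)
    fun_prop

lemma Admissible.restrict (h : Admissible σ ν) (s : Set (E d)) : Admissible σ (ν.restrict s) :=
  h.mono Measure.restrict_le_self

lemma Admissible.isFiniteMeasure_restrict (h : Admissible σ ν) {ε : ℝ} (hε : 0 < ε) :
    IsFiniteMeasure (ν.restrict {y | ε < ‖y‖}) := by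
  have hle : ∀ y : E d, ε < ‖y‖ → min (min (ε ^ 2) ε) 1 ≤ levyWeight σ y := by
    intro y hy
    have h2 : ε ^ 2 ≤ ‖y‖ ^ 2 := by gcongr
    unfold levyWeight
    split_ifs
    · exact min_le_min ((min_le_right _ _).trans hy.le) le_rfl
    · exact min_le_min ((min_le_left _ _).trans h2) le_rfl
    · exact (min_le_left _ _).trans (min_le_min h2 hy.le)
  constructor
  rw [Measure.restrict_apply_univ]
  refine (measure_mono (fun y hy => hle y hy)).trans_lt
    (h.integrable_weight.measure_ge_lt_top (by positivity))

lemma norm_chi_smul_le (y : E d) : ‖chi σ y • y‖ ≤ 1 + levyWeight σ y := by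
  have := norm_nonneg y
  unfold chi levyWeight
  split_ifs with h1 h2 h3
  · simp only [zero_smul, norm_zero]; positivity
  · rw [one_smul]; have : 0 ≤ min (‖y‖ ^ 2) 1 := by positivity
    linarith
  · simp only [zero_smul, norm_zero]; positivity
  · rw [one_smul]
    rcases le_or_gt ‖y‖ 1 with h | h
    · have : 0 ≤ min (‖y‖ ^ 2) ‖y‖ := by positivity
      linarith
    · rw [min_eq_right (by nlinarith)]; linarith

lemma Admissible.integrable_chi_smul [IsFiniteMeasure ν] (h : Admissible σ ν) :
    Integrable (fun y => chi σ y • y) ν := by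
  refine ((integrable_const (1 : ℝ)).add h.integrable_weight).mono' ?_
    (ae_of_all _ norm_chi_smul_le)
  exact (measurable_chi.smul measurable_id).aestronglyMeasurable

/-- For finite ν the compensator can be split off: it is a linear drift, hence a translation of a
compound Poisson law by -∫ χ(y) y dν. -/
lemma isCharacteristic_exp_symbol_of_isFiniteMeasure [IsFiniteMeasure ν] (h : Admissible σ ν) :
    IsCharacteristic (fun ξ => Complex.exp (symbol σ ν ξ)) := by
  have key : ∀ ξ, symbol σ ν ξ =
      ∫ y, (Complex.exp (2 * Real.pi * (inner ℝ ξ y : ℝ) * Complex.I) - 1) ∂ν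
      + 2 * Real.pi * (inner ℝ ξ (-∫ y, chi σ y • y ∂ν) : ℝ) * Complex.I := by
    intro ξ
    have hi : Integrable (fun y => (inner ℝ ξ (chi σ y • y) : ℝ)) ν :=
      h.integrable_chi_smul.const_inner ξ
    have e1 : (inner ℝ ξ (-∫ y, chi σ y • y ∂ν) : ℝ) = - ∫ y, inner ℝ ξ (chi σ y • y) ∂ν := by
      rw [inner_neg_right, integral_inner h.integrable_chi_smul]
    have e2 : ∀ y, levyIntegrand σ ξ y =
        (Complex.exp (2 * Real.pi * (inner ℝ ξ y : ℝ) * Complex.I) - 1)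
        - (2 * Real.pi * Complex.I) * ((inner ℝ ξ (chi σ y • y) : ℝ) : ℂ) := by
      intro y
      rw [real_inner_smul_right]
      simp only [levyIntegrand]
      push_cast
      ring
    rw [symbol_eq_integral, e1]
    simp_rw [e2]
    have hi' : Integrable (fun y => Complex.exp (2 * Real.pi * (inner ℝ ξ y : ℝ) * Complex.I) - 1)
        ν := (integrable_cexp_inner ξ).sub (integrable_const _)
    have hi2 : Integrable
        (fun y => (2 * Real.pi * Complex.I) * ((inner ℝ ξ (chi σ y • y) : ℝ) : ℂ)) ν :=
      hi.ofReal.const_mul _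
    rw [integral_sub hi' hi2,
      integral_const_mul, integral_complex_ofReal]
    push_cast
    ring
  simp_rw [key, Complex.exp_add]
  exact isCharacteristic_compoundPoisson.mul (isCharacteristic_dirac _)

lemma tendsto_symbol_restrict (h : Admissible σ ν) (ξ : E d) :
    Tendsto (fun n : ℕ => symbol σ (ν.restrict {y | 1 / ((n : ℝ) + 1) < ‖y‖}) ξ) atTop
      (𝓝 (symbol σ ν ξ)) := by
  have hm : ∀ n : ℕ, MeasurableSet {y : E d | 1 / ((n : ℝ) + 1) < ‖y‖} := fun n =>
    measurableSet_lt measurable_const measurable_norm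
  simp_rw [symbol_eq_integral, ← integral_indicator (hm _)]
  refine tendsto_integral_of_dominated_convergence (fun y => ‖levyIntegrand σ ξ y‖)
    (fun n => ((measurable_levyIntegrand ξ).indicator (hm n)).aestronglyMeasurable)
    (h.integrable ξ).norm (fun n => ae_of_all _ fun y => norm_indicator_le_norm_self _ _) ?_
  refine ae_of_all _ fun y => ?_
  by_cases hy : y = 0
  · subst hy
    have : levyIntegrand σ ξ (0 : E d) = 0 := by simp [levyIntegrand]
    simp [Set.indicator_apply, this]
  · refine tendsto_const_nhds.congr' ?_
    have := (tendsto_one_div_add_atTop_nhds_zero_nat (𝕜 := ℝ)).eventually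
      (gt_mem_nhds (norm_pos_iff.2 hy))
    filter_upwards [this] with n hn
    rw [indicator_of_mem]
    exact hn

/-- Infinitely divisible laws: `exp ψ` is a characteristic function. -/
lemma isCharacteristic_exp_symbol (h : Admissible σ ν) :
    IsCharacteristic (fun ξ => Complex.exp (symbol σ ν ξ)) := by
  -- Discard the jumps of size at most 1/(n+1): what is left is a finite measure, and its symbol
  -- converges pointwise to the full symbol, which is continuous.
  refine IsCharacteristic.of_tendsto
    (u := fun n ξ => Complex.exp (symbol σ (ν.restrict {y | 1 / ((n : ℝ) + 1) < ‖y‖}) ξ))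
    (Eventually.of_forall fun n => ?_) ?_ (fun ξ => ?_)
  · have := h.isFiniteMeasure_restrict (ε := 1 / ((n : ℝ) + 1)) (by positivity)
    exact isCharacteristic_exp_symbol_of_isFiniteMeasure (h.restrict _)
  · exact (continuous_symbol h).continuousAt.cexp
  · exact (Complex.continuous_exp.tendsto _).comp (tendsto_symbol_restrict h ξ)

end Characteristic

/-! ### Continuous densities by Fourier inversion. -/

section Density

variable {d : ℕ} {σ : ℝ} {ν ν' : Measure (E d)}

lemma IsCharacteristic.zero {φ : E d → ℂ} (h : IsCharacteristic φ) : φ 0 = 1 := by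
  obtain ⟨Q, hQ, hφ⟩ := h
  rw [← hφ]; simp

lemma IsCharacteristic.norm_le {φ : E d → ℂ} (h : IsCharacteristic φ) (ξ : E d) : ‖φ ξ‖ ≤ 1 := by
  obtain ⟨Q, hQ, hφ⟩ := h
  rw [← hφ]; exact norm_charFun_le_one _

lemma IsCharacteristic.conj {φ : E d → ℂ} (h : IsCharacteristic φ) (ξ : E d) :
    φ (-ξ) = (starRingEnd ℂ) (φ ξ) := by
  obtain ⟨Q, hQ, hφ⟩ := h
  rw [← hφ, ← hφ, ← charFun_neg, smul_neg]

lemma fourier_apply (φ : E d → ℂ) (x : E d) :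
    𝓕 φ x = ∫ ξ, Complex.exp ((-(2 * Real.pi * inner ℝ ξ x) : ℝ) * Complex.I) * φ ξ := by
  rw [Real.fourier_eq']
  simp [neg_mul]

lemma fourierInv_apply (φ : E d → ℂ) (x : E d) :
    𝓕⁻ φ x = ∫ ξ, Complex.exp ((2 * Real.pi * inner ℝ ξ x : ℝ) * Complex.I) * φ ξ := by
  rw [Real.fourierInv_eq']
  simp

lemma integrable_cexp_mul {α : Type*} [MeasurableSpace α] {μ : Measure α} {h : α → ℂ}
    (hh : Integrable h μ) {u : α → ℝ} (hu : Measurable u) :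
    Integrable (fun ξ => Complex.exp (u ξ * Complex.I) * h ξ) μ := by
  refine hh.bdd_mul (c := 1) (by fun_prop) (ae_of_all _ fun ξ => ?_)
  rw [Complex.norm_exp_ofReal_mul_I]

lemma continuous_fourier {φ : E d → ℂ} (hi : Integrable φ) : Continuous (𝓕 φ) :=
  VectorFourier.fourierIntegral_continuous Real.continuous_fourierChar continuous_inner hi

/-- Integration of an inverse Fourier transform against a finite measure. -/
lemma integral_fourierInv_measure (Q : Measure (E d)) [IsFiniteMeasure Q] {h : E d → ℂ}
    (hh : Integrable h) :
    ∫ y, 𝓕⁻ h y ∂Q = ∫ ξ, h ξ * charFun Q ((2 * Real.pi) • ξ) := by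
  simp_rw [fourierInv_apply]
  have hintegrable : Integrable (fun p : E d × E d =>
      Complex.exp ((2 * Real.pi * inner ℝ p.2 p.1 : ℝ) * Complex.I) * h p.2) (Q.prod volume) :=
    integrable_cexp_mul (hh.comp_snd Q) (by fun_prop)
  rw [integral_integral_swap (f := fun y ξ =>
      Complex.exp ((2 * Real.pi * inner ℝ ξ y : ℝ) * Complex.I) * h ξ) hintegrable]
  congr 1 with ξ
  rw [integral_mul_const, charFun_two_pi_smul, mul_comm]
  push_cast
  rfl

lemma integral_fourier_mul {f g : E d → ℂ} (hf : Integrable f) (hg : Integrable g) :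
    ∫ ξ, 𝓕 f ξ * g ξ = ∫ x, f x * 𝓕 g x := by
  simpa using! (VectorFourier.integral_fourierIntegral_smul_eq_flip (L := innerₗ (E d))
    Real.continuous_fourierChar continuous_inner hf hg)

/-- Parseval: tested against Schwartz functions, Q has density `𝓕 φ`. Positivity and integrability
of `𝓕 φ` are then read off from smooth bumps. -/
lemma integral_schwartz_eq {φ : E d → ℂ} {Q : Measure (E d)} [IsProbabilityMeasure Q]
    (hQ : ∀ ξ, charFun Q ((2 * Real.pi) • ξ) = φ ξ) (hi : Integrable φ) (g : 𝓢(E d, ℂ)) :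
    ∫ x, g x ∂Q = ∫ x, g x * 𝓕 φ x := by
  have hg : 𝓕⁻ (𝓕 (g : E d → ℂ)) = g :=
    g.continuous.fourierInv_fourier_eq g.integrable (by
      rw [← SchwartzMap.fourier_coe]; exact (𝓕 g).integrable)
  have hFg : Integrable (𝓕 (g : E d → ℂ)) := by
    rw [← SchwartzMap.fourier_coe]; exact (𝓕 g).integrable
  calc ∫ x, g x ∂Q = ∫ x, 𝓕⁻ (𝓕 (g : E d → ℂ)) x ∂Q := by rw [hg]
    _ = ∫ ξ, 𝓕 (g : E d → ℂ) ξ * φ ξ := by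
      rw [integral_fourierInv_measure Q hFg]; simp_rw [hQ]
    _ = _ := integral_fourier_mul g.integrable hi

/-- The Hermitian symmetry φ(-ξ) = conj φ(ξ) makes the transform real. -/
lemma fourier_im_eq_zero {φ : E d → ℂ} (h : IsCharacteristic φ) (x : E d) :
    ((𝓕 φ x).re : ℂ) = 𝓕 φ x := by
  rw [← Complex.conj_eq_iff_re, fourier_apply, ← integral_conj, ← integral_neg_eq_self]
  congr 1 with ξ
  rw [map_mul, ← h.conj, neg_neg, ← Complex.exp_conj, map_mul, Complex.conj_ofReal,
    Complex.conj_I, inner_neg_left]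
  congr 2
  push_cast
  ring

/-- The smooth bump equal to `1` on a ball, as a Schwartz function. -/
def schwartzBump {c : E d} (b : ContDiffBump c) : 𝓢(E d, ℂ) :=
  HasCompactSupport.toSchwartzMap (f := fun x => ((b x : ℝ) : ℂ))
    (b.hasCompactSupport.comp_left Complex.ofReal_zero) (Complex.ofRealCLM.contDiff.comp b.contDiff)

lemma schwartzBump_apply {c : E d} (b : ContDiffBump c) (x : E d) :
    schwartzBump b x = ((b x : ℝ) : ℂ) := rfl

lemma integral_bump_eq {φ : E d → ℂ} (h : IsCharacteristic φ) (hi : Integrable φ) {c : E d}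
    (b : ContDiffBump c) :
    0 ≤ ∫ x, b x * (𝓕 φ x).re ∧ ∫ x, b x * (𝓕 φ x).re ≤ 1 := by
  have h' := h
  obtain ⟨Q, hQ, hφ⟩ := h
  have key : ∫ x, b x ∂Q = ∫ x, b x * (𝓕 φ x).re := by
    have := integral_schwartz_eq hφ hi (schwartzBump b)
    have e : ∀ x, schwartzBump b x * 𝓕 φ x = ((b x * (𝓕 φ x).re : ℝ) : ℂ) := by
      intro x
      rw [Complex.ofReal_mul, fourier_im_eq_zero h' x, schwartzBump_apply]
    simp_rw [e, schwartzBump_apply] at this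
    rw [integral_complex_ofReal, integral_complex_ofReal] at this
    exact_mod_cast this
  rw [← key]
  refine ⟨integral_nonneg fun x => b.nonneg, ?_⟩
  calc ∫ x, b x ∂Q ≤ ∫ x, (1 : ℝ) ∂Q := by
        refine integral_mono_of_nonneg (ae_of_all _ fun x => b.nonneg) (integrable_const _)
          (ae_of_all _ fun x => b.le_one)
    _ = 1 := by simp

lemma integrable_bump_mul {g : E d → ℝ} (hg : Continuous g) {c : E d} (b : ContDiffBump c) :
    Integrable (fun x => b x * g x) :=
  (b.continuous.mul hg).integrable_of_hasCompactSupport b.hasCompactSupport.mul_right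

/-- By continuity a negative value would persist on a ball, and a bump supported there would have
negative integral against Q. -/
lemma fourier_re_nonneg {φ : E d → ℂ} (h : IsCharacteristic φ) (hi : Integrable φ) (x : E d) :
    0 ≤ (𝓕 φ x).re := by
  by_contra! hx
  have hc : Continuous fun x => (𝓕 φ x).re := Complex.continuous_re.comp (continuous_fourier hi)
  obtain ⟨ε, hε, hball⟩ := Metric.eventually_nhds_iff_ball.1
    (hc.continuousAt.eventually (gt_mem_nhds hx))
  let b : ContDiffBump x := ⟨ε / 2, ε, by linarith, by linarith⟩
  have hneg : 0 < ∫ y, -(b y * (𝓕 φ y).re) := by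
    refine Continuous.integral_pos_of_hasCompactSupport_nonneg_nonzero (x := x) ?_ ?_ ?_ ?_
    · exact (b.continuous.mul hc).neg
    · exact b.hasCompactSupport.mul_right.neg
    · intro y
      simp only [Pi.zero_apply]
      by_cases hy : y ∈ Metric.ball x ε
      · have := hball y hy
        have := b.nonneg (x := y)
        nlinarith
      · have : b y = 0 := b.zero_of_le_dist (by simpa using hy)
        simp [this]
    · have : b x = 1 := b.one_of_mem_closedBall (Metric.mem_closedBall_self b.rIn_pos.le)
      simp [this, hx.ne]
  rw [integral_neg] at hneg
  have := (integral_bump_eq h hi b).1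
  linarith

/-- Monotone convergence over growing balls: a bump equal to 1 on the ball has Q-integral at most 1.
-/
lemma integrable_fourier {φ : E d → ℂ} (h : IsCharacteristic φ) (hi : Integrable φ) :
    Integrable (fun x => (𝓕 φ x).re) := by
  have hc : Continuous fun x => (𝓕 φ x).re := Complex.continuous_re.comp (continuous_fourier hi)
  refine ⟨hc.aestronglyMeasurable, ?_⟩
  rw [hasFiniteIntegral_iff_ofReal (ae_of_all _ (fourier_re_nonneg h hi))]
  have hmono : ∫⁻ x, ENNReal.ofReal (𝓕 φ x).re ≤ 1 := by
    have hcov : (⋃ n : ℕ, Metric.closedBall (0 : E d) (n + 1 : ℝ)) = univ := by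
      refine eq_univ_of_forall fun x => mem_iUnion.2 ?_
      obtain ⟨n, hn⟩ := exists_nat_ge ‖x‖
      exact ⟨n, by simp only [Metric.mem_closedBall, dist_zero_right]; linarith⟩
    rw [← setLIntegral_univ, ← hcov]
    rw [setLIntegral_iUnion_of_directed]
    · refine iSup_le fun n => ?_
      let b : ContDiffBump (0 : E d) := ⟨n + 1, n + 2, by positivity, by linarith⟩
      calc ∫⁻ x in Metric.closedBall (0 : E d) (n + 1 : ℝ), ENNReal.ofReal (𝓕 φ x).re
          ≤ ∫⁻ x in Metric.closedBall (0 : E d) (n + 1 : ℝ), ENNReal.ofReal (b x * (𝓕 φ x).re) := by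
            refine setLIntegral_mono' Metric.isClosed_closedBall.measurableSet fun x hx => ?_
            rw [b.one_of_mem_closedBall hx, one_mul]
        _ ≤ ∫⁻ x, ENNReal.ofReal (b x * (𝓕 φ x).re) := setLIntegral_le_lintegral _ _
        _ = ENNReal.ofReal (∫ x, b x * (𝓕 φ x).re) := by
            rw [ofReal_integral_eq_lintegral_ofReal (integrable_bump_mul hc b)]
            exact ae_of_all _ fun x => mul_nonneg b.nonneg (fourier_re_nonneg h hi x)
        _ ≤ 1 := by
            rw [← ENNReal.ofReal_one]
            exact ENNReal.ofReal_le_ofReal (integral_bump_eq h hi b).2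
    · refine Monotone.directed_le fun m n hmn => Metric.closedBall_subset_closedBall ?_
      have : (m : ℝ) ≤ n := by exact_mod_cast hmn
      linarith
  exact hmono.trans_lt ENNReal.one_lt_top

lemma integrable_fourier_complex {φ : E d → ℂ} (h : IsCharacteristic φ) (hi : Integrable φ) :
    Integrable (𝓕 φ) := by
  have := (integrable_fourier h hi).ofReal (𝕜 := ℂ)
  exact this.congr (ae_of_all _ fun x => fourier_im_eq_zero h x)

lemma isFiniteMeasure_withDensity {q : E d → ℝ} (hq : Integrable q) :
    IsFiniteMeasure (volume.withDensity fun x => ENNReal.ofReal (q x)) :=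
  isFiniteMeasure_withDensity_ofReal hq.2

lemma integral_withDensity_ofReal {q : E d → ℝ} (hm : Measurable q) (h0 : ∀ x, 0 ≤ q x)
    (g : E d → ℂ) :
    ∫ x, g x ∂(volume.withDensity fun x => ENNReal.ofReal (q x)) = ∫ x, g x * q x := by
  rw [integral_withDensity_eq_integral_toReal_smul (by fun_prop) (by simp)]
  congr 1 with x
  rw [ENNReal.toReal_ofReal (h0 x), Complex.real_smul, mul_comm]

lemma charFun_withDensity {q : E d → ℝ} (hm : Measurable q) (h0 : ∀ x, 0 ≤ q x) (ξ : E d) :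
    charFun (volume.withDensity fun x => ENNReal.ofReal (q x)) ((2 * Real.pi) • ξ)
      = 𝓕⁻ (fun x => (q x : ℂ)) ξ := by
  rw [charFun_two_pi_smul, integral_withDensity_ofReal hm h0, fourierInv_apply]
  congr 1 with x
  rw [real_inner_comm]
  push_cast
  rfl

/-- A probability measure with continuous integrable characteristic function has a continuous
density, its Fourier transform. -/
lemma isLevyDensity_fourier {φ : E d → ℂ} (h : IsCharacteristic φ) (hc : Continuous φ)
    (hi : Integrable φ) {t : ℝ} (hφ : ∀ ξ, φ ξ = Complex.exp (t * symbol σ ν ξ)) :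
    IsLevyDensity σ ν t (fun x => (𝓕 φ x).re) := by
  have hcont : Continuous fun x => (𝓕 φ x).re := Complex.continuous_re.comp (continuous_fourier hi)
  have hchar : ∀ ξ : E d, charFun (volume.withDensity fun x => ENNReal.ofReal (𝓕 φ x).re)
      ((2 * Real.pi) • ξ) = φ ξ := by
    intro ξ
    rw [charFun_withDensity hcont.measurable (fourier_re_nonneg h hi)]
    simp_rw [fourier_im_eq_zero h]
    exact congrFun (hc.fourierInv_fourier_eq hi (integrable_fourier_complex h hi)) ξ
  refine ⟨hcont, fourier_re_nonneg h hi, ⟨?_⟩, fun ξ => (hchar ξ).trans (hφ ξ)⟩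
  have hfin := isFiniteMeasure_withDensity (integrable_fourier h hi)
  -- The total mass is the value of the characteristic function at frequency 0.
  have h0 := hchar 0
  rw [h.zero, smul_zero, charFun_zero] at h0
  have h1 : (volume.withDensity fun x => ENNReal.ofReal (𝓕 φ x).re).real univ = 1 := by
    exact_mod_cast h0
  rw [← ofReal_measureReal, h1, ENNReal.ofReal_one]

lemma IsLevyDensity.integrable {q : E d → ℝ} {t : ℝ} (hq : IsLevyDensity σ ν t q) :
    Integrable q := by
  refine ⟨hq.continuous.aestronglyMeasurable, ?_⟩
  rw [hasFiniteIntegral_iff_ofReal (ae_of_all _ hq.nonneg)]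
  have := hq.prob.measure_univ
  rw [withDensity_apply _ MeasurableSet.univ, Measure.restrict_univ] at this
  rw [this]; exact ENNReal.one_lt_top

lemma IsLevyDensity.fourierInv_eq {q : E d → ℝ} {t : ℝ} (hq : IsLevyDensity σ ν t q) (ξ : E d) :
    𝓕⁻ (fun x => (q x : ℂ)) ξ = Complex.exp (t * symbol σ ν ξ) := by
  rw [← charFun_withDensity hq.continuous.measurable hq.nonneg, hq.charFun_eq]

/-- The continuous density is the Fourier transform of the characteristic function. -/
lemma IsLevyDensity.eq_fourier {q : E d → ℝ} {t : ℝ} (hq : IsLevyDensity σ ν t q)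
    (hi : Integrable fun ξ => Complex.exp (t * symbol σ ν ξ)) (x : E d) :
    (q x : ℂ) = 𝓕 (fun ξ => Complex.exp (t * symbol σ ν ξ)) x := by
  have h1 : 𝓕⁻ (fun x => (q x : ℂ)) = fun ξ => Complex.exp (t * symbol σ ν ξ) :=
    funext hq.fourierInv_eq
  have hqc : Continuous fun x => (q x : ℂ) := Complex.continuous_ofReal.comp hq.continuous
  have hqi : Integrable fun x => (q x : ℂ) := hq.integrable.ofReal
  rw [← h1, Real.fourierInv_comm]
  refine (congrFun (hqc.fourierInv_fourier_eq hqi ?_) x).symm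
  have : 𝓕 (fun x => (q x : ℂ)) = fun ξ => Complex.exp (t * symbol σ ν (-ξ)) := by
    ext ξ
    rw [← hq.fourierInv_eq, Real.fourierInv_eq_fourier_neg, neg_neg]
  rw [this]
  exact hi.comp_neg

end Density

/-! ### L¹ increments under convolution and dilation. -/

section Convolution

variable {d : ℕ} {σ : ℝ} {ν ν' : Measure (E d)}

lemma norm_fourier_le (φ : E d → ℂ) (x : E d) : ‖𝓕 φ x‖ ≤ ∫ ξ, ‖φ ξ‖ :=
  VectorFourier.norm_fourierIntegral_le_integral_norm _ _ _ _ _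

lemma fourier_sub (φ : E d → ℂ) (x y : E d) :
    𝓕 φ (x - y) =
      𝓕⁻ (fun ξ => Complex.exp ((-(2 * Real.pi * inner ℝ ξ x) : ℝ) * Complex.I) * φ ξ) y := by
  rw [fourier_apply, fourierInv_apply]
  congr 1 with ξ
  rw [← mul_assoc, ← Complex.exp_add, inner_sub_right]
  congr 2
  push_cast
  ring

/-- The Fourier transform turns multiplication by a characteristic function into convolution. -/
lemma fourier_mul_charFun {φ φ' : E d → ℂ} (hi : Integrable φ) {Q : Measure (E d)}
    [IsProbabilityMeasure Q] (hQ : ∀ ξ, charFun Q ((2 * Real.pi) • ξ) = φ' ξ) (x : E d) :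
    𝓕 (fun ξ => φ ξ * φ' ξ) x = ∫ y, 𝓕 φ (x - y) ∂Q := by
  simp_rw [fourier_sub]
  rw [integral_fourierInv_measure Q (integrable_cexp_mul hi (by fun_prop)), fourier_apply]
  congr 1 with ξ
  rw [hQ]
  ring

/-- Convolution with a probability measure averages translates, so by Tonelli and translation
invariance it cannot increase the L¹ modulus of continuity. -/
lemma lintegral_translation_convolution_le {F : E d → ℂ} (hc : Continuous F) {C : ℝ}
    (hC : ∀ x, ‖F x‖ ≤ C) {Q : Measure (E d)} [IsProbabilityMeasure Q] (h : E d) :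
    ∫⁻ x, ‖(∫ y, F (x + h - y) ∂Q) - ∫ y, F (x - y) ∂Q‖ₑ ≤ ∫⁻ x, ‖F (x + h) - F x‖ₑ := by
  have hintegrable : ∀ x, Integrable (fun y => F (x - y)) Q := fun x =>
    (integrable_const C).mono' (by fun_prop) (ae_of_all _ fun y => hC _)
  calc ∫⁻ x, ‖(∫ y, F (x + h - y) ∂Q) - ∫ y, F (x - y) ∂Q‖ₑ
      ≤ ∫⁻ x, ∫⁻ y, ‖F (x + h - y) - F (x - y)‖ₑ ∂Q := by
        refine lintegral_mono fun x => ?_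
        rw [← integral_sub (hintegrable _) (hintegrable _)]
        exact enorm_integral_le_lintegral_enorm _
    _ = ∫⁻ y, ∫⁻ x, ‖F (x + h - y) - F (x - y)‖ₑ ∂volume ∂Q := by
        refine lintegral_lintegral_swap (Continuous.aemeasurable ?_)
        simp only [Function.uncurry_def]
        fun_prop
    _ = ∫⁻ _, ∫⁻ x, ‖F (x + h) - F x‖ₑ ∂volume ∂Q := by
        refine lintegral_congr fun y => ?_
        rw [← lintegral_sub_right_eq_self (fun x => ‖F (x + h) - F x‖ₑ) y]
        refine lintegral_congr fun x => ?_
        rw [sub_add_eq_add_sub]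
    _ = _ := by simp

/-- Write the increment as the integral of the derivative along the segment from x to x + h, then
apply Tonelli and translation invariance. -/
lemma lintegral_translation_le {F : E d → ℂ} (hF : ContDiff ℝ 1 F) (h : E d) :
    ∫⁻ x, ‖F (x + h) - F x‖ₑ ≤ ‖h‖ₑ * ∫⁻ x, ‖fderiv ℝ F x‖ₑ := by
  have hcd : Continuous (fderiv ℝ F) := hF.continuous_fderiv one_ne_zero
  have hpt : ∀ x, ‖F (x + h) - F x‖ₑ ≤
      ∫⁻ s in Ioc (0 : ℝ) 1, ‖fderiv ℝ F (x + s • h)‖ₑ * ‖h‖ₑ := by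
    intro x
    have hd : ∀ s ∈ uIcc (0 : ℝ) 1,
        HasDerivAt (fun s : ℝ => F (x + s • h)) (fderiv ℝ F (x + s • h) h) s := by
      intro s _
      have h1 : HasDerivAt (fun s : ℝ => x + s • h) h s := by
        simpa using ((hasDerivAt_id s).smul_const h).const_add x
      exact ((hF.differentiable one_ne_zero).differentiableAt.hasFDerivAt).comp_hasDerivAt s h1
    have := intervalIntegral.integral_eq_sub_of_hasDerivAt hd
      (Continuous.intervalIntegrable (by fun_prop) _ _)
    simp only [one_smul, zero_smul, add_zero] at this
    rw [← this, intervalIntegral.integral_of_le zero_le_one]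
    refine (enorm_integral_le_lintegral_enorm _).trans (lintegral_mono fun s => ?_)
    exact ContinuousLinearMap.le_opENorm _ _
  calc ∫⁻ x, ‖F (x + h) - F x‖ₑ
      ≤ ∫⁻ x, ∫⁻ s in Ioc (0 : ℝ) 1, ‖fderiv ℝ F (x + s • h)‖ₑ * ‖h‖ₑ := lintegral_mono hpt
    _ = ∫⁻ s in Ioc (0 : ℝ) 1, ∫⁻ x, ‖fderiv ℝ F (x + s • h)‖ₑ * ‖h‖ₑ := by
        refine lintegral_lintegral_swap (Measurable.aemeasurable ?_)
        simp only [Function.uncurry_def]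
        have : Continuous fun a : E d × ℝ => ‖fderiv ℝ F (a.1 + a.2 • h)‖ₑ := by fun_prop
        exact this.measurable.mul_const _
    _ = ∫⁻ _ in Ioc (0 : ℝ) 1, ‖h‖ₑ * ∫⁻ x, ‖fderiv ℝ F x‖ₑ := by
        refine lintegral_congr fun s => ?_
        rw [lintegral_mul_const _ (by fun_prop),
          lintegral_add_right_eq_self (fun x => ‖fderiv ℝ F x‖ₑ), mul_comm]
    _ = _ := by simp

lemma lintegral_comp_inv_smul {r : ℝ} (hr : 0 < r) {f : E d → ℝ≥0∞} (hf : Measurable f) :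
    ∫⁻ x, f (r⁻¹ • x) = ENNReal.ofReal (r ^ d) * ∫⁻ x, f x := by
  have h1 : ∫⁻ x, f (r⁻¹ • x) = ∫⁻ x, f x ∂(volume.map fun x : E d => r⁻¹ • x) :=
    (lintegral_map hf (measurable_const_smul _)).symm
  rw [h1, Measure.map_addHaar_smul volume (inv_ne_zero hr.ne'), lintegral_smul_measure]
  simp [abs_of_pos hr]

lemma fourier_comp_smul (φ : E d → ℂ) {r : ℝ} (hr : 0 < r) (x : E d) :
    𝓕 (fun ξ => φ (r • ξ)) x = ((r ^ d)⁻¹ : ℝ) * 𝓕 φ (r⁻¹ • x) := by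
  rw [fourier_apply, fourier_apply]
  have := Measure.integral_comp_smul volume
    (fun ξ : E d => Complex.exp ((-(2 * Real.pi * inner ℝ ξ (r⁻¹ • x)) : ℝ) * Complex.I) * φ ξ) r
  rw [finrank_euclideanSpace_fin, abs_of_pos (by positivity), Complex.real_smul] at this
  rw [← this]
  congr 1 with ξ
  rw [real_inner_smul_left, real_inner_smul_right, mul_inv_cancel_left₀ hr.ne']

/-- Dilating a density by r preserves the L¹ norm and turns the step h into h/r. This is the source
of the factor r⁻¹, hence of the decay in time. -/
lemma lintegral_translation_fourier_comp_smul (φ : E d → ℂ) (hi : Integrable φ) {r : ℝ}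
    (hr : 0 < r) (h : E d) :
    ∫⁻ x, ‖𝓕 (fun ξ => φ (r • ξ)) (x + h) - 𝓕 (fun ξ => φ (r • ξ)) x‖ₑ
      = ∫⁻ x, ‖𝓕 φ (x + r⁻¹ • h) - 𝓕 φ x‖ₑ := by
  have hc := continuous_fourier hi
  simp_rw [fourier_comp_smul φ hr, ← mul_sub, enorm_mul, smul_add]
  rw [lintegral_const_mul _ (by fun_prop),
    lintegral_comp_inv_smul hr (f := fun x => ‖𝓕 φ (x + r⁻¹ • h) - 𝓕 φ x‖ₑ) (by fun_prop),
    ← mul_assoc]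
  have h1 : ‖(((r ^ d)⁻¹ : ℝ) : ℂ)‖ₑ = ENNReal.ofReal ((r ^ d)⁻¹) := by
    rw [← ofReal_norm, Complex.norm_real, Real.norm_of_nonneg (by positivity)]
  rw [h1, ← ENNReal.ofReal_mul (by positivity), inv_mul_cancel₀ (by positivity),
    ENNReal.ofReal_one, one_mul]

/-- If the characteristic function `φ` of a density factors through `φ₁(r ·)` then the density has
`L¹` increments controlled by the `L¹` norm of the gradient of the Fourier transform of `φ₁`. -/
lemma lintegral_increment_le {φ₁ φ₂ φ : E d → ℂ} (hi : Integrable φ₁)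
    (hsm : ContDiff ℝ 1 (𝓕 φ₁)) (hφ₂ : IsCharacteristic φ₂) {r : ℝ} (hr : 0 < r)
    (hφ : ∀ ξ, φ ξ = φ₁ (r • ξ) * φ₂ ξ) (h : E d) :
    ∫⁻ x, ‖𝓕 φ (x + h) - 𝓕 φ x‖ₑ ≤
      ENNReal.ofReal (r⁻¹ * ‖h‖) * ∫⁻ x, ‖fderiv ℝ (𝓕 φ₁) x‖ₑ := by
  obtain ⟨Q, hQ, hQφ⟩ := hφ₂
  have hir : Integrable fun ξ => φ₁ (r • ξ) := hi.comp_smul hr.ne'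
  have e : ∀ x, 𝓕 φ x = ∫ y, 𝓕 (fun ξ => φ₁ (r • ξ)) (x - y) ∂Q := by
    intro x
    rw [← fourier_mul_charFun hir hQφ, funext hφ]
  simp_rw [e]
  refine (lintegral_translation_convolution_le (continuous_fourier hir)
    (norm_fourier_le _) h).trans ?_
  rw [lintegral_translation_fourier_comp_smul φ₁ hi hr]
  refine (lintegral_translation_le hsm _).trans (le_of_eq ?_)
  congr 1
  rw [← ofReal_norm, norm_smul, Real.norm_of_nonneg (by positivity)]

end Convolution

/-! ### Derivatives of the symbol of the auxiliary measure. -/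

section Decay

variable {d : ℕ} {σ : ℝ} {μ₀ : Measure (E d)}

open VectorFourier

/-- The pairing for which the Fourier integral is the characteristic function. -/
def negInner (d : ℕ) : E d →L[ℝ] E d →L[ℝ] ℝ := -innerSL ℝ

lemma negInner_apply (y ξ : E d) : negInner d y ξ = -inner ℝ ξ y := by
  rw [real_inner_comm]; rfl

lemma norm_negInner_le : ‖negInner d‖ ≤ 1 := by
  refine ContinuousLinearMap.opNorm_le_bound₂ _ zero_le_one fun y ξ => ?_
  rw [negInner_apply, norm_neg, one_mul, mul_comm]
  exact norm_inner_le_norm ξ y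

lemma two_pi_mul_norm_negInner_le : 2 * Real.pi * ‖negInner d‖ ≤ 2 * Real.pi := by
  calc 2 * Real.pi * ‖negInner d‖ ≤ 2 * Real.pi * 1 := by gcongr; exact norm_negInner_le
    _ = _ := mul_one _

lemma fourierChar_negInner (y ξ : E d) :
    (Real.fourierChar (-(negInner d y ξ)) : ℂ)
      = Complex.exp (2 * Real.pi * (inner ℝ ξ y : ℝ) * Complex.I) := by
  rw [Real.fourierChar_apply, negInner_apply, neg_neg]
  push_cast
  rfl

lemma continuous_fourierChar_negInner (ξ : E d) :
    Continuous fun y : E d => Real.fourierChar (-(negInner d y ξ)) :=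
  Real.continuous_fourierChar.comp (by fun_prop)

/-- The pointwise bound for the gradient of the integrand of the symbol. -/
def gradBound (σ : ℝ) (ξ y : E d) : ℝ :=
  2 * Real.pi * levyWeight σ y
    + (2 * Real.pi) ^ 2 * (chi σ y * ‖y‖ * min (‖ξ‖ * ‖y‖) 1)

lemma chi_nonneg (y : E d) : 0 ≤ chi σ y := by unfold chi; split_ifs <;> simp

lemma chi_mul_min_le {y : E d} (hy : ‖y‖ ≤ 1) (ξ : E d) :
    chi σ y * ‖y‖ * min (‖ξ‖ * ‖y‖) 1 ≤ ‖ξ‖ * levyWeight σ y := by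
  have hy0 := norm_nonneg y
  have hξ := norm_nonneg ξ
  have hy2 : ‖y‖ ^ 2 ≤ 1 := by nlinarith
  have hy3 : ‖y‖ ^ 2 ≤ ‖y‖ := by nlinarith
  have key : ‖y‖ * min (‖ξ‖ * ‖y‖) 1 ≤ ‖ξ‖ * ‖y‖ ^ 2 := by
    calc ‖y‖ * min (‖ξ‖ * ‖y‖) 1 ≤ ‖y‖ * (‖ξ‖ * ‖y‖) := by gcongr; exact min_le_left _ _
      _ = _ := by ring
  unfold chi levyWeight
  split_ifs with h1 h2
  · simp only [zero_mul]; positivity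
  · rw [min_eq_left hy2, one_mul]; exact key
  · rw [min_eq_left hy3, one_mul]; exact key

lemma gradBound_le {y : E d} (hy : ‖y‖ ≤ 1) {ξ : E d} {C : ℝ} (hC : ‖ξ‖ ≤ C) :
    gradBound σ ξ y ≤ (2 * Real.pi + (2 * Real.pi) ^ 2 * C) * levyWeight σ y := by
  have h := chi_mul_min_le (σ := σ) hy ξ
  have hw := levyWeight_nonneg (σ := σ) y
  unfold gradBound
  have : ‖ξ‖ * levyWeight σ y ≤ C * levyWeight σ y := by gcongr
  have h' := mul_le_mul_of_nonneg_left (h.trans this) (sq_nonneg (2 * Real.pi))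
  linarith

lemma ae_norm_le_one (hs : μ₀.restrict {y | ‖y‖ ≤ 1} = μ₀) : ∀ᵐ y ∂μ₀, ‖y‖ ≤ 1 := by
  have h : ∀ᵐ y ∂(μ₀.restrict {y | ‖y‖ ≤ 1}), ‖y‖ ≤ 1 :=
    ae_restrict_mem (measurableSet_le measurable_norm measurable_const)
  rwa [hs] at h

lemma norm_le_of_mem_ball {ξ ξ₀ : E d} (h : ξ ∈ Metric.ball ξ₀ 1) : ‖ξ‖ ≤ ‖ξ₀‖ + 1 := by
  have h1 : ‖ξ - ξ₀‖ < 1 := by simpa [dist_eq_norm] using h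
  have h2 := norm_add_le ξ₀ (ξ - ξ₀)
  rw [add_sub_cancel] at h2
  linarith

section Compensated

variable {H : Type*} [NormedAddCommGroup H] [NormedSpace ℂ H] {f : E d → H}

/-- The integrand `(exp(2πi ξ·y) - χ(y)) f(y)`. -/
def compensated (σ : ℝ) (f : E d → H) (ξ y : E d) : H :=
  Real.fourierChar (-(negInner d y ξ)) • f y - chi σ y • f y

/-- For σ < 1 nothing is compensated and |f(y)| ≤ 2π|y| is already the weight. For σ ≥ 1 and |y| ≤ 1
the compensated factor is e^{iu} - 1, of size at most 2π min(|ξ||y|, 1); integrating this bound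
produces λ(ξ). -/
lemma norm_compensated_le {y : E d} (hf : ‖f y‖ ≤ 2 * Real.pi * ‖y‖) (hy : ‖y‖ ≤ 1) (ξ : E d) :
    ‖compensated σ f ξ y‖ ≤ gradBound σ ξ y := by
  have hpi := Real.two_pi_pos
  have hy0 := norm_nonneg y
  unfold compensated
  by_cases h1 : σ < 1
  · have hc : chi σ y = 0 := by simp [chi, h1]
    have hw : levyWeight σ y = ‖y‖ := by simp [levyWeight, h1, hy]
    rw [gradBound, hc, hw, zero_smul, sub_zero, Circle.norm_smul]
    simpa using hf
  · have hc : chi σ y = 1 := by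
      unfold chi; split_ifs <;> simp_all
    have hform : Real.fourierChar (-(negInner d y ξ)) • f y - chi σ y • f y
        = (Complex.exp ((2 * Real.pi * inner ℝ ξ y : ℝ) * Complex.I) - 1) • f y := by
      rw [hc, one_smul, sub_smul, one_smul, Circle.smul_def, fourierChar_negInner]
      push_cast
      rfl
    have e1 := norm_cexp_mul_I_sub_one_le (2 * Real.pi * inner ℝ ξ y)
    have e2 := norm_cexp_mul_I_sub_one_le_two (2 * Real.pi * inner ℝ ξ y)
    have e3 := abs_two_pi_inner_le ξ y
    have e4 : ‖Complex.exp ((2 * Real.pi * inner ℝ ξ y : ℝ) * Complex.I) - 1‖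
        ≤ 2 * Real.pi * min (‖ξ‖ * ‖y‖) 1 := by
      rw [mul_min_of_nonneg _ _ hpi.le]
      refine le_min (by linarith) (e2.trans ?_)
      nlinarith [Real.pi_gt_three]
    rw [hform, norm_smul, gradBound, hc]
    calc _ ≤ (2 * Real.pi * min (‖ξ‖ * ‖y‖) 1) * (2 * Real.pi * ‖y‖) := by gcongr
      _ = (2 * Real.pi) ^ 2 * (1 * ‖y‖ * min (‖ξ‖ * ‖y‖) 1) := by ring
      _ ≤ _ := by
        have := levyWeight_nonneg (σ := σ) y
        have : 0 ≤ 2 * Real.pi * levyWeight σ y := by positivity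
        linarith

lemma aestronglyMeasurable_compensated (hm : AEStronglyMeasurable f μ₀) (ξ : E d) :
    AEStronglyMeasurable (compensated σ f ξ) μ₀ := by
  refine AEStronglyMeasurable.sub ?_ ?_
  · exact (continuous_fourierChar_negInner ξ).aestronglyMeasurable.smul hm
  · exact measurable_chi.aestronglyMeasurable.smul hm

lemma integrable_compensated (h : Admissible σ μ₀) (hs : μ₀.restrict {y | ‖y‖ ≤ 1} = μ₀)
    (hm : AEStronglyMeasurable f μ₀) (hf : ∀ y, ‖f y‖ ≤ 2 * Real.pi * ‖y‖) (ξ : E d) :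
    Integrable (compensated σ f ξ) μ₀ := by
  refine (h.integrable_weight.const_mul (2 * Real.pi + (2 * Real.pi) ^ 2 * ‖ξ‖)).mono'
    (aestronglyMeasurable_compensated hm ξ) ?_
  filter_upwards [ae_norm_le_one hs] with y hy
  exact (norm_compensated_le (hf y) hy ξ).trans (gradBound_le hy le_rfl)

lemma norm_fourierSMulRight_negInner_le (hf : ∀ y, ‖f y‖ ≤ 2 * Real.pi * ‖y‖) (y : E d) :
    ‖fourierSMulRight (negInner d) f y‖ ≤ (2 * Real.pi) ^ 2 * ‖y‖ ^ 2 := by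
  have hfy := hf y
  refine (norm_fourierSMulRight_le _ _ _).trans ?_
  calc 2 * Real.pi * ‖negInner d‖ * ‖y‖ * ‖f y‖
      ≤ 2 * Real.pi * ‖y‖ * (2 * Real.pi * ‖y‖) := by
        gcongr ?_ * ‖y‖ * ?_
        exact two_pi_mul_norm_negInner_le
    _ = _ := by ring

lemma integrable_pow_mul_fourierSMulRight (hs : μ₀.restrict {y | ‖y‖ ≤ 1} = μ₀)
    (h2 : Integrable (fun y => ‖y‖ ^ 2) μ₀) (hm : AEStronglyMeasurable f μ₀)
    (hf : ∀ y, ‖f y‖ ≤ 2 * Real.pi * ‖y‖) (n : ℕ) :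
    Integrable (fun y => ‖y‖ ^ n * ‖fourierSMulRight (negInner d) f y‖) μ₀ := by
  refine (h2.const_mul ((2 * Real.pi) ^ 2)).mono' ?_ ?_
  · exact (continuous_norm.pow n).aestronglyMeasurable.mul hm.fourierSMulRight.norm
  · filter_upwards [ae_norm_le_one hs] with y hy
    rw [Real.norm_of_nonneg (by positivity)]
    calc ‖y‖ ^ n * ‖fourierSMulRight (negInner d) f y‖
        ≤ 1 * ‖fourierSMulRight (negInner d) f y‖ := by
          gcongr; exact pow_le_one₀ (norm_nonneg y) hy
      _ ≤ _ := by rw [one_mul]; exact norm_fourierSMulRight_negInner_le hf y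

/-- The compensator does not depend on ξ, so it disappears on differentiation. What remains is an
ordinary Fourier integral of a function of size O(|y|²), integrable for μ₀, whose further regularity
is standard. -/
lemma hasFDerivAt_integral_compensated (h : Admissible σ μ₀)
    (hs : μ₀.restrict {y | ‖y‖ ≤ 1} = μ₀)
    (h2 : Integrable (fun y => ‖y‖ ^ 2) μ₀) (hm : AEStronglyMeasurable f μ₀)
    (hf : ∀ y, ‖f y‖ ≤ 2 * Real.pi * ‖y‖) (ξ₀ : E d) :
    HasFDerivAt (fun ξ => ∫ y, compensated σ f ξ y ∂μ₀)
      (fourierIntegral Real.fourierChar μ₀ (negInner d).toLinearMap₁₂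
        (fourierSMulRight (negInner d) f) ξ₀) ξ₀ := by
  have hI := integrable_pow_mul_fourierSMulRight hs h2 hm hf 0
  simp only [pow_zero, one_mul] at hI
  refine hasFDerivAt_integral_of_dominated_of_fderiv_le
    (F := fun ξ y => compensated σ f ξ y)
    (F' := fun ξ y => Real.fourierChar (-(negInner d y ξ)) • fourierSMulRight (negInner d) f y)
    (bound := fun y => ‖fourierSMulRight (negInner d) f y‖)
    univ_mem (Eventually.of_forall fun ξ => aestronglyMeasurable_compensated hm ξ)
    (integrable_compensated h hs hm hf ξ₀) ?_ ?_ hI ?_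
  · exact (continuous_fourierChar_negInner ξ₀).aestronglyMeasurable.smul hm.fourierSMulRight
  · refine ae_of_all _ fun y ξ _ =>
      ContinuousLinearMap.opNorm_le_bound _ (norm_nonneg _) fun w => ?_
    refine le_trans (le_of_eq ?_) (ContinuousLinearMap.le_opNorm _ w)
    exact Circle.norm_smul (Real.fourierChar (-(negInner d y ξ)))
      (fourierSMulRight (negInner d) f y w)
  · exact ae_of_all _ fun y ξ _ =>
      (hasFDerivAt_fourierChar_smul (negInner d) f y ξ).sub_const _

lemma fderiv_integral_compensated (h : Admissible σ μ₀)
    (hs : μ₀.restrict {y | ‖y‖ ≤ 1} = μ₀)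
    (h2 : Integrable (fun y => ‖y‖ ^ 2) μ₀) (hm : AEStronglyMeasurable f μ₀)
    (hf : ∀ y, ‖f y‖ ≤ 2 * Real.pi * ‖y‖) :
    fderiv ℝ (fun ξ => ∫ y, compensated σ f ξ y ∂μ₀)
      = fourierIntegral Real.fourierChar μ₀ (negInner d).toLinearMap₁₂
        (fourierSMulRight (negInner d) f) :=
  funext fun ξ => (hasFDerivAt_integral_compensated h hs h2 hm hf ξ).fderiv

lemma contDiff_integral_compensated (h : Admissible σ μ₀)
    (hs : μ₀.restrict {y | ‖y‖ ≤ 1} = μ₀)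
    (h2 : Integrable (fun y => ‖y‖ ^ 2) μ₀) (hm : AEStronglyMeasurable f μ₀)
    (hf : ∀ y, ‖f y‖ ≤ 2 * Real.pi * ‖y‖) :
    ContDiff ℝ ∞ (fun ξ => ∫ y, compensated σ f ξ y ∂μ₀) := by
  rw [contDiff_infty_iff_fderiv, fderiv_integral_compensated h hs h2 hm hf]
  refine ⟨fun ξ => (hasFDerivAt_integral_compensated h hs h2 hm hf ξ).differentiableAt, ?_⟩
  exact contDiff_fourierIntegral (N := ⊤) (negInner d)
    (fun n _ => integrable_pow_mul_fourierSMulRight hs h2 hm hf n)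

lemma norm_iteratedFDeriv_integral_compensated_le (h : Admissible σ μ₀)
    (hs : μ₀.restrict {y | ‖y‖ ≤ 1} = μ₀)
    (h2 : Integrable (fun y => ‖y‖ ^ 2) μ₀) (hm : AEStronglyMeasurable f μ₀)
    (hf : ∀ y, ‖f y‖ ≤ 2 * Real.pi * ‖y‖) (n : ℕ) (ξ : E d) :
    ‖iteratedFDeriv ℝ (n + 1) (fun ξ => ∫ y, compensated σ f ξ y ∂μ₀) ξ‖
      ≤ (2 * Real.pi) ^ (n + 2) * ∫ y, ‖y‖ ^ 2 ∂μ₀ := by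
  rw [← norm_iteratedFDeriv_fderiv, fderiv_integral_compensated h hs h2 hm hf,
    iteratedFDeriv_fourierIntegral (N := ⊤) (negInner d)
      (fun n _ => integrable_pow_mul_fourierSMulRight hs h2 hm hf n) hm.fourierSMulRight
      (by exact_mod_cast le_top)]
  refine (norm_fourierIntegral_le_integral_norm _ _ _ _ _).trans ?_
  rw [← integral_const_mul]
  refine integral_mono_of_nonneg (ae_of_all _ fun y => norm_nonneg _) (h2.const_mul _) ?_
  -- Each further derivative costs a factor 2π|y|, at most 2π on the support of μ₀.
  filter_upwards [ae_norm_le_one hs] with y hy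
  have hb := norm_fourierSMulRight_negInner_le hf y
  refine (norm_fourierPowSMulRight_le _ _ _ _).trans ?_
  calc (2 * Real.pi * ‖negInner d‖) ^ n * ‖y‖ ^ n * ‖fourierSMulRight (negInner d) f y‖
      ≤ (2 * Real.pi) ^ n * 1 * ((2 * Real.pi) ^ 2 * ‖y‖ ^ 2) := by
        gcongr ?_ ^ n * ?_ * ?_
        · exact two_pi_mul_norm_negInner_le
        · exact pow_le_one₀ (norm_nonneg y) hy
    _ = _ := by ring

end Compensated

/-- The linear form `2πi ⟨y, ·⟩`. -/
def linForm (y : E d) : E d →L[ℝ] ℂ := fourierSMulRight (negInner d) (fun _ => (1 : ℂ)) y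

lemma norm_linForm_le (y : E d) : ‖linForm y‖ ≤ 2 * Real.pi * ‖y‖ := by
  refine (norm_fourierSMulRight_le _ _ _).trans ?_
  rw [norm_one, mul_one]
  gcongr ?_ * ‖y‖
  exact two_pi_mul_norm_negInner_le

lemma aestronglyMeasurable_linForm : AEStronglyMeasurable (linForm (d := d)) μ₀ :=
  aestronglyMeasurable_const.fourierSMulRight

lemma linForm_apply (y ξ : E d) : linForm y ξ = 2 * Real.pi * (inner ℝ ξ y : ℝ) * Complex.I := by
  simp only [linForm, fourierSMulRight_apply, negInner_apply, smul_eq_mul, Complex.real_smul]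
  push_cast
  ring

lemma hasFDerivAt_levyIntegrand (y ξ : E d) :
    HasFDerivAt (fun ξ => levyIntegrand σ ξ y) (compensated σ linForm ξ y) ξ := by
  have h1 := hasFDerivAt_fourierChar_smul (negInner d) (fun _ => (1 : ℂ)) y ξ
  have h2 := ((linForm y).hasFDerivAt (x := ξ)).const_smul (chi σ y)
  refine ((h1.sub_const 1).sub h2).congr_of_eventuallyEq (Eventually.of_forall fun ξ => ?_)
  simp only [levyIntegrand, Pi.sub_apply, Pi.smul_apply, linForm_apply, Circle.smul_def,
    fourierChar_negInner, smul_eq_mul, Complex.real_smul]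
  ring

/-- The gradient of the symbol. -/
def symbolGrad (σ : ℝ) (μ₀ : Measure (E d)) (ξ : E d) : E d →L[ℝ] ℂ :=
  ∫ y, compensated σ linForm ξ y ∂μ₀

lemma hasFDerivAt_symbol (h : Admissible σ μ₀) (hs : μ₀.restrict {y | ‖y‖ ≤ 1} = μ₀) (ξ₀ : E d) :
    HasFDerivAt (symbol σ μ₀) (symbolGrad σ μ₀ ξ₀) ξ₀ := by
  refine hasFDerivAt_integral_of_dominated_of_fderiv_le (F := levyIntegrand σ)
    (F' := compensated σ linForm)
    (bound := fun y => (2 * Real.pi + (2 * Real.pi) ^ 2 * (‖ξ₀‖ + 1)) * levyWeight σ y)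
    (Metric.ball_mem_nhds ξ₀ one_pos)
    (Eventually.of_forall fun ξ => (measurable_levyIntegrand ξ).aestronglyMeasurable)
    (h.integrable ξ₀) (aestronglyMeasurable_compensated aestronglyMeasurable_linForm ξ₀) ?_
    (h.integrable_weight.const_mul _) (ae_of_all _ fun y ξ _ => hasFDerivAt_levyIntegrand y ξ)
  filter_upwards [ae_norm_le_one hs] with y hy ξ hξ
  exact (norm_compensated_le (norm_linForm_le y) hy ξ).trans
    (gradBound_le hy (norm_le_of_mem_ball hξ))

lemma fderiv_symbol (h : Admissible σ μ₀) (hs : μ₀.restrict {y | ‖y‖ ≤ 1} = μ₀) :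
    fderiv ℝ (symbol σ μ₀) = symbolGrad σ μ₀ :=
  funext fun ξ => (hasFDerivAt_symbol h hs ξ).fderiv

lemma contDiff_symbol (h : Admissible σ μ₀) (hs : μ₀.restrict {y | ‖y‖ ≤ 1} = μ₀)
    (h2 : Integrable (fun y => ‖y‖ ^ 2) μ₀) : ContDiff ℝ ∞ (symbol σ μ₀) := by
  rw [contDiff_infty_iff_fderiv, fderiv_symbol h hs]
  exact ⟨fun ξ => (hasFDerivAt_symbol h hs ξ).differentiableAt,
    contDiff_integral_compensated h hs h2 aestronglyMeasurable_linForm norm_linForm_le⟩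

lemma norm_iteratedFDeriv_symbol_le (h : Admissible σ μ₀)
    (hs : μ₀.restrict {y | ‖y‖ ≤ 1} = μ₀)
    (h2 : Integrable (fun y => ‖y‖ ^ 2) μ₀) (n : ℕ) (ξ : E d) :
    ‖iteratedFDeriv ℝ (n + 2) (symbol σ μ₀) ξ‖
      ≤ (2 * Real.pi) ^ (n + 2) * ∫ y, ‖y‖ ^ 2 ∂μ₀ := by
  rw [show n + 2 = (n + 1) + 1 from rfl, ← norm_iteratedFDeriv_fderiv, fderiv_symbol h hs]
  exact norm_iteratedFDeriv_integral_compensated_le h hs h2 aestronglyMeasurable_linForm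
    norm_linForm_le n ξ

lemma lambdaZero_nonneg (ξ : E d) : 0 ≤ lambdaZero σ μ₀ ξ :=
  integral_nonneg fun y => mul_nonneg (mul_nonneg (chi_nonneg y) (norm_nonneg y)) (by positivity)

/-- The bounds on the derivatives of order at least two do not depend on ξ; only the gradient
requires λ. -/
lemma norm_symbolGrad_le (h : Admissible σ μ₀) (hs : μ₀.restrict {y | ‖y‖ ≤ 1} = μ₀) (ξ : E d) :
    ‖symbolGrad σ μ₀ ξ‖
      ≤ 2 * Real.pi * ∫ y, levyWeight σ y ∂μ₀ + (2 * Real.pi) ^ 2 * lambdaZero σ μ₀ ξ := by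
  have hI : Integrable (fun y => chi σ y * ‖y‖ * min (‖ξ‖ * ‖y‖) 1) μ₀ := by
    refine (h.integrable_weight.const_mul ‖ξ‖).mono' ?_ ?_
    · exact ((measurable_chi.mul measurable_norm).mul (by fun_prop)).aestronglyMeasurable
    · filter_upwards [ae_norm_le_one hs] with y hy
      rw [Real.norm_of_nonneg (mul_nonneg (mul_nonneg (chi_nonneg y) (norm_nonneg y))
        (by positivity))]
      exact chi_mul_min_le hy ξ
  rw [lambdaZero, hs, ← integral_const_mul, ← integral_const_mul,
    ← integral_add (h.integrable_weight.const_mul _) (hI.const_mul _)]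
  refine norm_integral_le_of_norm_le ((h.integrable_weight.const_mul _).add (hI.const_mul _)) ?_
  filter_upwards [ae_norm_le_one hs] with y hy
  exact norm_compensated_le (norm_linForm_le y) hy ξ

/-- The i-th power of a single quantity is the shape demanded by the estimate for derivatives of a
composition. As A(1+λ) ≥ 1, it suffices to bound every derivative by its first power, so A simply
collects the constants of all orders. -/
lemma exists_norm_iteratedFDeriv_symbol_le (h : Admissible σ μ₀)
    (hs : μ₀.restrict {y | ‖y‖ ≤ 1} = μ₀) (h2 : Integrable (fun y => ‖y‖ ^ 2) μ₀) (N : ℕ) :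
    ∃ A : ℝ, 1 ≤ A ∧ ∀ ξ, ∀ i, 1 ≤ i → i ≤ N →
      ‖iteratedFDeriv ℝ i (symbol σ μ₀) ξ‖ ≤ (A * (1 + lambdaZero σ μ₀ ξ)) ^ i := by
  set B : ℕ → ℝ := fun n => (2 * Real.pi) ^ (n + 2) * ∫ y, ‖y‖ ^ 2 ∂μ₀ with hB
  have hB0 : ∀ n, 0 ≤ B n := fun n =>
    mul_nonneg (by positivity) (integral_nonneg fun y => by positivity)
  set W : ℝ := ∫ y, levyWeight σ y ∂μ₀
  have hW : 0 ≤ W := integral_nonneg fun y => levyWeight_nonneg y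
  have hS : 0 ≤ ∑ n ∈ Finset.range N, B n := Finset.sum_nonneg fun n _ => hB0 n
  set A : ℝ := 1 + 2 * Real.pi * W + (2 * Real.pi) ^ 2 + ∑ n ∈ Finset.range N, B n with hA
  have hW' : 0 ≤ 2 * Real.pi * W := by positivity
  have hA1 : 1 ≤ A := by rw [hA]; nlinarith [sq_nonneg (2 * Real.pi)]
  refine ⟨A, hA1, fun ξ i hi1 hiN => ?_⟩
  have hl := lambdaZero_nonneg (σ := σ) (μ₀ := μ₀) ξ
  have hD1 : 1 ≤ A * (1 + lambdaZero σ μ₀ ξ) := by nlinarith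
  refine le_trans ?_ (le_self_pow₀ hD1 (by omega))
  obtain ⟨j, rfl⟩ : ∃ j, i = j + 1 := ⟨i - 1, by omega⟩
  rcases j with _ | n
  · rw [← norm_iteratedFDeriv_fderiv, fderiv_symbol h hs, norm_iteratedFDeriv_zero]
    refine (norm_symbolGrad_le h hs ξ).trans ?_
    have h1 : 2 * Real.pi * W ≤ A := by rw [hA]; nlinarith [sq_nonneg (2 * Real.pi)]
    have h2 : (2 * Real.pi) ^ 2 ≤ A := by rw [hA]; linarith
    have h3 := mul_le_mul_of_nonneg_right h2 hl
    linarith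
  · refine (norm_iteratedFDeriv_symbol_le h hs h2 n ξ).trans ?_
    have h1 : B n ≤ ∑ n ∈ Finset.range N, B n :=
      Finset.single_le_sum (fun n _ => hB0 n) (Finset.mem_range.2 (by omega))
    have h3 : B n ≤ A := by rw [hA]; nlinarith [sq_nonneg (2 * Real.pi)]
    change B n ≤ _
    nlinarith

/-- The vector a is there for the induction: the real derivative of e^z • a has the same form, with
a replaced by w ↦ w • a, whose norm is no larger. -/
lemma norm_iteratedFDeriv_exp_smul_le {G : Type*} [NormedAddCommGroup G] [NormedSpace ℂ G]
    (a : G) (n : ℕ) (z : ℂ) :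
    ‖iteratedFDeriv ℝ n (fun z : ℂ => Complex.exp z • a) z‖ ≤ ‖Complex.exp z‖ * ‖a‖ := by
  induction n generalizing G with
  | zero => rw [norm_iteratedFDeriv_zero, norm_smul]
  | succ n ih =>
    have hd : fderiv ℝ (fun z : ℂ => Complex.exp z • a)
        = fun z => Complex.exp z • ((1 : ℂ →L[ℝ] ℂ).smulRight a) := by
      ext1 z
      have h1 : HasFDerivAt Complex.exp (Complex.exp z • (1 : ℂ →L[ℝ] ℂ)) z :=
        (Complex.hasStrictFDerivAt_exp_real z).hasFDerivAt
      rw [(h1.smul_const a).fderiv]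
      ext w
      simp [smul_smul]
    rw [← norm_iteratedFDeriv_fderiv, hd]
    refine (ih _).trans ?_
    gcongr
    refine ContinuousLinearMap.opNorm_le_bound _ (norm_nonneg a) fun w => ?_
    simp [norm_smul, mul_comm]

end Decay

/-! ### Integrability of the gradient of the auxiliary density. -/

section Smoothness

variable {d : ℕ} {σ : ℝ} {μ₀ : Measure (E d)}

lemma norm_exp_symbol (h : Admissible σ μ₀) (hs : μ₀.restrict {y | ‖y‖ ≤ 1} = μ₀) (ξ : E d) :
    ‖Complex.exp (symbol σ μ₀ ξ)‖ = Real.exp (-psiZero μ₀ ξ) := by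
  rw [Complex.norm_exp, symbol_re h, psiZero, hs]

/-- Faà di Bruno for exp ∘ ψ: every derivative of exp at ψ(ξ) has norm at most |exp ψ(ξ)| =
exp(-ψ_0(ξ)), and the i-th derivatives of ψ are at most (A(1+λ))^i. -/
lemma exists_norm_iteratedFDeriv_exp_symbol_le (h : Admissible σ μ₀)
    (hs : μ₀.restrict {y | ‖y‖ ≤ 1} = μ₀) (h2 : Integrable (fun y => ‖y‖ ^ 2) μ₀) (N : ℕ) :
    ∃ C : ℝ, 0 ≤ C ∧ ∀ n ≤ N, ∀ ξ,
      ‖iteratedFDeriv ℝ n (fun ξ => Complex.exp (symbol σ μ₀ ξ)) ξ‖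
        ≤ C * ((1 + lambdaZero σ μ₀ ξ) ^ N * Real.exp (-psiZero μ₀ ξ)) := by
  obtain ⟨A, hA1, hA⟩ := exists_norm_iteratedFDeriv_symbol_le h hs h2 N
  refine ⟨(N.factorial : ℝ) * A ^ N, by positivity, fun n hn ξ => ?_⟩
  have hl := lambdaZero_nonneg (σ := σ) (μ₀ := μ₀) ξ
  have hexp : ContDiff ℝ ∞ Complex.exp := Complex.contDiff_exp
  have key := norm_iteratedFDeriv_comp_le (n := n) (N := ∞) hexp (contDiff_symbol h hs h2)
    (by exact_mod_cast le_top) ξ (C := Real.exp (-psiZero μ₀ ξ))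
    (D := A * (1 + lambdaZero σ μ₀ ξ))
    (fun i _ => by
      have := norm_iteratedFDeriv_exp_smul_le (1 : ℂ) i (symbol σ μ₀ ξ)
      simpa [norm_exp_symbol h hs] using this)
    (fun i hi1 hin => hA ξ i hi1 (hin.trans hn))
  refine key.trans ?_
  have hD1 : 1 ≤ A * (1 + lambdaZero σ μ₀ ξ) := by nlinarith
  calc (n.factorial : ℝ) * Real.exp (-psiZero μ₀ ξ) * (A * (1 + lambdaZero σ μ₀ ξ)) ^ n
      ≤ (N.factorial : ℝ) * Real.exp (-psiZero μ₀ ξ) * (A * (1 + lambdaZero σ μ₀ ξ)) ^ N := by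
        gcongr
    _ = _ := by rw [mul_pow]; ring

/-- The weight |ξ|⁴ dominates |ξ|^k only outside the unit ball; inside, continuity on a compact set
is enough. -/
lemma integrable_pow_mul_of_le {F : Type*} [NormedAddCommGroup F] {g : E d → F}
    (hg : Continuous g) {w : E d → ℝ}
    (hw : ∫⁻ ξ, ENNReal.ofReal (‖ξ‖ ^ 4 * w ξ) < ⊤) {C : ℝ} (hC : 0 ≤ C)
    (hle : ∀ ξ, ‖g ξ‖ ≤ C * w ξ) {k : ℕ} (hk : k ≤ 4) :
    Integrable (fun ξ => ‖ξ‖ ^ k * ‖g ξ‖) := by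
  have hc : Continuous fun ξ => ‖ξ‖ ^ k * ‖g ξ‖ := by fun_prop
  have hball : IntegrableOn (fun ξ => ‖ξ‖ ^ k * ‖g ξ‖) (Metric.closedBall 0 1) :=
    hc.continuousOn.integrableOn_compact (isCompact_closedBall 0 1)
  have hcompl : IntegrableOn (fun ξ => ‖ξ‖ ^ k * ‖g ξ‖) (Metric.closedBall 0 1)ᶜ := by
    refine ⟨hc.aestronglyMeasurable, ?_⟩
    rw [hasFiniteIntegral_iff_ofReal (ae_of_all _ fun ξ => by positivity)]
    calc ∫⁻ ξ in (Metric.closedBall 0 1)ᶜ, ENNReal.ofReal (‖ξ‖ ^ k * ‖g ξ‖)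
        ≤ ∫⁻ ξ in (Metric.closedBall 0 1)ᶜ, ENNReal.ofReal C * ENNReal.ofReal (‖ξ‖ ^ 4 * w ξ) := by
          refine setLIntegral_mono' Metric.isClosed_closedBall.measurableSet.compl fun ξ hξ => ?_
          rw [← ENNReal.ofReal_mul hC]
          refine ENNReal.ofReal_le_ofReal ?_
          have h1 : 1 ≤ ‖ξ‖ := by
            have : ¬ ‖ξ‖ ≤ 1 := by simpa using hξ
            linarith
          calc ‖ξ‖ ^ k * ‖g ξ‖ ≤ ‖ξ‖ ^ 4 * (C * w ξ) := by
                gcongr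
                exact hle ξ
            _ = _ := by ring
      _ ≤ ∫⁻ ξ, ENNReal.ofReal C * ENNReal.ofReal (‖ξ‖ ^ 4 * w ξ) := setLIntegral_le_lintegral _ _
      _ = ENNReal.ofReal C * ∫⁻ ξ, ENNReal.ofReal (‖ξ‖ ^ 4 * w ξ) :=
          lintegral_const_mul' _ _ ENNReal.ofReal_ne_top
      _ < ⊤ := ENNReal.mul_lt_top ENNReal.ofReal_lt_top hw
  rw [← integrableOn_univ, ← union_compl_self (Metric.closedBall (0 : E d) 1)]
  exact hball.union hcompl

lemma integrable_of_pow_mul_le {F : Type*} [NormedAddCommGroup F] {g : E d → F}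
    (hg : Continuous g) {C₀ C₁ : ℝ} (h0 : ∀ x, ‖g x‖ ≤ C₀)
    (h1 : ∀ x, ‖x‖ ^ (d + 1) * ‖g x‖ ≤ C₁) : Integrable g := by
  have hI : Integrable fun x : E d => (1 + ‖x‖) ^ (-((d + 1 : ℕ) : ℝ)) :=
    integrable_one_add_norm (by
      rw [finrank_euclideanSpace_fin]; push_cast; linarith)
  refine (hI.const_mul (2 ^ d * (C₀ + C₁))).mono' hg.aestronglyMeasurable (ae_of_all _ fun x => ?_)
  have hx : 0 < 1 + ‖x‖ := by positivity
  rw [Real.rpow_neg hx.le, Real.rpow_natCast, ← div_eq_mul_inv, le_div_iff₀ (by positivity)]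
  have hp : (1 + ‖x‖) ^ (d + 1) ≤ 2 ^ d * (1 ^ (d + 1) + ‖x‖ ^ (d + 1)) :=
    add_pow_le zero_le_one (norm_nonneg x) (d + 1)
  calc ‖g x‖ * (1 + ‖x‖) ^ (d + 1) ≤ ‖g x‖ * (2 ^ d * (1 ^ (d + 1) + ‖x‖ ^ (d + 1))) := by gcongr
    _ = 2 ^ d * (‖g x‖ + ‖x‖ ^ (d + 1) * ‖g x‖) := by ring
    _ ≤ _ := by
      have := h0 x
      have := h1 x
      gcongr

/-- Regularity of the auxiliary density at time one. -/
lemma smooth_aux_density (h : Admissible σ μ₀)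
    (hs : μ₀.restrict {y | ‖y‖ ≤ 1} = μ₀) (h2 : Integrable (fun y => ‖y‖ ^ 2) μ₀)
    (hw : ∫⁻ ξ, ENNReal.ofReal (‖ξ‖ ^ 4 * (1 + lambdaZero σ μ₀ ξ) ^ (d + 3)
        * Real.exp (-psiZero μ₀ ξ)) < ⊤) :
    Integrable (fun ξ => Complex.exp (symbol σ μ₀ ξ)) ∧
    ContDiff ℝ 1 (𝓕 fun ξ => Complex.exp (symbol σ μ₀ ξ)) ∧
    Integrable (fderiv ℝ (𝓕 fun ξ => Complex.exp (symbol σ μ₀ ξ))) := by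
  set φ : E d → ℂ := fun ξ => Complex.exp (symbol σ μ₀ ξ) with hφ
  have hsm : ContDiff ℝ ∞ φ := Complex.contDiff_exp.comp (contDiff_symbol h hs h2)
  obtain ⟨C, hC, hbound⟩ := exists_norm_iteratedFDeriv_exp_symbol_le h hs h2 (d + 3)
  have hintegrable : ∀ k n : ℕ, k ≤ 4 → n ≤ d + 3 →
      Integrable (fun ξ => ‖ξ‖ ^ k * ‖iteratedFDeriv ℝ n φ ξ‖) := by
    intro k n hk hn
    refine integrable_pow_mul_of_le
      (w := fun ξ => (1 + lambdaZero σ μ₀ ξ) ^ (d + 3) * Real.exp (-psiZero μ₀ ξ)) ?_ ?_ hC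
      (hbound n hn) hk
    · exact hsm.continuous_iteratedFDeriv (by exact_mod_cast le_top)
    · simpa only [mul_assoc] using hw
  have hk0 : ∀ k ≤ 4, Integrable (fun ξ => ‖ξ‖ ^ k * ‖φ ξ‖) := by
    intro k hk
    simpa using hintegrable k 0 hk (Nat.zero_le _)
  have hφi : Integrable φ := by
    have := hk0 0 (by norm_num)
    simp only [pow_zero, one_mul] at this
    exact (integrable_norm_iff hsm.continuous.aestronglyMeasurable).1 this
  have hcd : ContDiff ℝ 1 (𝓕 φ) :=
    Real.contDiff_fourier (N := 1) fun n hn => hk0 n (by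
      have : n ≤ 1 := by exact_mod_cast hn
      omega)
  -- Each factor |x| costs one derivative of φ, and the gradient costs one power of |ξ|. Using n = 0
  -- and n = d + 1 gives decay of order (1+|x|)^{-(d+1)}, integrable in dimension d.
  have hdecay : ∀ n ≤ d + 1, ∃ C', ∀ x, ‖x‖ ^ n * ‖fderiv ℝ (𝓕 φ) x‖ ≤ C' := by
    intro n hn
    have hfd : ∀ x, ‖iteratedFDeriv ℝ 1 (𝓕 φ) x‖ = ‖fderiv ℝ (𝓕 φ) x‖ := fun x => by
      rw [← zero_add 1, ← norm_iteratedFDeriv_fderiv, norm_iteratedFDeriv_zero]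
    have key := Real.pow_mul_norm_iteratedFDeriv_fourier_le (f := φ) (K := 1)
      (N := (d + 1 : ℕ)) (k := 1) (n := n)
      (hsm.of_le (by exact_mod_cast le_top))
      (fun k m hk hm => hintegrable k m
        (by have : k ≤ 1 := by exact_mod_cast hk
            omega)
        (by have : m ≤ d + 1 := by exact_mod_cast hm
            omega)) (by norm_num) (by exact_mod_cast hn)
    simp_rw [hfd] at key
    exact ⟨_, key⟩
  obtain ⟨C₀, h0⟩ := hdecay 0 (Nat.zero_le _)
  obtain ⟨C₁, h1⟩ := hdecay (d + 1) le_rfl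
  refine ⟨hφi, hcd, integrable_of_pow_mul_le (hcd.continuous_fderiv one_ne_zero) (C₀ := C₀)
    (C₁ := C₁) (fun x => by simpa using h0 x) h1⟩

end Smoothness

/-! ### Scaling of Lévy measures and symbols; factorization of the law. -/

section Rescaling

variable {d : ℕ} {σ : ℝ} {κ l : ℝ → ℝ} {π ν ν' μ₀ : Measure (E d)}

lemma rescaled_zero (hπ : π {0} = 0) {R : ℝ} (hR : 0 < R) : rescaled κ π R {0} = 0 := by
  have hpre : (fun y : E d => R⁻¹ • y) ⁻¹' {0} = {0} := by
    ext y; simp [hR.ne']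
  rw [rescaled, Measure.smul_apply, Measure.map_apply (by fun_prop) (measurableSet_singleton 0),
    hpre, hπ, smul_zero]

lemma measurableSet_norm_le_one : MeasurableSet {y : E d | ‖y‖ ≤ 1} :=
  measurableSet_le measurable_norm measurable_const

lemma levyWeight_le_rpow_of_norm_le_one {α : ℝ} (h1 : σ < 1 → α ≤ 1) (h2 : α ≤ 2) {y : E d}
    (hy : ‖y‖ ≤ 1) : levyWeight σ y ≤ ‖y‖ ^ α := by
  rcases eq_or_ne y 0 with rfl | hy0
  · have : levyWeight σ (0 : E d) = 0 := by simp [levyWeight]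
    rw [this]; positivity
  have hpos : 0 < ‖y‖ := norm_pos_iff.2 hy0
  have e2 : ‖y‖ ^ 2 ≤ ‖y‖ ^ α := by
    rw [← Real.rpow_two]; exact Real.rpow_le_rpow_of_exponent_ge hpos hy h2
  unfold levyWeight
  split_ifs with h
  · refine (min_le_left _ _).trans ?_
    simpa using Real.rpow_le_rpow_of_exponent_ge hpos hy (h1 h)
  · exact (min_le_left _ _).trans e2
  · exact (min_le_left _ _).trans e2

lemma levyWeight_le_rpow_of_one_lt_norm {α : ℝ} (h1 : 1 < σ → 1 ≤ α) (h2 : 0 ≤ α) {y : E d}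
    (hy : 1 < ‖y‖) : levyWeight σ y ≤ ‖y‖ ^ α := by
  have e2 : 1 ≤ ‖y‖ ^ α := Real.one_le_rpow hy.le h2
  unfold levyWeight
  split_ifs with h h'
  · exact (min_le_right _ _).trans e2
  · exact (min_le_right _ _).trans e2
  · refine (min_le_right _ _).trans ?_
    have hσ : 1 < σ := lt_of_le_of_ne (not_lt.1 h) (Ne.symm h')
    simpa using Real.rpow_le_rpow_of_exponent_le hy.le (h1 hσ)

/-- This is the role of assumption B: the admissible ranges of α₁ and α₂ are such that the weight is
at most |y|^{α₁} on the unit ball and |y|^{α₂} outside it. -/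
lemma admissible_rescaled (hπ : IsLevyMeasure σ π) (hB : AssumptionB σ κ π) {R : ℝ} (hR : 0 < R) :
    Admissible σ (rescaled κ π R) := by
  obtain ⟨α₁, α₂, N₀, -, h1, h2, h3, hN⟩ := hB
  refine ⟨rescaled_zero hπ.zero hR, ?_⟩
  have ha : (σ < 1 → α₁ ≤ 1) ∧ α₁ ≤ 2 ∧ (1 < σ → 1 ≤ α₂) ∧ 0 ≤ α₂ := by
    rcases lt_trichotomy σ 1 with h | h | h
    · obtain ⟨⟨_, _⟩, ⟨_, _⟩⟩ := h1 h
      exact ⟨fun _ => by linarith, by linarith, fun _ => by linarith, by linarith⟩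
    · obtain ⟨⟨_, _⟩, ⟨_, _⟩⟩ := h3 h
      exact ⟨fun _ => by linarith, by linarith, fun _ => by linarith, by linarith⟩
    · obtain ⟨⟨_, _⟩, ⟨_, _⟩⟩ := h2 h
      exact ⟨fun _ => by linarith, by linarith, fun _ => by linarith, by linarith⟩
  obtain ⟨a1, a2, a3, a4⟩ := ha
  rw [← lintegral_add_compl _ measurableSet_norm_le_one]
  refine lt_of_le_of_lt (le_trans (add_le_add ?_ ?_) (hN R hR)) ENNReal.ofReal_lt_top
  · exact setLIntegral_mono' measurableSet_norm_le_one fun y hy =>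
      ENNReal.ofReal_le_ofReal (levyWeight_le_rpow_of_norm_le_one a1 a2 hy)
  · have hc : {y : E d | ‖y‖ ≤ 1}ᶜ = {y | 1 < ‖y‖} := by ext y; simp
    rw [hc]
    exact setLIntegral_mono' (measurableSet_lt measurable_const measurable_norm) fun y hy =>
      ENNReal.ofReal_le_ofReal (levyWeight_le_rpow_of_one_lt_norm a3 a4 hy)

lemma admissible_of_rescaled (hκ : 0 < κ 1) (h : Admissible σ (rescaled κ π 1)) :
    Admissible σ π := by
  have : π = (ENNReal.ofReal (κ 1))⁻¹ • rescaled κ π 1 := by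
    rw [rescaled, smul_smul, ENNReal.inv_mul_cancel (by simpa using hκ) ENNReal.ofReal_ne_top]
    simp
  rw [this]
  exact h.smul (by simpa using hκ)

/-- The change of the drift caused by rescaling. -/
lemma levyIntegrand_rescale {R : ℝ} (hR : 0 < R) (ξ y : E d) :
    levyIntegrand σ (R • ξ) (R⁻¹ • y) = levyIntegrand σ ξ y +
      2 * Real.pi * Complex.I * (inner ℝ ξ ((chi σ y - chi σ (R⁻¹ • y)) • y) : ℝ) := by
  have : (inner ℝ (R • ξ) (R⁻¹ • y) : ℝ) = inner ℝ ξ y := by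
    rw [real_inner_smul_left, real_inner_smul_right, mul_inv_cancel_left₀ hR.ne']
  simp only [levyIntegrand, this, real_inner_smul_right]
  push_cast
  ring

lemma chi_sub_chi_eq_zero_of_ne (h : σ ≠ 1) (y y' : E d) : chi σ y - chi σ y' = 0 := by
  unfold chi; split_ifs <;> simp_all

lemma norm_inv_smul_le_one_iff {R : ℝ} (hR : 0 < R) (y : E d) : ‖R⁻¹ • y‖ ≤ 1 ↔ ‖y‖ ≤ R := by
  rw [norm_smul, norm_inv, Real.norm_of_nonneg hR.le, inv_mul_le_iff₀ hR, mul_one]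

/-- For σ = 1 the two indicators differ only on the shell between the radii 1 and R, where |y| ≤
max(1, R) and ν has finite mass; otherwise the integrand is zero. -/
lemma Admissible.integrable_drift (h : Admissible σ ν) {R : ℝ} (hR : 0 < R) :
    Integrable (fun y => (chi σ y - chi σ (R⁻¹ • y)) • y) ν := by
  by_cases hσ : σ = 1
  swap
  · simp_rw [chi_sub_chi_eq_zero_of_ne hσ, zero_smul]; exact integrable_zero _ _ _
  have hfin := h.isFiniteMeasure_restrict (ε := min 1 R) (by positivity)
  have hs : MeasurableSet {y : E d | min 1 R < ‖y‖} :=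
    measurableSet_lt measurable_const measurable_norm
  have hsupp : (fun y => (chi σ y - chi σ (R⁻¹ • y)) • y) =
      {y : E d | min 1 R < ‖y‖}.indicator (fun y => (chi σ y - chi σ (R⁻¹ • y)) • y) := by
    symm
    rw [indicator_eq_self]
    intro y hy
    by_contra hle
    simp only [mem_ofPred_eq, not_lt, le_min_iff] at hle
    apply hy
    have e1 : chi σ y = 1 := by simp [chi, hσ, hle.1]
    have e2 : chi σ (R⁻¹ • y) = 1 := by simp [chi, hσ, (norm_inv_smul_le_one_iff hR y).2 hle.2]
    simp [e1, e2]
  rw [hsupp, integrable_indicator_iff hs]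
  refine (integrable_const (max 1 R)).mono' ?_ (ae_of_all _ fun y => ?_)
  · have h1 := measurable_chi (d := d) (σ := σ)
    have h2 : Measurable fun y : E d => chi σ (R⁻¹ • y) := h1.comp (measurable_const_smul _)
    exact ((h1.sub h2).smul measurable_id).aestronglyMeasurable
  · rw [norm_smul]
    by_cases a1 : ‖y‖ ≤ 1 <;> by_cases a2 : ‖R⁻¹ • y‖ ≤ 1
    · simp [chi, hσ, a1, a2]
    · simp [chi, hσ, a1, a2]
    · simp only [chi, hσ, a1, a2, lt_irrefl, if_true, if_false]
      rw [norm_inv_smul_le_one_iff hR] at a2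
      simp [a2]
    · simp [chi, hσ, a1, a2]

/-- For σ = 1 the integral is, up to sign, that of y over the shell between 1 and R, which vanishes
because π is centered. -/
lemma integral_drift_eq_zero (hπ : IsLevyMeasure σ π) {R : ℝ} (hR : 0 < R) :
    ∫ y, (chi σ y - chi σ (R⁻¹ • y)) • y ∂π = 0 := by
  by_cases hσ : σ = 1
  swap
  · simp_rw [chi_sub_chi_eq_zero_of_ne hσ, zero_smul]; exact integral_zero _ _
  have hm : ∀ a b : ℝ, MeasurableSet {y : E d | a < ‖y‖ ∧ ‖y‖ ≤ b} := fun a b =>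
    (measurableSet_lt measurable_const measurable_norm).inter
      (measurableSet_le measurable_norm measurable_const)
  rcases lt_trichotomy R 1 with hR1 | rfl | hR1
  · have e : (fun y : E d => (chi σ y - chi σ (R⁻¹ • y)) • y) =
        {y : E d | R < ‖y‖ ∧ ‖y‖ ≤ 1}.indicator (fun y => y) := by
      ext1 y
      simp only [chi, hσ, lt_irrefl, if_true, if_false, norm_inv_smul_le_one_iff hR,
        indicator_apply, mem_ofPred_eq]
      rcases le_or_gt ‖y‖ R with h1 | h1
      · simp [h1, h1.trans hR1.le, not_lt.2 h1]
      · by_cases h2 : ‖y‖ ≤ 1 <;> simp [h1, h2, not_le.2 h1]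
    rw [e, integral_indicator (hm _ _)]
    exact hπ.centered hσ R 1 hR hR1
  · simp
  · have e : (fun y : E d => (chi σ y - chi σ (R⁻¹ • y)) • y) =
        fun y => -({y : E d | 1 < ‖y‖ ∧ ‖y‖ ≤ R}.indicator (fun y => y) y) := by
      ext1 y
      simp only [chi, hσ, lt_irrefl, if_true, if_false, norm_inv_smul_le_one_iff hR,
        indicator_apply, mem_ofPred_eq]
      rcases le_or_gt ‖y‖ 1 with h1 | h1
      · simp [h1, h1.trans hR1.le, not_lt.2 h1]
      · by_cases h2 : ‖y‖ ≤ R <;> simp [h1, h2, not_le.2 h1]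
    rw [e, integral_neg, integral_indicator (hm _ _), hπ.centered hσ 1 R one_pos hR1, neg_zero]

lemma integral_levyIntegrand_rescale (h : Admissible σ ν) {R : ℝ} (hR : 0 < R) (ξ : E d) :
    ∫ y, levyIntegrand σ (R • ξ) (R⁻¹ • y) ∂ν = symbol σ ν ξ +
      2 * Real.pi * (inner ℝ ξ (∫ y, (chi σ y - chi σ (R⁻¹ • y)) • y ∂ν) : ℝ) * Complex.I := by
  have hi := h.integrable_drift hR
  have hi2 : Integrable (fun y => 2 * Real.pi * Complex.I *
      ((inner ℝ ξ ((chi σ y - chi σ (R⁻¹ • y)) • y) : ℝ) : ℂ)) ν :=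
    (hi.const_inner ξ).ofReal.const_mul _
  simp_rw [levyIntegrand_rescale hR]
  rw [integral_add (h.integrable ξ) hi2, integral_const_mul, integral_complex_ofReal,
    integral_inner hi, symbol_eq_integral]
  ring

lemma symbol_map_smul (r : ℝ) (ξ : E d) :
    symbol σ (ν.map fun y => r • y) ξ = ∫ y, levyIntegrand σ ξ (r • y) ∂ν := by
  rw [symbol_eq_integral, integral_map (by fun_prop)
    (measurable_levyIntegrand ξ).aestronglyMeasurable]

/-- The scaling of the symbol. -/
lemma symbol_rescaled (hπ : IsLevyMeasure σ π) (h : Admissible σ π) {R : ℝ} (hR : 0 < R)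
    (hκ : 0 ≤ κ R) (ξ : E d) :
    symbol σ (rescaled κ π R) (R • ξ) = κ R * symbol σ π ξ := by
  rw [rescaled, symbol_smul hκ, symbol_map_smul, integral_levyIntegrand_rescale h hR,
    integral_drift_eq_zero hπ hR]
  simp

/-- The scaled auxiliary measure is dominated by the rescaled measure. -/
lemma map_smul_le_rescaled (hκ : IsScalingFunction κ l)
    (hD : ∀ R, 0 < R → μ₀ ≤ rescaled κ π R) {R r t : ℝ} (hR : 0 < R) (hr : 0 < r)
    (hlt : l r ≤ t) :
    μ₀.map (fun y => r • y) ≤ ENNReal.ofReal t • rescaled κ π R := by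
  have hκR := hκ.pos R hR
  -- Domination is used at radius rR rather than R: dilating κ(rR)π_{rR} by r gives κ(rR)π_R, and
  -- κ(rR) ≤ l(r)κ(R) ≤ tκ(R).
  have h1 : μ₀.map (fun y => r • y) ≤ (rescaled κ π (r * R)).map (fun y => r • y) :=
    Measure.map_mono (hD _ (by positivity)) (by fun_prop)
  have h2 : (rescaled κ π (r * R)).map (fun y => r • y)
      = ENNReal.ofReal (κ (r * R)) • π.map (fun y => R⁻¹ • y) := by
    rw [rescaled, Measure.map_smul, Measure.map_map (by fun_prop) (by fun_prop)]
    congr 2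
    ext1 y
    simp only [Function.comp_apply, smul_smul]
    congr 1
    field_simp
  have h3 : κ (r * R) ≤ t * κ R :=
    (hκ.scaling r R hr hR).trans (mul_le_mul_of_nonneg_right hlt hκR.le)
  have ht : 0 ≤ t := by
    by_contra! ht
    have := hκ.pos (r * R) (by positivity)
    nlinarith
  rw [h2] at h1
  refine h1.trans ?_
  rw [rescaled, smul_smul, ← ENNReal.ofReal_mul ht]
  intro s
  simp only [Measure.smul_apply, smul_eq_mul]
  gcongr

/-- Lévy measures may be infinite, so the difference is formed as a density, 1 - dν'/dν with respect
to ν. -/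
lemma exists_add_eq_of_le [SigmaFinite ν] (hle : ν' ≤ ν) : ∃ ρ : Measure (E d), ν = ν' + ρ := by
  have : SigmaFinite ν' := Measure.sigmaFinite_of_le ν hle
  have hac : ν' ≪ ν := Measure.absolutelyContinuous_of_le hle
  refine ⟨ν.withDensity fun y => 1 - ν'.rnDeriv ν y, ?_⟩
  have hm := Measure.measurable_rnDeriv ν' ν
  have hsum : ν' + ν.withDensity (fun y => 1 - ν'.rnDeriv ν y)
      = ν.withDensity (ν'.rnDeriv ν + fun y => 1 - ν'.rnDeriv ν y) := by
    rw [withDensity_add_left hm, Measure.withDensity_rnDeriv_eq _ _ hac]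
  rw [hsum]
  conv_lhs => rw [← withDensity_one (μ := ν)]
  refine withDensity_congr_ae ?_
  have h1 : ν'.rnDeriv ν ≤ᵐ[ν] 1 := Measure.rnDeriv_le_one_of_le hle
  filter_upwards [h1] with y hy
  simp only [Pi.add_apply, Pi.one_apply] at hy ⊢
  rw [add_tsub_cancel_of_le hy]

/-- Factorization of the characteristic function of the rescaled process. -/
lemma exists_factorization (hκ : IsScalingFunction κ l)
    (hD : ∀ R, 0 < R → μ₀ ≤ rescaled κ π R) {R r t : ℝ} (hR : 0 < R) (hr : 0 < r)
    (ht : 0 < t) (hlt : l r ≤ t) (hadm : Admissible σ (rescaled κ π R))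
    (hμ₀ : Admissible σ μ₀) :
    ∃ φ₂ : E d → ℂ, IsCharacteristic φ₂ ∧ ∀ ξ,
      Complex.exp (t * symbol σ (rescaled κ π R) ξ)
        = Complex.exp (symbol σ μ₀ (r • ξ)) * φ₂ ξ := by
  have hle := map_smul_le_rescaled hκ hD hR hr hlt
  have hbig : Admissible σ (ENNReal.ofReal t • rescaled κ π R) := hadm.smul ENNReal.ofReal_ne_top
  have := hbig.sigmaFinite
  obtain ⟨ρ, hρ⟩ := exists_add_eq_of_le hle
  have hρadm : Admissible σ ρ := hbig.mono (by rw [hρ]; exact Measure.le_add_left le_rfl)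
  -- Dilating μ₀ by r moves the truncation level of the compensator. The resulting drift b merely
  -- shifts the law, so a Dirac factor absorbs it.
  set b : E d := r • ∫ y, (chi σ y - chi σ ((r⁻¹)⁻¹ • y)) • y ∂μ₀
  refine ⟨_, (isCharacteristic_dirac b).mul (isCharacteristic_exp_symbol hρadm), fun ξ => ?_⟩
  rw [← symbol_smul ht.le, hρ, symbol_add (hbig.mono hle) hρadm, symbol_map_smul]
  have h1 := integral_levyIntegrand_rescale hμ₀ (inv_pos.2 hr) (r • ξ)
  rw [inv_smul_smul₀ hr.ne', real_inner_smul_left, ← real_inner_smul_right, inv_inv] at h1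
  rw [h1, Complex.exp_add, Complex.exp_add, mul_assoc]
  simp only [b, inv_inv]

end Rescaling

/-! ### Time-integrable bounds for the increments of the densities. -/

section Increments

variable {d : ℕ} {σ : ℝ} {κ l : ℝ → ℝ} {π ν ρ μ₀ : Measure (E d)}

lemma isCharacteristic_exp_mul_symbol (h : Admissible σ ρ) {t : ℝ} (ht : 0 ≤ t) :
    IsCharacteristic (fun ξ => Complex.exp (t * symbol σ ρ ξ)) := by
  simp_rw [← symbol_smul (σ := σ) (ν := ρ) ht]
  exact isCharacteristic_exp_symbol (h.smul ENNReal.ofReal_ne_top)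

lemma continuous_exp_mul_symbol (h : Admissible σ ρ) (t : ℝ) :
    Continuous (fun ξ => Complex.exp (t * symbol σ ρ ξ)) := by
  have := continuous_symbol h
  fun_prop

lemma isLevyDensity_levyDensity (h : Admissible σ ρ) {t : ℝ} (ht : 0 ≤ t)
    (hi : Integrable (fun ξ => Complex.exp (t * symbol σ ρ ξ))) :
    IsLevyDensity σ ρ t (levyDensity σ ρ t) :=
  Classical.epsilon_spec ⟨_, isLevyDensity_fourier (isCharacteristic_exp_mul_symbol h ht)
    (continuous_exp_mul_symbol h t) hi fun _ => rfl⟩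

/-- Since l vanishes at 0, every t > 0 admits some r with l(r) ≤ t. The factorization then bounds
|exp(tψ)| by the dilated auxiliary characteristic function. -/
lemma integrable_exp_mul_symbol (hκ : IsScalingFunction κ l)
    (hD : ∀ R, 0 < R → μ₀ ≤ rescaled κ π R) {R t : ℝ} (hR : 0 < R)
    (ht : 0 < t) (hadm : Admissible σ (rescaled κ π R)) (hμ₀ : Admissible σ μ₀)
    (hi : Integrable (fun ξ => Complex.exp (symbol σ μ₀ ξ))) :
    Integrable (fun ξ => Complex.exp (t * symbol σ (rescaled κ π R) ξ)) := by
  obtain ⟨r, hr, hlt⟩ : ∃ r : ℝ, 0 < r ∧ l r ≤ t := by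
    have h1 : ∀ᶠ r in 𝓝[>] (0 : ℝ), l r < t := hκ.factor_tendsto_zero.eventually (gt_mem_nhds ht)
    obtain ⟨r, hr, hr'⟩ := (h1.and self_mem_nhdsWithin).exists
    exact ⟨r, hr', hr.le⟩
  obtain ⟨φ₂, hφ₂, hfac⟩ := exists_factorization hκ hD hR hr ht hlt hadm hμ₀
  refine (hi.comp_smul hr.ne').mono (continuous_exp_mul_symbol hadm t).aestronglyMeasurable
    (ae_of_all _ fun ξ => ?_)
  rw [hfac, norm_mul]
  exact mul_le_of_le_one_right (norm_nonneg _) (hφ₂.norm_le ξ)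

lemma lintegral_density_increment_le (hκ : IsScalingFunction κ l)
    (hD : ∀ R, 0 < R → μ₀ ≤ rescaled κ π R) {R r t : ℝ} (hR : 0 < R) (hr : 0 < r)
    (ht : 0 < t) (hlt : l r ≤ t) (hadm : Admissible σ (rescaled κ π R)) (hμ₀ : Admissible σ μ₀)
    (hi : Integrable (fun ξ => Complex.exp (symbol σ μ₀ ξ)))
    (hsm : ContDiff ℝ 1 (𝓕 fun ξ => Complex.exp (symbol σ μ₀ ξ))) (h : E d) :
    ∫⁻ x, ‖levyDensity σ (rescaled κ π R) t (x + h) - levyDensity σ (rescaled κ π R) t x‖ₑ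
      ≤ ENNReal.ofReal (r⁻¹ * ‖h‖)
        * ∫⁻ x, ‖fderiv ℝ (𝓕 fun ξ => Complex.exp (symbol σ μ₀ ξ)) x‖ₑ := by
  obtain ⟨φ₂, hφ₂, hfac⟩ := exists_factorization hκ hD hR hr ht hlt hadm hμ₀
  have hintegrable := integrable_exp_mul_symbol hκ hD hR ht hadm hμ₀ hi
  have hdens := isLevyDensity_levyDensity hadm ht.le hintegrable
  refine le_trans (le_of_eq ?_) (lintegral_increment_le hi hsm hφ₂ hr hfac h)
  refine lintegral_congr fun x => ?_
  rw [← hdens.eq_fourier hintegrable, ← hdens.eq_fourier hintegrable, ← Complex.ofReal_sub, ← ofReal_norm,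
    ← ofReal_norm, Complex.norm_real]

lemma lintegral_density_increment_le_two {q : E d → ℝ} {t : ℝ} (hq : IsLevyDensity σ ρ t q)
    (h : E d) : ∫⁻ x, ‖q (x + h) - q x‖ₑ ≤ 2 := by
  have h1 : ∫⁻ x, ‖q x‖ₑ = 1 := by
    have := hq.prob.measure_univ
    rw [withDensity_apply _ MeasurableSet.univ, Measure.restrict_univ] at this
    rw [← this]
    refine lintegral_congr fun x => ?_
    rw [← ofReal_norm, Real.norm_of_nonneg (hq.nonneg x)]
  have hm : Measurable fun x => ‖q x‖ₑ := hq.continuous.measurable.enorm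
  calc ∫⁻ x, ‖q (x + h) - q x‖ₑ ≤ ∫⁻ x, (‖q (x + h)‖ₑ + ‖q x‖ₑ) :=
        lintegral_mono fun x => enorm_sub_le
    _ = 2 := by
        rw [lintegral_add_right _ hm, lintegral_add_right_eq_self (fun x => ‖q x‖ₑ), h1]
        norm_num

/-- The scaling inequality at radius 1 reads l(ε) ≥ κ(ε)/κ(1). -/
lemma scalingFactor_tendsto_atTop (hκ : IsScalingFunction κ l) : Tendsto l atTop atTop := by
  have h1 := hκ.pos 1 one_pos
  refine tendsto_atTop_mono' _ ?_ (hκ.tendsto_atTop.atTop_div_const h1)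
  filter_upwards [eventually_gt_atTop 0] with ε hε
  rw [div_le_iff₀ h1]
  simpa using hκ.scaling ε 1 hε one_pos

/-- The infimum is over a nonempty set because l is unbounded, so the default value `sInf ∅ = 0`
does not occur; it is positive because l is monotone and tends to 0 at 0. -/
lemma scalingInv_pos (hκ : IsScalingFunction κ l) {t : ℝ} (ht : 0 < t) : 0 < scalingInv l t := by
  have h1 : ∀ᶠ r in 𝓝[>] (0 : ℝ), l r < t := hκ.factor_tendsto_zero.eventually (gt_mem_nhds ht)
  obtain ⟨r, hr, hr'⟩ := (h1.and self_mem_nhdsWithin).exists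
  have hr0 : 0 < r := hr'
  refine hr0.trans_le (le_csInf ?_ ?_)
  · obtain ⟨s, hs1, hs2⟩ := (((scalingFactor_tendsto_atTop hκ).eventually_ge_atTop t).and
      (eventually_gt_atTop 0)).exists
    exact ⟨s, hs2, hs1⟩
  · rintro s ⟨hs, hts⟩
    by_contra! hlt
    have := hκ.factor_mono (mem_Ioi.2 hs) (mem_Ioi.2 hr0) hlt.le
    linarith

lemma factor_lt_of_lt_scalingInv {r t : ℝ} (hr : 0 < r) (h : r < scalingInv l t) : l r < t := by
  by_contra! hle
  exact notMem_of_lt_csInf h ⟨0, fun s hs => hs.1.le⟩ ⟨hr, hle⟩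

/-- The uniform bound on the total variation of increments, integrated in time. -/
lemma exists_lintegral_increment_le (hκ : IsScalingFunction κ l)
    (hD : ∀ R, 0 < R → μ₀ ≤ rescaled κ π R)
    (hadm : ∀ R, 0 < R → Admissible σ (rescaled κ π R)) (hμ₀ : Admissible σ μ₀)
    (hi : Integrable (fun ξ => Complex.exp (symbol σ μ₀ ξ)))
    (hsm : ContDiff ℝ 1 (𝓕 fun ξ => Complex.exp (symbol σ μ₀ ξ)))
    (hgrad : Integrable (fderiv ℝ (𝓕 fun ξ => Complex.exp (symbol σ μ₀ ξ))))
    (hγ : IntegrableOn (fun t => (scalingInv l t)⁻¹) (Ioi 1)) :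
    ∃ K : ℝ, 0 < K ∧ ∀ R, 0 < R → ∀ h : E d, ‖h‖ = 1 →
      ∫⁻ t in Ioi (0 : ℝ), ∫⁻ x, ‖levyDensity σ (rescaled κ π R) t (x + h)
        - levyDensity σ (rescaled κ π R) t x‖ₑ ≤ ENNReal.ofReal K := by
  set M : ℝ≥0∞ := ∫⁻ x, ‖fderiv ℝ (𝓕 fun ξ => Complex.exp (symbol σ μ₀ ξ)) x‖ₑ with hM
  have hMfin : M < ⊤ := hgrad.2
  set J : ℝ≥0∞ := ∫⁻ t in Ioi (1 : ℝ), ‖(scalingInv l t)⁻¹‖ₑ with hJ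
  have hJfin : J < ⊤ := hγ.2
  -- The term 2 covers t ≤ 1, where two probability densities differ by at most 2 in L¹. The term
  -- 2MJ covers t > 1 with r = γ(t)/2, strictly below the infimum γ(t) so that l(r) < t.
  set B : ℝ≥0∞ := 2 + 2 * M * J with hB
  have hBfin : B < ⊤ := by
    refine ENNReal.add_lt_top.2 ⟨by norm_num, ENNReal.mul_lt_top ?_ hJfin⟩
    exact ENNReal.mul_lt_top (by norm_num) hMfin
  refine ⟨B.toReal, ENNReal.toReal_pos ?_ hBfin.ne, fun R hR h hh => ?_⟩
  · simp [hB]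
  rw [ENNReal.ofReal_toReal hBfin.ne, ← Ioc_union_Ioi_eq_Ioi (zero_le_one (α := ℝ))]
  refine (lintegral_union_le _ _ _).trans (add_le_add ?_ ?_)
  · calc ∫⁻ t in Ioc (0 : ℝ) 1, ∫⁻ x, ‖levyDensity σ (rescaled κ π R) t (x + h)
          - levyDensity σ (rescaled κ π R) t x‖ₑ
        ≤ ∫⁻ t in Ioc (0 : ℝ) 1, 2 := by
          refine setLIntegral_mono' measurableSet_Ioc fun t ht => ?_
          exact lintegral_density_increment_le_two (isLevyDensity_levyDensity (hadm R hR) ht.1.le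
            (integrable_exp_mul_symbol hκ hD hR ht.1 (hadm R hR) hμ₀ hi)) h
      _ = 2 := by simp
  · calc ∫⁻ t in Ioi (1 : ℝ), ∫⁻ x, ‖levyDensity σ (rescaled κ π R) t (x + h)
          - levyDensity σ (rescaled κ π R) t x‖ₑ
        ≤ ∫⁻ t in Ioi (1 : ℝ), 2 * M * ‖(scalingInv l t)⁻¹‖ₑ := by
          refine setLIntegral_mono' measurableSet_Ioi fun t ht => ?_
          have ht0 : 0 < t := one_pos.trans ht
          have hs := scalingInv_pos hκ ht0
          refine (lintegral_density_increment_le hκ hD hR (half_pos hs) ht0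
            (factor_lt_of_lt_scalingInv (half_pos hs) (half_lt_self hs)).le (hadm R hR) hμ₀ hi hsm
            h).trans (le_of_eq ?_)
          rw [hh, mul_one, inv_div, div_eq_mul_inv, ENNReal.ofReal_mul (by norm_num),
            ← ofReal_norm, Real.norm_of_nonneg (by positivity), ENNReal.ofReal_ofNat]
          ring
      _ = 2 * M * J := lintegral_const_mul' _ _ (ENNReal.mul_lt_top (by norm_num) hMfin).ne

/-- For fixed r the bound M/r holds as soon as t ≥ l(r), and r may be taken arbitrarily large. This
removes the boundary term at infinite time. -/
lemma tendsto_lintegral_increment (hκ : IsScalingFunction κ l)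
    (hD : ∀ R, 0 < R → μ₀ ≤ rescaled κ π R) {R : ℝ} (hR : 0 < R)
    (hadm : Admissible σ (rescaled κ π R)) (hμ₀ : Admissible σ μ₀)
    (hi : Integrable (fun ξ => Complex.exp (symbol σ μ₀ ξ)))
    (hsm : ContDiff ℝ 1 (𝓕 fun ξ => Complex.exp (symbol σ μ₀ ξ)))
    (hgrad : Integrable (fderiv ℝ (𝓕 fun ξ => Complex.exp (symbol σ μ₀ ξ)))) {h : E d}
    (hh : ‖h‖ = 1) :
    Tendsto (fun t => ∫⁻ x, ‖levyDensity σ (rescaled κ π R) t (x + h)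
        - levyDensity σ (rescaled κ π R) t x‖ₑ) atTop (𝓝 0) := by
  set M : ℝ≥0∞ := ∫⁻ x, ‖fderiv ℝ (𝓕 fun ξ => Complex.exp (symbol σ μ₀ ξ)) x‖ₑ with hM
  have hMfin : M < ⊤ := hgrad.2
  have hlim : Tendsto (fun r : ℝ => ENNReal.ofReal r⁻¹ * M) atTop (𝓝 0) := by
    have h1 := ENNReal.tendsto_ofReal (tendsto_inv_atTop_zero (𝕜 := ℝ))
    rw [ENNReal.ofReal_zero] at h1
    simpa using ENNReal.Tendsto.mul_const h1 (Or.inr hMfin.ne)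
  rw [ENNReal.tendsto_nhds_zero]
  intro ε hε
  obtain ⟨r, hrε, hr⟩ := ((hlim.eventually (gt_mem_nhds hε)).and (eventually_gt_atTop 0)).exists
  filter_upwards [eventually_ge_atTop (l r), eventually_gt_atTop 0] with t ht ht0
  refine (lintegral_density_increment_le hκ hD hR hr ht0 ht hadm hμ₀ hi hsm h).trans ?_
  rw [hh, mul_one]
  exact hrε.le

end Increments

/-! ### The operator as a Fourier multiplier on Schwartz functions. -/

section Schwartz

variable {d : ℕ} {σ : ℝ} {κ l : ℝ → ℝ} {π ν ρ μ₀ : Measure (E d)}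

/-- The Fourier transform of a real Schwartz function. -/
def schwartzFourier (f : 𝓢(E d, ℝ)) : 𝓢(E d, ℂ) :=
  𝓕 (SchwartzMap.postcompCLM (𝕜 := ℝ) Complex.ofRealCLM f)

lemma integrable_schwartzFourier (f : 𝓢(E d, ℝ)) : Integrable (schwartzFourier f) :=
  (schwartzFourier f).integrable

lemma fourierInv_schwartzFourier (f : 𝓢(E d, ℝ)) (x : E d) :
    𝓕⁻ (schwartzFourier f : E d → ℂ) x = (f x : ℂ) := by
  rw [schwartzFourier, ← SchwartzMap.fourierInv_coe, FourierTransform.fourierInv_fourier_eq]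
  rfl

lemma integrable_growth_mul (f : 𝓢(E d, ℝ)) :
    Integrable (fun ξ => growth ξ * ‖schwartzFourier f ξ‖) := by
  have h0 := (schwartzFourier f).integrable_pow_mul volume 0
  have h1 := (schwartzFourier f).integrable_pow_mul volume 1
  have h2 := (schwartzFourier f).integrable_pow_mul volume 2
  refine (((h0.const_mul 2).add (h1.const_mul (8 * Real.pi))).add
    (h2.const_mul (8 * Real.pi ^ 2))).congr (ae_of_all _ fun ξ => ?_)
  simp only [Pi.add_apply, growth]
  ring

lemma integrable_norm_mul (f : 𝓢(E d, ℝ)) :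
    Integrable (fun ξ => ‖ξ‖ * ‖schwartzFourier f ξ‖) := by
  simpa using (schwartzFourier f).integrable_pow_mul volume 1

/-- Differentiate s ↦ f(x + sy) at 0 under the Fourier inversion integral; |ξ| times the transform
of f is the dominating function. -/
lemma fderiv_schwartz_eq (f : 𝓢(E d, ℝ)) (x y : E d) :
    (fderiv ℝ f x y : ℂ) = ∫ ξ, Complex.exp ((2 * Real.pi * inner ℝ ξ x : ℝ) * Complex.I) *
      ((2 * Real.pi * (inner ℝ ξ y : ℝ) * Complex.I) * schwartzFourier f ξ) := by
  have hfd : HasDerivAt (fun s : ℝ => (f (x + s • y) : ℂ)) (fderiv ℝ f x y : ℂ) 0 := by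
    have h1 : HasDerivAt (fun s : ℝ => x + s • y) y 0 := by
      simpa using ((hasDerivAt_id (0 : ℝ)).smul_const y).const_add x
    have h2 : HasFDerivAt f (fderiv ℝ f x) (x + (0 : ℝ) • y) := by
      rw [zero_smul, add_zero]; exact f.differentiableAt.hasFDerivAt
    exact (h2.comp_hasDerivAt (0 : ℝ) h1).ofReal_comp
  have hrep : (fun s : ℝ => (f (x + s • y) : ℂ)) = fun s : ℝ => ∫ ξ,
      Complex.exp ((2 * Real.pi * inner ℝ ξ (x + s • y) : ℝ) * Complex.I) * schwartzFourier f ξ := by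
    ext s
    rw [← fourierInv_schwartzFourier, fourierInv_apply]
  rw [hrep] at hfd
  have hm : ∀ s : ℝ, AEStronglyMeasurable (fun ξ : E d =>
      Complex.exp ((2 * Real.pi * inner ℝ ξ (x + s • y) : ℝ) * Complex.I) * schwartzFourier f ξ)
      volume := fun s => (integrable_cexp_mul (integrable_schwartzFourier f) (by fun_prop)).1
  have hder := (hasDerivAt_integral_of_dominated_loc_of_deriv_le (μ := volume)
    (F := fun (s : ℝ) (ξ : E d) =>
      Complex.exp ((2 * Real.pi * inner ℝ ξ (x + s • y) : ℝ) * Complex.I) * schwartzFourier f ξ)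
    (F' := fun (s : ℝ) (ξ : E d) =>
      Complex.exp ((2 * Real.pi * inner ℝ ξ (x + s • y) : ℝ) * Complex.I) *
      ((2 * Real.pi * (inner ℝ ξ y : ℝ) * Complex.I) * schwartzFourier f ξ))
    (bound := fun ξ => 2 * Real.pi * ‖y‖ * (‖ξ‖ * ‖schwartzFourier f ξ‖)) (x₀ := 0)
    univ_mem (Eventually.of_forall hm)
    (integrable_cexp_mul (integrable_schwartzFourier f) (by fun_prop)) ?_ ?_
    ((integrable_norm_mul f).const_mul _) ?_).2
  · have := hfd.unique hder
    simpa using this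
  · have := (schwartzFourier f).continuous
    exact Continuous.aestronglyMeasurable (by fun_prop)
  · refine ae_of_all _ fun ξ s _ => ?_
    rw [norm_mul, Complex.norm_exp_ofReal_mul_I, one_mul, norm_mul]
    have h1 : ‖(2 * Real.pi * (inner ℝ ξ y : ℝ) * Complex.I : ℂ)‖ = |2 * Real.pi * inner ℝ ξ y| := by
      rw [norm_mul, Complex.norm_I, mul_one]
      norm_cast
    rw [h1]
    calc |2 * Real.pi * inner ℝ ξ y| * ‖schwartzFourier f ξ‖
        ≤ (2 * Real.pi * ‖ξ‖ * ‖y‖) * ‖schwartzFourier f ξ‖ := by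
          gcongr; exact abs_two_pi_inner_le ξ y
      _ = _ := by ring
  · refine ae_of_all _ fun ξ s _ => ?_
    have h1 : HasDerivAt (fun s : ℝ => 2 * Real.pi * inner ℝ ξ (x + s • y))
        (2 * Real.pi * inner ℝ ξ y) s := by
      simp_rw [inner_add_right, real_inner_smul_right]
      simpa using (((hasDerivAt_id s).mul_const (inner ℝ ξ y)).const_add (inner ℝ ξ x)).const_mul
        (2 * Real.pi)
    have h2 := ((h1.ofReal_comp.mul_const Complex.I).cexp).mul_const (schwartzFourier f ξ)
    convert! h2 using 1
    push_cast
    ring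

lemma levyOp_integrand_eq (f : 𝓢(E d, ℝ)) (x y : E d) :
    ((f (x + y) - f x - chi σ y * fderiv ℝ f x y : ℝ) : ℂ) =
      ∫ ξ, Complex.exp ((2 * Real.pi * inner ℝ ξ x : ℝ) * Complex.I) *
        (levyIntegrand σ ξ y * schwartzFourier f ξ) := by
  have hF := integrable_schwartzFourier f
  have i1 : Integrable (fun ξ : E d =>
      Complex.exp ((2 * Real.pi * inner ℝ ξ (x + y) : ℝ) * Complex.I) * schwartzFourier f ξ) :=
    integrable_cexp_mul hF (by fun_prop)
  have i2 : Integrable (fun ξ : E d =>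
      Complex.exp ((2 * Real.pi * inner ℝ ξ x : ℝ) * Complex.I) * schwartzFourier f ξ) :=
    integrable_cexp_mul hF (by fun_prop)
  have i3 : Integrable (fun ξ : E d =>
      (chi σ y : ℂ) * (Complex.exp ((2 * Real.pi * inner ℝ ξ x : ℝ) * Complex.I) *
      ((2 * Real.pi * (inner ℝ ξ y : ℝ) * Complex.I) * schwartzFourier f ξ))) := by
    refine Integrable.const_mul (integrable_cexp_mul ?_ (by fun_prop)) _
    refine ((integrable_norm_mul f).const_mul (2 * Real.pi * ‖y‖)).mono' ?_ (ae_of_all _ fun ξ => ?_)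
    · have := (schwartzFourier f).continuous
      exact Continuous.aestronglyMeasurable (by fun_prop)
    · have h1 : ‖(2 * Real.pi * (inner ℝ ξ y : ℝ) * Complex.I : ℂ)‖
          = |2 * Real.pi * inner ℝ ξ y| := by
        rw [norm_mul, Complex.norm_I, mul_one]
        norm_cast
      rw [norm_mul, h1]
      calc |2 * Real.pi * inner ℝ ξ y| * ‖schwartzFourier f ξ‖
          ≤ (2 * Real.pi * ‖ξ‖ * ‖y‖) * ‖schwartzFourier f ξ‖ := by
            gcongr; exact abs_two_pi_inner_le ξ y
        _ = _ := by ring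
  have i12 : Integrable (fun ξ : E d =>
      Complex.exp ((2 * Real.pi * inner ℝ ξ (x + y) : ℝ) * Complex.I) * schwartzFourier f ξ -
      Complex.exp ((2 * Real.pi * inner ℝ ξ x : ℝ) * Complex.I) * schwartzFourier f ξ) := i1.sub i2
  rw [Complex.ofReal_sub, Complex.ofReal_sub, Complex.ofReal_mul,
    fderiv_schwartz_eq, ← fourierInv_schwartzFourier, ← fourierInv_schwartzFourier,
    fourierInv_apply, fourierInv_apply, ← integral_const_mul, ← integral_sub i1 i2,
    ← integral_sub i12 i3]
  congr 1 with ξ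
  have hexp : Complex.exp ((2 * Real.pi * inner ℝ ξ (x + y) : ℝ) * Complex.I) =
      Complex.exp ((2 * Real.pi * inner ℝ ξ x : ℝ) * Complex.I) *
      Complex.exp (2 * Real.pi * (inner ℝ ξ y : ℝ) * Complex.I) := by
    rw [← Complex.exp_add, inner_add_right]
    push_cast
    ring_nf
  simp only [hexp, levyIntegrand]
  ring

lemma integrable_schwartzFourier_mul_symbol (h : Admissible σ π) (f : 𝓢(E d, ℝ)) :
    Integrable (fun ξ => schwartzFourier f ξ * symbol σ π ξ) := by
  refine ((integrable_growth_mul f).const_mul (∫ y, levyWeight σ y ∂π)).mono' ?_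
    (ae_of_all _ fun ξ => ?_)
  · exact ((schwartzFourier f).continuous.mul (continuous_symbol h)).aestronglyMeasurable
  · rw [norm_mul]
    calc ‖schwartzFourier f ξ‖ * ‖symbol σ π ξ‖
        ≤ ‖schwartzFourier f ξ‖ * (growth ξ * ∫ y, levyWeight σ y ∂π) := by
          gcongr; exact norm_symbol_le h ξ
      _ = _ := by ring

lemma measurable_uncurry_levyIntegrand :
    Measurable (fun p : E d × E d => levyIntegrand σ p.2 p.1) := by
  unfold levyIntegrand
  have h : Measurable (fun p : E d × E d => chi σ p.1) := measurable_chi.comp measurable_fst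
  have h2 : Measurable (fun p : E d × E d => (inner ℝ p.2 p.1 : ℝ)) := by fun_prop
  fun_prop

/-- `L^π` is the Fourier multiplier with symbol `ψ^π`. -/
lemma levyOp_eq_fourierInv (h : Admissible σ π) (f : 𝓢(E d, ℝ)) (x : E d) :
    (levyOp σ π f x : ℂ) = 𝓕⁻ (fun ξ => schwartzFourier f ξ * symbol σ π ξ) x := by
  have := h.sigmaFinite
  rw [levyOp, ← integral_complex_ofReal, fourierInv_apply]
  simp_rw [levyOp_integrand_eq]
  have hintegrable : Integrable (fun p : E d × E d =>
      Complex.exp ((2 * Real.pi * inner ℝ p.2 x : ℝ) * Complex.I) *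
        (levyIntegrand σ p.2 p.1 * schwartzFourier f p.2)) (π.prod volume) := by
    refine integrable_cexp_mul ?_ (by fun_prop)
    -- The bound on the integrand separates the variables: `levyWeight` is integrable in y, and
    -- `growth` is polynomial in ξ, absorbed by the Schwartz transform.
    have hdom : Integrable (fun p : E d × E d =>
        levyWeight σ p.1 * (growth p.2 * ‖schwartzFourier f p.2‖)) (π.prod volume) :=
      h.integrable_weight.mul_prod (integrable_growth_mul f)
    refine hdom.mono' ?_ (ae_of_all _ fun p => ?_)
    · have h1 : Measurable fun p : E d × E d => levyIntegrand σ p.2 p.1 :=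
        measurable_uncurry_levyIntegrand
      have h2 : Measurable fun p : E d × E d => schwartzFourier f p.2 :=
        (schwartzFourier f).continuous.measurable.comp measurable_snd
      exact (h1.mul h2).aestronglyMeasurable
    · rw [norm_mul]
      calc ‖levyIntegrand σ p.2 p.1‖ * ‖schwartzFourier f p.2‖
          ≤ (growth p.2 * levyWeight σ p.1) * ‖schwartzFourier f p.2‖ := by
            gcongr; exact norm_levyIntegrand_le _ _
        _ = _ := by ring
  rw [integral_integral_swap (f := fun y ξ =>
    Complex.exp ((2 * Real.pi * inner ℝ ξ x : ℝ) * Complex.I) *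
        (levyIntegrand σ ξ y * schwartzFourier f ξ)) hintegrable]
  congr 1 with ξ
  rw [integral_const_mul, integral_mul_const, ← symbol_eq_integral]
  ring

lemma norm_fourierInv_le (φ : E d → ℂ) (x : E d) : ‖𝓕⁻ φ x‖ ≤ ∫ ξ, ‖φ ξ‖ := by
  rw [Real.fourierInv_eq_fourier_neg]; exact norm_fourier_le φ _

lemma continuous_fourierInv {φ : E d → ℂ} (hi : Integrable φ) : Continuous (𝓕⁻ φ) := by
  have : 𝓕⁻ φ = fun x => 𝓕 φ (-x) := funext fun x => Real.fourierInv_eq_fourier_neg φ x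
  rw [this]
  exact (continuous_fourier hi).comp continuous_neg

lemma continuous_levyOp (h : Admissible σ π) (f : 𝓢(E d, ℝ)) : Continuous (levyOp σ π f) := by
  have h1 := continuous_fourierInv (integrable_schwartzFourier_mul_symbol h f)
  have h2 : levyOp σ π f
      = fun x => (𝓕⁻ (fun ξ => schwartzFourier f ξ * symbol σ π ξ) x).re := by
    ext x; rw [← levyOp_eq_fourierInv h, Complex.ofReal_re]
  rw [h2]
  exact Complex.continuous_re.comp h1

lemma abs_levyOp_le (h : Admissible σ π) (f : 𝓢(E d, ℝ)) (x : E d) :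
    |levyOp σ π f x| ≤ ∫ ξ, ‖schwartzFourier f ξ * symbol σ π ξ‖ := by
  rw [← Real.norm_eq_abs, ← Complex.norm_real, levyOp_eq_fourierInv h]
  exact norm_fourierInv_le _ x

lemma bddAbove_levyOp (h : Admissible σ π) (f : 𝓢(E d, ℝ)) :
    BddAbove (range fun x => |levyOp σ π f x|) := by
  refine ⟨∫ ξ, ‖schwartzFourier f ξ * symbol σ π ξ‖, ?_⟩
  rintro _ ⟨x, rfl⟩
  exact abs_levyOp_le h f x

end Schwartz

/-! ### The semigroup on the Fourier side and its time derivative. -/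

section Semigroup

variable {d : ℕ} {σ : ℝ} {κ l : ℝ → ℝ} {π ν ρ μ₀ : Measure (E d)}

/-- `levyDensity` is a choice made separately for each t; joint measurability in time and space has
to come from the explicit Fourier formula, which agrees with it for t > 0. -/
lemma stronglyMeasurable_fourier_exp_mul_symbol (h : Admissible σ ρ) :
    StronglyMeasurable (fun q : ℝ × E d =>
      (𝓕 (fun ξ => Complex.exp (q.1 * symbol σ ρ ξ)) q.2).re) := by
  simp_rw [fourier_apply]
  have hc := continuous_symbol h
  have hcont : Continuous (fun w : (ℝ × E d) × E d =>
      Complex.exp ((-(2 * Real.pi * inner ℝ w.2 w.1.2) : ℝ) * Complex.I) *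
        Complex.exp (w.1.1 * symbol σ ρ w.2)) := by
    fun_prop
  exact Complex.continuous_re.comp_stronglyMeasurable
    hcont.stronglyMeasurable.integral_prod_right'

lemma levyDensity_eq_re (h : Admissible σ ρ)
    (hi : ∀ t : ℝ, 0 < t → Integrable (fun ξ => Complex.exp (t * symbol σ ρ ξ))) {t : ℝ}
    (ht : 0 < t) (x : E d) :
    levyDensity σ ρ t x = (𝓕 (fun ξ => Complex.exp (t * symbol σ ρ ξ)) x).re := by
  rw [← (isLevyDensity_levyDensity h ht.le (hi t ht)).eq_fourier (hi t ht), Complex.ofReal_re]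

/-- Joint integrability of the rescaled increment of the density in time and space. -/
lemma integrable_density_increment (hρ : Admissible σ ρ)
    (hi : ∀ t : ℝ, 0 < t → Integrable (fun ξ => Complex.exp (t * symbol σ ρ ξ))) {R K : ℝ}
    (hR : 0 < R) {h : E d}
    (hK : ∫⁻ t in Ioi (0 : ℝ), ∫⁻ x, ‖levyDensity σ ρ t (x + h) - levyDensity σ ρ t x‖ₑ
      ≤ ENNReal.ofReal K) :
    Integrable (fun q : ℝ × E d =>
        levyDensity σ ρ q.1 (R⁻¹ • q.2 + h) - levyDensity σ ρ q.1 (R⁻¹ • q.2))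
        ((volume.restrict (Ioi (0 : ℝ))).prod volume) ∧
      ∫⁻ q : ℝ × E d, ‖levyDensity σ ρ q.1 (R⁻¹ • q.2 + h) - levyDensity σ ρ q.1 (R⁻¹ • q.2)‖ₑ
        ∂((volume.restrict (Ioi (0 : ℝ))).prod volume) ≤ ENNReal.ofReal (R ^ d * K) := by
  have hsm := (stronglyMeasurable_fourier_exp_mul_symbol hρ).measurable
  have h1 : Measurable (fun q : ℝ × E d => (q.1, R⁻¹ • q.2 + h)) := by fun_prop
  have h2 : Measurable (fun q : ℝ × E d => (q.1, R⁻¹ • q.2)) := by fun_prop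
  have hmeas : AEStronglyMeasurable (fun q : ℝ × E d =>
      levyDensity σ ρ q.1 (R⁻¹ • q.2 + h) - levyDensity σ ρ q.1 (R⁻¹ • q.2))
      ((volume.restrict (Ioi (0 : ℝ))).prod volume) := by
    refine ⟨_, ((hsm.comp h1).sub (hsm.comp h2)).stronglyMeasurable, ?_⟩
    have hprod : (volume.restrict (Ioi (0 : ℝ))).prod (volume : Measure (E d))
        = (volume.prod volume).restrict (Ioi 0 ×ˢ univ) := by
      rw [← Measure.prod_restrict, Measure.restrict_univ]
    rw [hprod]
    refine ae_restrict_of_forall_mem (measurableSet_Ioi.prod MeasurableSet.univ) fun q hq => ?_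
    simp only [Pi.sub_apply, Function.comp_apply]
    rw [levyDensity_eq_re hρ hi hq.1, levyDensity_eq_re hρ hi hq.1]
  have hbound : ∫⁻ q : ℝ × E d,
      ‖levyDensity σ ρ q.1 (R⁻¹ • q.2 + h) - levyDensity σ ρ q.1 (R⁻¹ • q.2)‖ₑ
        ∂((volume.restrict (Ioi (0 : ℝ))).prod volume) ≤ ENNReal.ofReal (R ^ d * K) := by
    rw [lintegral_prod _ hmeas.enorm, ENNReal.ofReal_mul (by positivity)]
    calc ∫⁻ t in Ioi (0 : ℝ), ∫⁻ y, ‖levyDensity σ ρ t (R⁻¹ • y + h)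
            - levyDensity σ ρ t (R⁻¹ • y)‖ₑ
        = ∫⁻ t in Ioi (0 : ℝ), ENNReal.ofReal (R ^ d) *
            ∫⁻ x, ‖levyDensity σ ρ t (x + h) - levyDensity σ ρ t x‖ₑ := by
          refine setLIntegral_congr_fun measurableSet_Ioi fun t ht => ?_
          have hc := (isLevyDensity_levyDensity hρ (le_of_lt ht) (hi t ht)).continuous
          exact lintegral_comp_inv_smul hR
            (f := fun x => ‖levyDensity σ ρ t (x + h) - levyDensity σ ρ t x‖ₑ)
            (by have := hc.measurable; fun_prop)
      _ ≤ _ := by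
          rw [lintegral_const_mul' _ _ ENNReal.ofReal_ne_top]
          gcongr
  exact ⟨⟨hmeas, hbound.trans_lt ENNReal.ofReal_lt_top⟩, hbound⟩

lemma kernelIntegrand_one {z : E d} {t : ℝ} (ht : 0 < t) (y : E d) :
    kernelIntegrand σ κ π 1 y z t =
      levyDensity σ (rescaled κ π ‖z‖) t (‖z‖⁻¹ • y + ‖z‖⁻¹ • z)
        - levyDensity σ (rescaled κ π ‖z‖) t (‖z‖⁻¹ • y) := by
  rw [kernelIntegrand, Real.rpow_one, mul_div_cancel_left₀ _ ht.ne']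

lemma kernel_one (y z : E d) :
    kernel σ κ π 1 y z = κ ‖z‖ * (‖z‖ ^ d)⁻¹ * ∫ t in Ioi (0 : ℝ),
      (levyDensity σ (rescaled κ π ‖z‖) t (‖z‖⁻¹ • y + ‖z‖⁻¹ • z)
        - levyDensity σ (rescaled κ π ‖z‖) t (‖z‖⁻¹ • y)) := by
  rw [kernel, Real.rpow_one]
  congr 1
  exact setIntegral_congr_fun measurableSet_Ioi fun t ht => kernelIntegrand_one ht y

/-- By Fubini, averaging w + R·Z_t multiplies the transform by the characteristic function of Z_t at
Rξ. -/
lemma integral_fourierInv_mul_density {q : E d → ℝ} {t : ℝ} (hq : IsLevyDensity σ ρ t q)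
    {G : E d → ℂ} (hG : Integrable G) (R : ℝ) (w : E d) :
    ∫ u, 𝓕⁻ G (w + R • u) * (q u : ℂ) =
      ∫ ξ, Complex.exp ((2 * Real.pi * inner ℝ ξ w : ℝ) * Complex.I) *
        (G ξ * Complex.exp (t * symbol σ ρ (R • ξ))) := by
  have hintegrable : Integrable (fun p : E d × E d =>
      Complex.exp ((2 * Real.pi * inner ℝ p.2 (w + R • p.1) : ℝ) * Complex.I) *
        ((q p.1 : ℂ) * G p.2)) (volume.prod volume) :=
    integrable_cexp_mul ((hq.integrable.ofReal (𝕜 := ℂ)).mul_prod hG) (by fun_prop)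
  calc ∫ u, 𝓕⁻ G (w + R • u) * (q u : ℂ)
      = ∫ u, ∫ ξ, Complex.exp ((2 * Real.pi * inner ℝ ξ (w + R • u) : ℝ) * Complex.I) *
          ((q u : ℂ) * G ξ) := by
        congr 1 with u
        rw [fourierInv_apply, ← integral_mul_const]
        congr 1 with ξ
        ring
    _ = ∫ ξ, ∫ u, Complex.exp ((2 * Real.pi * inner ℝ ξ (w + R • u) : ℝ) * Complex.I) *
          ((q u : ℂ) * G ξ) := integral_integral_swap hintegrable
    _ = _ := by
        congr 1 with ξ
        rw [← hq.fourierInv_eq, fourierInv_apply, ← integral_const_mul, ← integral_const_mul]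
        congr 1 with u
        have hexp : Complex.exp ((2 * Real.pi * inner ℝ ξ (w + R • u) : ℝ) * Complex.I) =
            Complex.exp ((2 * Real.pi * inner ℝ ξ w : ℝ) * Complex.I) *
            Complex.exp ((2 * Real.pi * inner ℝ u (R • ξ) : ℝ) * Complex.I) := by
          rw [← Complex.exp_add, inner_add_right, real_inner_smul_right, real_inner_smul_right,
            real_inner_comm ξ u]
          push_cast
          ring_nf
        rw [hexp]
        ring

lemma integrable_fourierInv_mul {q : E d → ℝ} (hq : Integrable q) {G : E d → ℂ}
    (hG : Integrable G) (R : ℝ) (w : E d) :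
    Integrable (fun u => 𝓕⁻ G (w + R • u) * (q u : ℂ)) := by
  refine (hq.ofReal (𝕜 := ℂ)).bdd_mul (c := ∫ ξ, ‖G ξ‖) ?_
    (ae_of_all _ fun u => norm_fourierInv_le G _)
  have := continuous_fourierInv hG
  exact Continuous.aestronglyMeasurable (by fun_prop)

/-- The increment of the semigroup applied to an inverse Fourier transform. -/
lemma integral_fourierInv_mul_increment {q : E d → ℝ} {t : ℝ} (hq : IsLevyDensity σ ρ t q)
    {G : E d → ℂ} (hG : Integrable G) {R : ℝ} (hR : R ≠ 0) (x z : E d) :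
    ∫ u, 𝓕⁻ G (x + R • u) * ((q (u + R⁻¹ • (-z)) - q u : ℝ) : ℂ) =
      ∫ ξ, (Complex.exp ((2 * Real.pi * inner ℝ ξ (x + z) : ℝ) * Complex.I)
        - Complex.exp ((2 * Real.pi * inner ℝ ξ x : ℝ) * Complex.I)) * G ξ
        * Complex.exp (t * symbol σ ρ (R • ξ)) := by
  -- Translation of the integration variable moves the shift -z/R from the density to a shift +z of
  -- the function. This is why the kernel is evaluated at -z.
  have hshift : ∀ u, 𝓕⁻ G (x + R • u) * (q (u + R⁻¹ • (-z)) : ℂ) =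
      (fun v => 𝓕⁻ G ((x + z) + R • v) * (q v : ℂ)) (u + R⁻¹ • (-z)) := by
    intro u
    have : x + z + R • (u + R⁻¹ • (-z)) = x + R • u := by
      rw [smul_add, smul_inv_smul₀ hR]; abel
    simp only [this]
  have i1 : Integrable (fun u => 𝓕⁻ G (x + R • u) * (q (u + R⁻¹ • (-z)) : ℂ)) :=
    integrable_fourierInv_mul (hq.integrable.comp_add_right _) hG R x
  have i2 := integrable_fourierInv_mul hq.integrable hG R x
  have hE : ∀ w : E d, Integrable (fun ξ =>
      Complex.exp ((2 * Real.pi * inner ℝ ξ w : ℝ) * Complex.I) *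
        (G ξ * Complex.exp (t * symbol σ ρ (R • ξ)))) := by
    intro w
    refine integrable_cexp_mul ?_ (by fun_prop)
    refine hG.mul_bdd (c := 1) ?_ (ae_of_all _ fun ξ => ?_)
    · have hc : Continuous (𝓕⁻ fun x => (q x : ℂ)) :=
        continuous_fourierInv hq.integrable.ofReal
      simp_rw [← hq.fourierInv_eq]
      exact Continuous.aestronglyMeasurable (by fun_prop)
    · rw [← hq.charFun_eq]
      have := hq.prob
      exact norm_charFun_le_one _
  simp_rw [Complex.ofReal_sub, mul_sub]
  rw [integral_sub i1 i2]
  simp_rw [hshift]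
  rw [integral_add_right_eq_self (fun v => 𝓕⁻ G ((x + z) + R • v) * (q v : ℂ)),
    integral_fourierInv_mul_density hq hG, integral_fourierInv_mul_density hq hG,
    ← integral_sub (hE _) (hE _)]
  congr 1 with ξ
  ring

lemma norm_integral_fourierInv_mul_increment_le {q : E d → ℝ} {t : ℝ}
    (hq : IsLevyDensity σ ρ t q) (G : E d → ℂ) (R : ℝ) (x h : E d) :
    ‖∫ u, 𝓕⁻ G (x + R • u) * ((q (u + h) - q u : ℝ) : ℂ)‖ ≤
      (∫ ξ, ‖G ξ‖) * (∫⁻ u, ‖q (u + h) - q u‖ₑ).toReal := by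
  have hi : Integrable (fun u => q (u + h) - q u) :=
    (hq.integrable.comp_add_right h).sub hq.integrable
  rw [← integral_norm_eq_lintegral_enorm hi.1, ← integral_const_mul]
  refine norm_integral_le_of_norm_le (hi.norm.const_mul _) (ae_of_all _ fun u => ?_)
  rw [norm_mul, Complex.norm_real]
  gcongr
  exact norm_fourierInv_le G _

lemma norm_exp_mul_le_one {t : ℝ} (ht : 0 ≤ t) {a : ℂ} (ha : a.re ≤ 0) :
    ‖Complex.exp (t * a)‖ ≤ 1 := by
  rw [Complex.norm_exp, Real.exp_le_one_iff, Complex.re_ofReal_mul]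
  exact mul_nonpos_of_nonneg_of_nonpos ht ha

lemma continuousWithinAt_integral_exp {G Ψ : E d → ℂ} (hG : Integrable G) (hΨ : Continuous Ψ)
    (hre : ∀ ξ, (Ψ ξ).re ≤ 0) :
    ContinuousWithinAt (fun t : ℝ => ∫ ξ, G ξ * Complex.exp (t * Ψ ξ)) (Ici 0) 0 := by
  refine continuousWithinAt_of_dominated (bound := fun ξ => ‖G ξ‖) ?_ ?_ hG.norm ?_
  · exact Eventually.of_forall fun t =>
      hG.1.mul (Continuous.aestronglyMeasurable (by fun_prop))
  · filter_upwards [self_mem_nhdsWithin] with t ht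
    refine ae_of_all _ fun ξ => ?_
    rw [norm_mul]
    exact mul_le_of_le_one_right (norm_nonneg _) (norm_exp_mul_le_one ht (hre ξ))
  · exact ae_of_all _ fun ξ => Continuous.continuousWithinAt (by fun_prop)

lemma hasDerivAt_integral_exp {G Ψ : E d → ℂ} (hG : Integrable G) (hΨ : Continuous Ψ)
    (hre : ∀ ξ, (Ψ ξ).re ≤ 0) (hGΨ : Integrable fun ξ => G ξ * Ψ ξ) {t : ℝ} (ht : 0 < t) :
    HasDerivAt (fun t : ℝ => ∫ ξ, G ξ * Complex.exp (t * Ψ ξ))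
      (∫ ξ, G ξ * Ψ ξ * Complex.exp (t * Ψ ξ)) t := by
  refine (hasDerivAt_integral_of_dominated_loc_of_deriv_le (μ := volume)
    (F := fun (t : ℝ) (ξ : E d) => G ξ * Complex.exp (t * Ψ ξ))
    (F' := fun (t : ℝ) (ξ : E d) => G ξ * Ψ ξ * Complex.exp (t * Ψ ξ))
    (bound := fun ξ => ‖G ξ * Ψ ξ‖) (Ioi_mem_nhds ht) ?_ ?_ ?_ ?_ hGΨ.norm ?_).2
  · exact Eventually.of_forall fun t =>
      hG.1.mul (Continuous.aestronglyMeasurable (by fun_prop))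
  · refine hG.mul_bdd (c := 1) (Continuous.aestronglyMeasurable (by fun_prop))
      (ae_of_all _ fun ξ => norm_exp_mul_le_one ht.le (hre ξ))
  · exact hGΨ.1.mul (Continuous.aestronglyMeasurable (by fun_prop))
  · refine ae_of_all _ fun ξ s hs => ?_
    rw [norm_mul]
    exact mul_le_of_le_one_right (norm_nonneg _) (norm_exp_mul_le_one (le_of_lt hs) (hre ξ))
  · refine ae_of_all _ fun ξ s _ => ?_
    have h1 : HasDerivAt (fun s : ℝ => (s : ℂ) * Ψ ξ) (Ψ ξ) s := by
      simpa using (Complex.ofRealCLM.hasDerivAt (x := s)).mul_const (Ψ ξ)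
    convert! h1.cexp.const_mul (G ξ) using 1
    ring

end Semigroup

/-! ### Integrability of the kernel and the representation formula. -/

section Kernel

variable {d : ℕ} {σ : ℝ} {κ l : ℝ → ℝ} {π ν ρ μ₀ : Measure (E d)}

lemma norm_inv_smul {z : E d} (hz : z ≠ 0) : ‖‖z‖⁻¹ • z‖ = 1 := by
  rw [norm_smul, norm_inv, norm_norm, inv_mul_cancel₀ (norm_ne_zero_iff.2 hz)]

lemma ae_integrableOn_kernelIntegrand {z : E d} {K : ℝ} (hz : z ≠ 0)
    (hρ : Admissible σ (rescaled κ π ‖z‖))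
    (hi : ∀ t : ℝ, 0 < t → Integrable (fun ξ => Complex.exp (t * symbol σ (rescaled κ π ‖z‖) ξ)))
    (hK : ∫⁻ t in Ioi (0 : ℝ), ∫⁻ x, ‖levyDensity σ (rescaled κ π ‖z‖) t (x + ‖z‖⁻¹ • z)
      - levyDensity σ (rescaled κ π ‖z‖) t x‖ₑ ≤ ENNReal.ofReal K) :
    ∀ᵐ y, IntegrableOn (kernelIntegrand σ κ π 1 y z) (Ioi 0) := by
  filter_upwards [(integrable_density_increment hρ hi (norm_pos_iff.2 hz) hK).1.prod_left_ae]
    with y hy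
  exact hy.congr (ae_restrict_of_forall_mem measurableSet_Ioi fun t ht =>
    (kernelIntegrand_one ht y).symm)

lemma integrable_kernel {z : E d} {K : ℝ} (hz : z ≠ 0)
    (hρ : Admissible σ (rescaled κ π ‖z‖))
    (hi : ∀ t : ℝ, 0 < t → Integrable (fun ξ => Complex.exp (t * symbol σ (rescaled κ π ‖z‖) ξ)))
    (hK : ∫⁻ t in Ioi (0 : ℝ), ∫⁻ x, ‖levyDensity σ (rescaled κ π ‖z‖) t (x + ‖z‖⁻¹ • z)
      - levyDensity σ (rescaled κ π ‖z‖) t x‖ₑ ≤ ENNReal.ofReal K) :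
    Integrable (fun y => kernel σ κ π 1 y z) := by
  simp_rw [kernel_one]
  exact (integrable_density_increment hρ hi (norm_pos_iff.2 hz) hK).1.integral_prod_right.const_mul _

/-- The substitution y = |z|u gives a factor |z|^d that cancels the prefactor |z|^{-d} of the
kernel, leaving κ(|z|) times the uniform bound K. -/
lemma integral_abs_kernel_le {z : E d} {K : ℝ} (hκ : IsScalingFunction κ l) (hz : z ≠ 0)
    (hρ : Admissible σ (rescaled κ π ‖z‖))
    (hi : ∀ t : ℝ, 0 < t → Integrable (fun ξ => Complex.exp (t * symbol σ (rescaled κ π ‖z‖) ξ)))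
    (hK : ∫⁻ t in Ioi (0 : ℝ), ∫⁻ x, ‖levyDensity σ (rescaled κ π ‖z‖) t (x + ‖z‖⁻¹ • z)
      - levyDensity σ (rescaled κ π ‖z‖) t x‖ₑ ≤ ENNReal.ofReal K)
    (hK0 : 0 ≤ K) : ∫ y, |kernel σ κ π 1 y z| ≤ K * κ ‖z‖ := by
  have hR := norm_pos_iff.2 hz
  obtain ⟨h1, h2⟩ := integrable_density_increment hρ hi hR hK
  have hκz := hκ.pos _ hR
  simp_rw [kernel_one, abs_mul, abs_inv, abs_of_pos hκz, abs_of_pos (pow_pos hR d)]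
  rw [integral_const_mul]
  have h3 := integral_norm_eq_lintegral_enorm h1.1
  rw [integral_prod_symm _ h1.norm] at h3
  have h4 : ∫ y, |∫ t in Ioi (0 : ℝ),
      (levyDensity σ (rescaled κ π ‖z‖) t (‖z‖⁻¹ • y + ‖z‖⁻¹ • z)
        - levyDensity σ (rescaled κ π ‖z‖) t (‖z‖⁻¹ • y))| ≤ ‖z‖ ^ d * K := by
    calc _ ≤ ∫ y, ∫ t in Ioi (0 : ℝ),
        ‖levyDensity σ (rescaled κ π ‖z‖) t (‖z‖⁻¹ • y + ‖z‖⁻¹ • z)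
        - levyDensity σ (rescaled κ π ‖z‖) t (‖z‖⁻¹ • y)‖ := by
          refine integral_mono h1.integral_prod_right.norm h1.norm.integral_prod_right fun y => ?_
          show |_| ≤ _
          rw [← Real.norm_eq_abs]
          exact norm_integral_le_integral_norm _
      _ ≤ _ := by
          rw [h3]
          exact ENNReal.toReal_le_of_le_ofReal (by positivity) h2
  calc _ ≤ κ ‖z‖ * (‖z‖ ^ d)⁻¹ * (‖z‖ ^ d * K) := by gcongr
    _ = _ := by field_simp

/-- Joint integrability in (t, y) allows Fubini against a bounded g; the substitution y = |z|u then
removes the factor |z|^{-d}. -/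
lemma integral_mul_kernel {z : E d} {K : ℝ} (hz : z ≠ 0)
    (hρ : Admissible σ (rescaled κ π ‖z‖))
    (hi : ∀ t : ℝ, 0 < t → Integrable (fun ξ => Complex.exp (t * symbol σ (rescaled κ π ‖z‖) ξ)))
    (hK : ∫⁻ t in Ioi (0 : ℝ), ∫⁻ x, ‖levyDensity σ (rescaled κ π ‖z‖) t (x + ‖z‖⁻¹ • z)
      - levyDensity σ (rescaled κ π ‖z‖) t x‖ₑ ≤ ENNReal.ofReal K)
    {g : E d → ℝ} (hg : Continuous g) {M : ℝ} (hM : ∀ y, |g y| ≤ M) :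
    ∫ y, g y * kernel σ κ π 1 y z = κ ‖z‖ * ∫ t in Ioi (0 : ℝ), ∫ u, g (‖z‖ • u) *
      (levyDensity σ (rescaled κ π ‖z‖) t (u + ‖z‖⁻¹ • z)
        - levyDensity σ (rescaled κ π ‖z‖) t u) := by
  have hR := norm_pos_iff.2 hz
  have h1 := (integrable_density_increment hρ hi hR hK).1
  have h2 : Integrable (fun q : ℝ × E d => g q.2 *
      (levyDensity σ (rescaled κ π ‖z‖) q.1 (‖z‖⁻¹ • q.2 + ‖z‖⁻¹ • z)
        - levyDensity σ (rescaled κ π ‖z‖) q.1 (‖z‖⁻¹ • q.2)))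
      ((volume.restrict (Ioi (0 : ℝ))).prod volume) :=
    h1.bdd_mul (c := M) (Continuous.aestronglyMeasurable (by fun_prop))
      (ae_of_all _ fun q => hM q.2)
  have h3 := integral_integral_swap (f := fun (t : ℝ) (y : E d) => g y *
      (levyDensity σ (rescaled κ π ‖z‖) t (‖z‖⁻¹ • y + ‖z‖⁻¹ • z)
        - levyDensity σ (rescaled κ π ‖z‖) t (‖z‖⁻¹ • y))) h2
  simp_rw [integral_const_mul] at h3
  calc ∫ y, g y * kernel σ κ π 1 y z
      = κ ‖z‖ * (‖z‖ ^ d)⁻¹ * ∫ y, g y * ∫ t in Ioi (0 : ℝ),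
        (levyDensity σ (rescaled κ π ‖z‖) t (‖z‖⁻¹ • y + ‖z‖⁻¹ • z)
        - levyDensity σ (rescaled κ π ‖z‖) t (‖z‖⁻¹ • y)) := by
        rw [← integral_const_mul]
        congr 1 with y
        rw [kernel_one]
        ring
    _ = _ := by
        rw [← h3, mul_assoc, ← integral_const_mul]
        congr 2
        ext t
        have h5 := Measure.integral_comp_smul (volume : Measure (E d)) (fun u => g (‖z‖ • u) *
          (levyDensity σ (rescaled κ π ‖z‖) t (u + ‖z‖⁻¹ • z)
            - levyDensity σ (rescaled κ π ‖z‖) t u)) ‖z‖⁻¹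
        simp_rw [smul_inv_smul₀ hR.ne'] at h5
        rw [h5, finrank_euclideanSpace_fin, inv_pow, inv_inv, abs_of_pos (pow_pos hR d), smul_eq_mul,
          inv_mul_cancel_left₀ (pow_pos hR d).ne']

lemma integrableOn_integral_mul_increment {z : E d} {K : ℝ}
    (hρ : Admissible σ (rescaled κ π ‖z‖))
    (hi : ∀ t : ℝ, 0 < t → Integrable (fun ξ => Complex.exp (t * symbol σ (rescaled κ π ‖z‖) ξ)))
    (hK : ∫⁻ t in Ioi (0 : ℝ), ∫⁻ x, ‖levyDensity σ (rescaled κ π ‖z‖) t (x + ‖z‖⁻¹ • z)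
      - levyDensity σ (rescaled κ π ‖z‖) t x‖ₑ ≤ ENNReal.ofReal K)
    {g : E d → ℝ} (hg : Continuous g) {M : ℝ}
    (hM : ∀ y, |g y| ≤ M) :
    IntegrableOn (fun t => ∫ u, g (‖z‖ • u) *
      (levyDensity σ (rescaled κ π ‖z‖) t (u + ‖z‖⁻¹ • z)
        - levyDensity σ (rescaled κ π ‖z‖) t u)) (Ioi 0) := by
  have h1 := (integrable_density_increment (R := 1) hρ hi one_pos hK).1
  simp only [inv_one, one_smul] at h1
  exact (h1.bdd_mul (c := M) (f := fun q : ℝ × E d => g (‖z‖ • q.2))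
    (Continuous.aestronglyMeasurable (by fun_prop)) (ae_of_all _ fun q => hM _)).integral_prod_left

/-- The representation of the increments of a Schwartz function through `L^π` and the kernel. -/
lemma increment_eq {z : E d} {K : ℝ} (hκ : IsScalingFunction κ l) (hz : z ≠ 0)
    (hπ : IsLevyMeasure σ π) (hadm : Admissible σ π) (hρ : Admissible σ (rescaled κ π ‖z‖))
    (hi : ∀ t : ℝ, 0 < t → Integrable (fun ξ => Complex.exp (t * symbol σ (rescaled κ π ‖z‖) ξ)))
    (hK : ∫⁻ t in Ioi (0 : ℝ), ∫⁻ x, ‖levyDensity σ (rescaled κ π ‖z‖) t (x + ‖z‖⁻¹ • (-z))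
      - levyDensity σ (rescaled κ π ‖z‖) t x‖ₑ ≤ ENNReal.ofReal K)
    (hlim : Tendsto (fun t => ∫⁻ x, ‖levyDensity σ (rescaled κ π ‖z‖) t (x + ‖z‖⁻¹ • (-z))
        - levyDensity σ (rescaled κ π ‖z‖) t x‖ₑ) atTop (𝓝 0))
    (f : 𝓢(E d, ℝ)) (x : E d) :
    f (x + z) - f x = -∫ y, levyOp σ π f (x - y) * kernel σ κ π 1 (-y) (-z) := by
  have hR := norm_pos_iff.2 hz
  have hnz := neg_ne_zero.2 hz
  have hρ' : Admissible σ (rescaled κ π ‖-z‖) := by rwa [norm_neg]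
  have hi' : ∀ t : ℝ, 0 < t →
      Integrable (fun ξ => Complex.exp (t * symbol σ (rescaled κ π ‖-z‖) ξ)) := by rwa [norm_neg]
  have hK' : ∫⁻ t in Ioi (0 : ℝ), ∫⁻ x,
      ‖levyDensity σ (rescaled κ π ‖-z‖) t (x + ‖-z‖⁻¹ • (-z))
      - levyDensity σ (rescaled κ π ‖-z‖) t x‖ₑ ≤ ENNReal.ofReal K := by rwa [norm_neg]
  have hgc : Continuous fun y => levyOp σ π f (x + y) := by
    have := continuous_levyOp hadm f
    fun_prop
  have hdens : ∀ t : ℝ, 0 < t → IsLevyDensity σ (rescaled κ π ‖z‖) t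
      (levyDensity σ (rescaled κ π ‖z‖) t) :=
    fun t ht => isLevyDensity_levyDensity hρ ht.le (hi t ht)
  have hker := integral_mul_kernel hnz hρ' hi' hK' hgc fun y => abs_levyOp_le hadm f (x + y)
  have hInt := integrableOn_integral_mul_increment hρ' hi' hK' hgc
    fun y => abs_levyOp_le hadm f (x + y)
  simp only [norm_neg] at hker hInt
  set s : ℝ → ℝ := fun t => ∫ u, levyOp σ π f (x + ‖z‖ • u) *
      (levyDensity σ (rescaled κ π ‖z‖) t (u + ‖z‖⁻¹ • (-z))
        - levyDensity σ (rescaled κ π ‖z‖) t u) with hs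
  have hswap : ∫ y, levyOp σ π f (x - y) * kernel σ κ π 1 (-y) (-z)
      = ∫ y, levyOp σ π f (x + y) * kernel σ κ π 1 y (-z) := by
    rw [← integral_neg_eq_self]
    simp
  set F := schwartzFourier f
  set Ψ : E d → ℂ := fun ξ => κ ‖z‖ * symbol σ π ξ with hΨ
  have hΨc : Continuous Ψ := continuous_const.mul (continuous_symbol hadm)
  have hΨre : ∀ ξ, (Ψ ξ).re ≤ 0 := fun ξ => by
    rw [hΨ, Complex.re_ofReal_mul]
    exact mul_nonpos_of_nonneg_of_nonpos (hκ.pos _ hR).le (symbol_re_nonpos hadm ξ)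
  have hsym : ∀ ξ, symbol σ (rescaled κ π ‖z‖) (‖z‖ • ξ) = Ψ ξ := fun ξ =>
    symbol_rescaled hπ hadm hR (hκ.pos _ hR).le ξ
  set e : E d → ℂ := fun ξ => Complex.exp ((2 * Real.pi * inner ℝ ξ (x + z) : ℝ) * Complex.I)
        - Complex.exp ((2 * Real.pi * inner ℝ ξ x : ℝ) * Complex.I) with he
  have hei : ∀ {G : E d → ℂ}, Integrable G → Integrable fun ξ => e ξ * G ξ := by
    intro G hG
    simp_rw [he, sub_mul]
    exact (integrable_cexp_mul hG (by fun_prop)).sub (integrable_cexp_mul hG (by fun_prop))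
  have hF : Integrable F := integrable_schwartzFourier f
  have hFs : Integrable fun ξ => F ξ * symbol σ π ξ := integrable_schwartzFourier_mul_symbol hadm f
  have hG : Integrable fun ξ => e ξ * F ξ := hei hF
  have hGΨ : Integrable fun ξ => e ξ * F ξ * Ψ ξ :=
    ((hei hFs).const_mul (κ ‖z‖ : ℂ)).congr (ae_of_all _ fun ξ => by simp only [hΨ]; ring)
  -- The time derivative of the semigroup increment equals κ(|z|) times the pairing of L^π f with
  -- the increment of the density.
  have hsS : ∀ t : ℝ, 0 < t → ∫ ξ, e ξ * F ξ * Ψ ξ * Complex.exp (t * Ψ ξ)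
      = ((κ ‖z‖ * s t : ℝ) : ℂ) := by
    intro t ht
    rw [Complex.ofReal_mul, hs, ← integral_complex_ofReal]
    simp_rw [Complex.ofReal_mul, levyOp_eq_fourierInv hadm]
    rw [integral_fourierInv_mul_increment (hdens t ht) hFs hR.ne', ← integral_const_mul]
    congr 1 with ξ
    rw [hsym]
    simp only [hΨ, he]
    ring
  -- Fundamental theorem of calculus on (0,∞): the value at t = 0 is f(x+z) - f(x) by Fourier
  -- inversion, and the limit at infinity is 0.
  have hftc := integral_Ioi_of_hasDerivAt_of_tendsto (a := 0) (m := 0)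
    (f := fun t : ℝ => ∫ ξ, e ξ * F ξ * Complex.exp (t * Ψ ξ))
    (f' := fun t : ℝ => ∫ ξ, e ξ * F ξ * Ψ ξ * Complex.exp (t * Ψ ξ))
    (continuousWithinAt_integral_exp hG hΨc hΨre)
    (fun t ht => hasDerivAt_integral_exp hG hΨc hΨre hGΨ ht) ?_ ?_
  · have h0 : ∫ ξ, e ξ * F ξ * Complex.exp (((0 : ℝ) : ℂ) * Ψ ξ) = ((f (x + z) - f x : ℝ) : ℂ) := by
      rw [Complex.ofReal_sub, ← fourierInv_schwartzFourier, ← fourierInv_schwartzFourier,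
        fourierInv_apply, fourierInv_apply, ← integral_sub (integrable_cexp_mul hF (by fun_prop))
          (integrable_cexp_mul hF (by fun_prop))]
      congr 1 with ξ
      rw [Complex.ofReal_zero, zero_mul, Complex.exp_zero, mul_one, he, sub_mul]
    have h1 : ∫ t in Ioi (0 : ℝ), ∫ ξ, e ξ * F ξ * Ψ ξ * Complex.exp (t * Ψ ξ)
        = ((κ ‖z‖ * ∫ t in Ioi (0 : ℝ), s t : ℝ) : ℂ) := by
      rw [← integral_const_mul, ← integral_complex_ofReal]
      exact setIntegral_congr_fun measurableSet_Ioi fun t ht => hsS t ht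
    rw [h1, h0, zero_sub, ← Complex.ofReal_neg] at hftc
    rw [hswap, hker, Complex.ofReal_injective hftc, neg_neg]
  · refine IntegrableOn.congr_fun (f := fun t => ((κ ‖z‖ * s t : ℝ) : ℂ)) ?_
      (fun t ht => (hsS t ht).symm) measurableSet_Ioi
    exact (hInt.const_mul _).ofReal
  -- At infinite time the semigroup increment is at most the L¹ norm of the transform of f times the
  -- L¹ increment of the density, which tends to 0.
  · have hb : Tendsto (fun t => (∫ ξ, ‖F ξ‖) * (∫⁻ x,
        ‖levyDensity σ (rescaled κ π ‖z‖) t (x + ‖z‖⁻¹ • (-z))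
        - levyDensity σ (rescaled κ π ‖z‖) t x‖ₑ).toReal) atTop (𝓝 0) := by
      simpa using ((ENNReal.tendsto_toReal ENNReal.zero_ne_top).comp hlim).const_mul (∫ ξ, ‖F ξ‖)
    refine squeeze_zero_norm' ?_ hb
    filter_upwards [eventually_gt_atTop 0] with t ht
    refine le_trans (le_of_eq ?_)
      (norm_integral_fourierInv_mul_increment_le (hdens t ht) F ‖z‖ x (‖z‖⁻¹ • (-z)))
    rw [integral_fourierInv_mul_increment (hdens t ht) hF hR.ne']
    simp_rw [hsym]
    rfl

end Kernel

/-- The hypotheses on the auxiliary measure, in the form used below. -/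
lemma exists_auxiliary_measure {d : ℕ} {σ : ℝ} {κ : ℝ → ℝ} {π : Measure (E d)}
    (hD : AssumptionD σ κ π)
    (hadm : ∀ R, 0 < R → Admissible σ (rescaled κ π R)) :
    ∃ μ₀ : Measure (E d), (∀ R, 0 < R → μ₀ ≤ rescaled κ π R) ∧ Admissible σ μ₀ ∧
      Integrable (fun ξ => Complex.exp (symbol σ μ₀ ξ)) ∧
      ContDiff ℝ 1 (𝓕 fun ξ => Complex.exp (symbol σ μ₀ ξ)) ∧
      Integrable (fderiv ℝ (𝓕 fun ξ => Complex.exp (symbol σ μ₀ ξ))) := by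
  obtain ⟨μ₀, n₀, c₁, hA, hle, -⟩ := hD
  rw [hA.support] at hle
  -- The order σ' of μ₀ may differ from σ; admissibility for σ itself is inherited through
  -- domination by the rescaled measure at R = 1.
  have hμ₀ : Admissible σ μ₀ := (hadm 1 one_pos).mono (hle 1 one_pos)
  have hb := ENNReal.add_lt_top.1 (hA.bound.trans_lt ENNReal.ofReal_lt_top)
  have h2 : Integrable (fun y : E d => ‖y‖ ^ 2) μ₀ := by
    refine ⟨Continuous.aestronglyMeasurable (by fun_prop), ?_⟩
    rw [hasFiniteIntegral_iff_ofReal (ae_of_all _ fun y => by positivity)]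
    exact hb.1
  exact ⟨μ₀, hle, hμ₀, smooth_aux_density hμ₀ hA.support h2 hb.2⟩

end LevyIncrement

end

/-! ### The main theorem. -/

open LevyIncrement

theorem mainTheorem7 (d : ℕ) (σ : ℝ) (hσ : σ ∈ Set.Ioo (0 : ℝ) 2)
    (π : Measure (LevyIncrement.E d)) (hπ : LevyIncrement.IsLevyMeasure σ π)
    (κ l : ℝ → ℝ) (hκ : LevyIncrement.IsScalingFunction κ l)
    (hD : LevyIncrement.AssumptionD σ κ π) (hB : LevyIncrement.AssumptionB σ κ π)
    (hγ : IntegrableOn (fun t => (LevyIncrement.scalingInv l t)⁻¹) (Set.Ioi 1)) :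
    -- the objects are well defined
    (∀ R > 0, ∀ t > 0, LevyIncrement.IsLevyDensity σ (LevyIncrement.rescaled κ π R) t
      (LevyIncrement.levyDensity σ (LevyIncrement.rescaled κ π R) t)) ∧
    (∀ z : LevyIncrement.E d, z ≠ 0 →
      (∀ᵐ y, IntegrableOn (LevyIncrement.kernelIntegrand σ κ π 1 y z) (Set.Ioi 0)) ∧
      Integrable (fun y => LevyIncrement.kernel σ κ π 1 y z)) ∧
    -- the representation of increments
    (∃ c : ℝ, 0 < c ∧ ∀ (f : 𝓢(LevyIncrement.E d, ℝ)) (x z : LevyIncrement.E d), z ≠ 0 →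
      Integrable (fun y =>
        LevyIncrement.levyOp σ π f (x - y) * LevyIncrement.kernel σ κ π 1 (-y) (-z)) ∧
      f (x + z) - f x =
        -c * ∫ y, LevyIncrement.levyOp σ π f (x - y) * LevyIncrement.kernel σ κ π 1 (-y) (-z)) ∧
    -- the estimate of increments
    (∃ C : ℝ, 0 < C ∧ ∀ f : 𝓢(LevyIncrement.E d, ℝ),
      BddAbove (Set.range fun x => |LevyIncrement.levyOp σ π f x|) ∧
      ∀ x z : LevyIncrement.E d, z ≠ 0 →
        |f (x + z) - f x| ≤ C * (⨆ w, |LevyIncrement.levyOp σ π f w|) * κ ‖z‖) := by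
  have hadm : ∀ R, 0 < R → Admissible σ (rescaled κ π R) := fun R hR =>
    admissible_rescaled hπ hB hR
  have hadmπ : Admissible σ π := admissible_of_rescaled (hκ.pos 1 one_pos) (hadm 1 one_pos)
  obtain ⟨μ₀, hle, hμ₀, hi, hsm, hgrad⟩ := exists_auxiliary_measure hD hadm
  have hintegrable : ∀ R, 0 < R → ∀ t : ℝ, 0 < t →
      Integrable (fun ξ => Complex.exp (t * symbol σ (rescaled κ π R) ξ)) := fun R hR t ht =>
    integrable_exp_mul_symbol hκ hle hR ht (hadm R hR) hμ₀ hi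
  obtain ⟨K, hK0, hK⟩ := exists_lintegral_increment_le hκ hle hadm hμ₀ hi hsm hgrad hγ
  have hKz : ∀ z : E d, z ≠ 0 → ∫⁻ t in Ioi (0 : ℝ), ∫⁻ x,
      ‖levyDensity σ (rescaled κ π ‖z‖) t (x + ‖z‖⁻¹ • z)
      - levyDensity σ (rescaled κ π ‖z‖) t x‖ₑ ≤ ENNReal.ofReal K := fun z hz =>
    hK _ (norm_pos_iff.2 hz) _ (norm_inv_smul hz)
  have hker : ∀ z : E d, z ≠ 0 → Integrable (fun y => kernel σ κ π 1 y z) := fun z hz =>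
    integrable_kernel hz (hadm _ (norm_pos_iff.2 hz)) (hintegrable _ (norm_pos_iff.2 hz)) (hKz z hz)
  have hprod : ∀ (f : 𝓢(E d, ℝ)) (x z : E d), z ≠ 0 →
      Integrable (fun y => levyOp σ π f (x - y) * kernel σ κ π 1 (-y) (-z)) := fun f x z hz => by
    have hc := continuous_levyOp hadmπ f
    exact (hker (-z) (neg_ne_zero.2 hz)).comp_neg.bdd_mul
      (Continuous.aestronglyMeasurable (by fun_prop))
      (ae_of_all _ fun y => abs_levyOp_le hadmπ f (x - y))
  have hrep : ∀ (f : 𝓢(E d, ℝ)) (x z : E d), z ≠ 0 →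
      f (x + z) - f x = -∫ y, levyOp σ π f (x - y) * kernel σ κ π 1 (-y) (-z) := fun f x z hz => by
    have hR := norm_pos_iff.2 hz
    have hunit : ‖‖z‖⁻¹ • (-z)‖ = 1 := by rw [smul_neg, norm_neg, norm_inv_smul hz]
    exact increment_eq hκ hz hπ hadmπ (hadm _ hR) (hintegrable _ hR) (hK _ hR _ hunit)
      (tendsto_lintegral_increment hκ hle hR (hadm _ hR) hμ₀ hi hsm hgrad hunit) f x
  -- The representation holds with c = 1, and C is the uniform bound K on the time-integrated L¹
  -- increments.
  refine ⟨fun R hR t ht => isLevyDensity_levyDensity (hadm R hR) (le_of_lt ht) (hintegrable R hR t ht),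
    fun z hz => ⟨?_, hker z hz⟩, ⟨1, one_pos, fun f x z hz => ⟨hprod f x z hz, ?_⟩⟩,
    ⟨K, hK0, fun f => ⟨bddAbove_levyOp hadmπ f, fun x z hz => ?_⟩⟩⟩
  · exact ae_integrableOn_kernelIntegrand hz (hadm _ (norm_pos_iff.2 hz))
      (hintegrable _ (norm_pos_iff.2 hz)) (hKz z hz)
  · rw [hrep f x z hz, neg_one_mul]
  · have hz' := neg_ne_zero.2 hz
    have hR' := norm_pos_iff.2 hz'
    have hS : ∀ w, |levyOp σ π f w| ≤ ⨆ w, |levyOp σ π f w| := le_ciSup (bddAbove_levyOp hadmπ f)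
    rw [hrep f x z hz, abs_neg, ← Real.norm_eq_abs]
    calc ‖∫ y, levyOp σ π f (x - y) * kernel σ κ π 1 (-y) (-z)‖
        ≤ ∫ y, (⨆ w, |levyOp σ π f w|) * |kernel σ κ π 1 (-y) (-z)| := by
          refine norm_integral_le_of_norm_le ((hker _ hz').comp_neg.abs.const_mul _)
            (ae_of_all _ fun y => ?_)
          rw [norm_mul, Real.norm_eq_abs, Real.norm_eq_abs]
          gcongr
          exact hS _
      _ = (⨆ w, |levyOp σ π f w|) * ∫ y, |kernel σ κ π 1 y (-z)| := by
          rw [integral_const_mul, integral_neg_eq_self (fun y => |kernel σ κ π 1 y (-z)|)]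
      _ ≤ (⨆ w, |levyOp σ π f w|) * (K * κ ‖-z‖) := by
          gcongr
          · exact (abs_nonneg _).trans (hS 0)
          · exact integral_abs_kernel_le hκ hz' (hadm _ hR') (hintegrable _ hR') (hKz _ hz') hK0.le
      _ = _ := by rw [norm_neg]; ring
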